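/- Strings are over $\Sigma=\{0,1\}$; $\mathrm{FP}$ is the class of functions computable in polynomial time by deterministic Turing machines (integers are written in binary), $\langle\cdot,\cdot\rangle$ is a standard pairing function, and $\mathrm{GapP}$ is the class of functions $g:\Sigma^*\to\mathbb Z$ for which there is a nondeterministic polynomial-time Turing machine $N$ such that, for every $x$, $g(x)$ is the number of accepting computation paths of $N$ on $x$ minus the number of rejecting computation paths of $N$ on $x$. $\mathrm{WPP}$ is the class of all $A\subseteq\Sigma^*$ for which there are $g\in\mathrm{GapP}$ and $f:\Sigma^*\to\mathbb Z\setminus\{0\}$ in $\mathrm{FP}$ such that, for all $x\in\Sigma^*$, $g(x)=f(x)$ if $x\in A$ and $g(x)=0$ if $x\notin A$. $\mathrm{LWPP}$ is defined in the same way, but with $f:0^*\to\mathbb Z\setminus\{0\}$ in $\mathrm{FP}$ and with $g(x)=f(0^{|x|})$ if $x\in A$. For $r:\mathbb N\to\mathbb N$, $r\text{-}\mathrm{LWPP}$ is the class of all $A\subseteq\Sigma^*$ for which there are $g\in\mathrm{GapP}$ and $f\in\mathrm{FP}$ with values in $\mathbb Z\setminus\{0\}$ such that, for all $x\in\Sigma^*$: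 if $x\in A$, then $g(x)=f(\langle 0^{|x|},i\rangle)$ for some $i\in\{1,\dots,r(|x|)\}$, and if $x\notin A$, then $g(x)=0$. Let $\mathit{Poly}\text{-}\mathrm{LWPP}=\bigcup_{c\ge 1}(n^c+c)\text{-}\mathrm{LWPP}$. For $r_A,r_R:\mathbb N\to\mathbb N$, $(r_A,r_R)\text{-}\mathrm{LWPP}$ is the class of all $B\subseteq\Sigma^*$ for which there are $g\in\mathrm{GapP}$ and integer-valued $f_A,f_R\in\mathrm{FP}$ such that, with $A_j=\{f_A(\langle 0^j,i\rangle) : 1\le i\le r_A(j)\}$ and $R_j=\{f_R(\langle 0^j,i\rangle) : 1\le i\le r_R(j)\}$, we have $A_j\cap R_j=\emptyset$ for every $j\in\mathbb N$ and, for all $x\in\Sigma^*$, $g(x)\in A_{|x|}$ if $x\in B$ and $g(x)\in R_{|x|}$ if $x\notin B$. The class $(r_A,r_R)\text{-}\mathrm{WPP}$ is defined in the same way with the sets $A_x=\{f_A(\langle x,i\rangle) : 1\le i\le r_A(|x|)\}$ and $R_x=\{f_R(\langle x,i\rangle) : 1\le i\le r_R(|x|)\}$ in place of $A_{|x|}$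 and $R_{|x|}$, which are required to be disjoint for every $x\in\Sigma^*$. For $\mathcal C\in\{\mathrm{LWPP},\mathrm{WPP}\}$ let $(\mathit{Poly},\mathit{Poly})\text{-}\mathcal C=\bigcup_{c\ge 1}(n^c+c,\,n^c+c)\text{-}\mathcal C$. Theorem. $(\mathit{Poly},\mathit{Poly})\text{-}\mathrm{LWPP}=\mathit{Poly}\text{-}\mathrm{LWPP}$. Moreover, $(\mathit{Poly},\mathit{Poly})\text{-}\mathrm{LWPP}=\mathrm{LWPP}$ and $(\mathit{Poly},\mathit{Poly})\text{-}\mathrm{WPP}=\mathrm{WPP}$. -/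

import Mathlib

namespace CountingClasses

open Turing

/-- A nondeterministic Turing machine with finitely many two-way infinite tapes, a finite state set
and a finite tape alphabet; the blank is `default : Γ`. The transition function gives, for a state
and the symbols under the heads, a finite set of possible transitions: a new state and, for each
tape, the symbol to be written followed by a head move (`none`: the head stays). -/
structure TM where
  /-- states -/
  Q : Type
  /-- tape alphabet -/
  Γ : Type
  /-- index set of the tapes -/
  K : Type
  [finQ : Finite Q]
  [finΓ : Finite Γ]
  [finK : Finite K]
  [blank : Inhabited Γ]
  /-- the input/output alphabet `{0, 1}`, as a set of nonblank tape symbols -/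
  sym : Bool → Γ
  sym_injective : Function.Injective sym
  sym_ne_blank : ∀ b, sym b ≠ default
  /-- the start state -/
  start : Q
  /-- the accepting states -/
  accepting : Set Q
  /-- the input tape -/
  inp : K
  /-- the output tape (used only by machines that compute functions) -/
  out : K
  /-- the transition function -/
  δ : Q → (K → Γ) → Finset (Q × (K → Γ × Option Dir))

namespace TM

variable (M : TM)

instance : Inhabited M.Γ := M.blank

/-- A transition: new state; for each tape the symbol to be written and the head move. -/
abbrev Trans : Type := M.Q × (M.K → M.Γ × Option Dir)

/-- Configurations. -/
structure Cfg where
  state : M.Q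
  tapes : M.K → Tape M.Γ

/-- Initial configuration: the input stands on the input tape, with the head on its first symbol;
all other tapes are blank. -/
noncomputable def init (x : List Bool) : M.Cfg :=
  open Classical in
  { state := M.start
    tapes := fun k => if k = M.inp then Tape.mk₁ (x.map M.sym) else default }

/-- Move the head of a tape, or leave it where it is. -/
def moveHead {Γ : Type} [Inhabited Γ] : Option Dir → Tape Γ → Tape Γ
  | none, T => T
  | some d, T => T.move d

variable {M}

/-- The transitions that are possible in a configuration. -/
def Cfg.options (c : M.Cfg) : Finset M.Trans :=
  M.δ c.state fun k => (c.tapes k).head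

/-- The configuration reached by executing a transition. -/
def Cfg.exec (c : M.Cfg) (t : M.Trans) : M.Cfg where
  state := t.1
  tapes := fun k => moveHead (t.2 k).2 ((c.tapes k).write (t.2 k).1)

/-- `IsRun c ts`: the transitions in `ts` can be executed one after the other from `c`. -/
def IsRun : M.Cfg → List M.Trans → Prop
  | _, [] => True
  | c, t :: ts => t ∈ c.options ∧ IsRun (c.exec t) ts

/-- The configuration at the end of a run. -/
def final : M.Cfg → List M.Trans → M.Cfg
  | c, [] => c
  | c, t :: ts => final (c.exec t) ts

/-- A configuration without possible transitions is halting. -/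
def Cfg.Halting (c : M.Cfg) : Prop := c.options = ∅

variable (M)

/-- The computation paths on input `x`: the runs from the initial configuration to a halting one,
each given by its sequence of nondeterministic choices. -/
def IsPath (x : List Bool) (ts : List M.Trans) : Prop :=
  IsRun (M.init x) ts ∧ (final (M.init x) ts).Halting

/-- Number of accepting computation paths (those that halt in an accepting state). -/
noncomputable def acc (x : List Bool) : ℕ :=
  Set.ncard {ts | M.IsPath x ts ∧ (final (M.init x) ts).state ∈ M.accepting}

/-- Number of rejecting computation paths (those that halt in a state that is not accepting). -/
noncomputable def rej (x : List Bool) : ℕ :=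
  Set.ncard {ts | M.IsPath x ts ∧ (final (M.init x) ts).state ∉ M.accepting}

/-- The gap function of a machine. -/
noncomputable def gap (x : List Bool) : ℤ := (M.acc x : ℤ) - (M.rej x : ℤ)

/-- Polynomial time: no run on input `x`, complete or not, is longer than `p(|x|)`. -/
def PolyTime : Prop :=
  ∃ p : Polynomial ℕ, ∀ x ts, IsRun (M.init x) ts → ts.length ≤ p.eval x.length

/-- Deterministic machines: at most one transition is possible in any situation. -/
def Deterministic : Prop := ∀ q s, (M.δ q s).card ≤ 1

/-- `M` computes `f`: on each input `x` it halts, the output tape then contains exactly `f x`, and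
the output head is on the first symbol of it. -/
def Computes (f : List Bool → List Bool) : Prop :=
  ∀ x, ∃ ts, M.IsPath x ts ∧ (final (M.init x) ts).tapes M.out = Tape.mk₁ ((f x).map M.sym)

end TM

/-- Binary representation of an integer: a sign bit (`true` for negative integers), then the
absolute value in binary, least significant bit first. -/
def encodeInt (z : ℤ) : List Bool := decide (z < 0) :: z.natAbs.bits

/-- The string `0ⁿ`. -/
def zeros (n : ℕ) : List Bool := List.replicate n false

/-- The pair `⟨x, i⟩` as a string: each bit of `x` doubled, the separator `01`, then `i` in
binary. -/
def pair (x : List Bool) (i : ℕ) : List Bool :=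
  x.flatMap (fun b => [b, b]) ++ [false, true] ++ i.bits

/-- Integer-valued functions computable in polynomial time by a deterministic machine. -/
def FP : Set (List Bool → ℤ) :=
  {f | ∃ M : TM, M.Deterministic ∧ M.PolyTime ∧ M.Computes fun x => encodeInt (f x)}

/-- The gap functions of the nondeterministic polynomial-time machines. -/
def GapP : Set (List Bool → ℤ) :=
  {g | ∃ N : TM, N.PolyTime ∧ N.gap = g}

/-- The class `WPP`. -/
def WPP : Set (Language Bool) :=
  {A | ∃ g ∈ GapP, ∃ f ∈ FP, (∀ x, f x ≠ 0) ∧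
    ∀ x, (x ∈ A → g x = f x) ∧ (x ∉ A → g x = 0)}

/-- The class `LWPP`: only the values of `f` on `0*` matter. -/
def LWPP : Set (Language Bool) :=
  {A | ∃ g ∈ GapP, ∃ f ∈ FP, (∀ n, f (zeros n) ≠ 0) ∧
    ∀ x, (x ∈ A → g x = f (zeros x.length)) ∧ (x ∉ A → g x = 0)}

/-- The class `r`-`LWPP`. -/
def IndexedLWPP (r : ℕ → ℕ) : Set (Language Bool) :=
  {A | ∃ g ∈ GapP, ∃ f ∈ FP, (∀ y, f y ≠ 0) ∧
    ∀ x, (x ∈ A → ∃ i, 1 ≤ i ∧ i ≤ r x.length ∧ g x = f (pair (zeros x.length) i)) ∧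
      (x ∉ A → g x = 0)}

/-- The class `Poly`-`LWPP`. -/
def PolyLWPP : Set (Language Bool) :=
  {A | ∃ c : ℕ, 1 ≤ c ∧ A ∈ IndexedLWPP fun n => n ^ c + c}

/-- The target set `{f(⟨y, i⟩) | 1 ≤ i ≤ m}`. -/
def targets (f : List Bool → ℤ) (y : List Bool) (m : ℕ) : Set ℤ :=
  {n | ∃ i, 1 ≤ i ∧ i ≤ m ∧ f (pair y i) = n}

/-- The class `(r_A, r_R)`-`LWPP`. -/
def IndexedLWPP₂ (rA rR : ℕ → ℕ) : Set (Language Bool) :=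
  {B | ∃ g ∈ GapP, ∃ fA ∈ FP, ∃ fR ∈ FP,
    (∀ j, targets fA (zeros j) (rA j) ∩ targets fR (zeros j) (rR j) = ∅) ∧
    ∀ x, (x ∈ B → g x ∈ targets fA (zeros x.length) (rA x.length)) ∧
      (x ∉ B → g x ∈ targets fR (zeros x.length) (rR x.length))}

/-- The class `(Poly, Poly)`-`LWPP`. -/
def PolyPolyLWPP : Set (Language Bool) :=
  {B | ∃ c : ℕ, 1 ≤ c ∧ B ∈ IndexedLWPP₂ (fun n => n ^ c + c) (fun n => n ^ c + c)}

/-- The class `(r_A, r_R)`-`WPP`: the target sets may depend on the input itself. -/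
def IndexedWPP₂ (rA rR : ℕ → ℕ) : Set (Language Bool) :=
  {B | ∃ g ∈ GapP, ∃ fA ∈ FP, ∃ fR ∈ FP,
    (∀ x : List Bool, targets fA x (rA x.length) ∩ targets fR x (rR x.length) = ∅) ∧
    ∀ x, (x ∈ B → g x ∈ targets fA x (rA x.length)) ∧
      (x ∉ B → g x ∈ targets fR x (rR x.length))}

/-- The class `(Poly, Poly)`-`WPP`. -/
def PolyPolyWPP : Set (Language Bool) :=
  {B | ∃ c : ℕ, 1 ≤ c ∧ B ∈ IndexedWPP₂ (fun n => n ^ c + c) (fun n => n ^ c + c)}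

end CountingClasses

/-! Let `y` be the string on which the target sets depend (`0ⁿ` for LWPP, the input for WPP), let
a_1, …, a_r and b_1, …, b_r be the accepting and rejecting targets, and put G(x) = ∏_i (g(x) - b_i)
and c_j = ∏_i (a_j - b_i). If x is not in the language, then g(x) is some b_i and G(x) = 0. If x is
in the language, then g(x) is some a_j and G(x) = c_j. Disjointness of the target sets says exactly
that all c_j are nonzero. Therefore ∏_j c_j - ∏_j (c_j - G(x)) is 0 outside the language and equals
the single nonzero number ∏_j c_j inside it, and this number depends on `y` only. The algebra is in
`prod_diffProd_ne_zero`, `prod_sub_prod_of_mem` and `prod_sub_prod_of_mem_right`. The converse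
inclusions are simple: one target is a constant indexed family, and 0 serves as the only rejecting
target.

What remains is to show that the difference of products is in GapP (`gapDiff_mem_GapP`) and that ∏_j
c_j is in FP (`prod_mem_FP`), for the concrete multi-tape machines of the definitions. Both are
obtained from structured programs on stacks. The relation `Runs` records the final memory, the
number of loop iterations and the sum of the signs of all paths. A nondeterministic choice adds such
sums, sequential composition multiplies them, and `neg` changes their sign, so the closure
properties of GapP become program constructions. Programs compile to Turing machines
(`tree_of_runs`), and conversely a program can run a given machine as a subroutine (`runs_sim`),
either for its gap or for its output.

For the product in FP, integers are handled as lists of digits -1, 0, 1. Negation is then digitwise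
and addition needs no case distinction on signs; only the final result is brought into the binary
form of `encodeInt`. -/

open Turing

namespace CountingClasses

/-! ### Computation trees -/

namespace TM

variable {M : TM}

/-- `Tree W c v n`: the computation tree below `c` has depth at most `n`, and `v` is the sum over its
leaves of weights that are admitted by `W`. -/
inductive Tree (W : M.Cfg → ℤ → Prop) : M.Cfg → ℤ → ℕ → Prop
  | halt {c : M.Cfg} {v : ℤ} (n : ℕ) : c.Halting → W c v → Tree W c v n
  | step {c : M.Cfg} (v : M.Trans → ℤ) {n : ℕ} : c.options.Nonempty →
      (∀ t ∈ c.options, Tree W (c.exec t) (v t) n) → Tree W c (∑ t ∈ c.options, v t) (n + 1)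

variable {W : M.Cfg → ℤ → Prop}

theorem Tree.length_le {c : M.Cfg} {v : ℤ} {n : ℕ} (h : Tree W c v n) {ts : List M.Trans}
    (hts : IsRun c ts) : ts.length ≤ n := by
  induction h generalizing ts with
  | halt n hc _ =>
    cases ts with
    | nil => simp
    | cons t ts => exact absurd hts.1 (by rw [hc]; simp)
  | step v _ _ ih =>
    cases ts with
    | nil => simp
    | cons t ts => simpa using ih t hts.1 hts.2

theorem Tree.mono {c : M.Cfg} {v : ℤ} {n n' : ℕ} (h : Tree W c v n) (hn : n ≤ n') :
    Tree W c v n' := by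
  induction h generalizing n' with
  | halt n hc hv => exact .halt _ hc hv
  | step v hne _ ih =>
    obtain ⟨k, rfl⟩ : ∃ k, n' = k + 1 := ⟨n' - 1, by omega⟩
    exact .step v hne fun t ht => ih t ht (by omega)

/-- Inner nodes have at least one child, so any descent ends in an admitted leaf. For deterministic
machines this is the computation itself. -/
theorem Tree.exists_path {c : M.Cfg} {v : ℤ} {n : ℕ} (h : Tree W c v n) :
    ∃ ts, IsRun c ts ∧ (final c ts).Halting ∧ ∃ v', W (final c ts) v' := by
  induction h with
  | @halt c v n hc hv => exact ⟨[], trivial, hc, v, hv⟩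
  | step v hne _ ih =>
    obtain ⟨t, ht⟩ := hne
    obtain ⟨ts, h1, h2, h3⟩ := ih t ht
    exact ⟨t :: ts, ⟨ht, h1⟩, h2, h3⟩

open Classical in
/-- The weight of a halting configuration in the gap of a machine. -/
noncomputable def leafSign (c : M.Cfg) : ℤ := if c.state ∈ M.accepting then 1 else -1

/-- The paths through an inner node split into disjoint classes by their first transition, just as
the value of the node splits into those of its children. Distinct leaves of the tree are thus
distinct paths. -/
theorem Tree.exists_finset {c : M.Cfg} {v : ℤ} {n : ℕ}
    (h : Tree (fun c v => v = leafSign c) c v n) :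
    ∃ P : Finset (List M.Trans), (∀ ts, ts ∈ P ↔ IsRun c ts ∧ (final c ts).Halting) ∧
      ∑ ts ∈ P, leafSign (final c ts) = v := by
  classical
  induction h with
  | @halt c v n hc hv =>
    refine ⟨{[]}, fun ts => ?_, by simp [final, hv]⟩
    cases ts with
    | nil => simpa [IsRun, final] using hc
    | cons t ts =>
      have : c.options = ∅ := hc
      simp [IsRun, this]
  | @step c v n hne _ ih =>
    choose! P hP hsum using ih
    refine ⟨c.options.biUnion fun t => (P t).image (List.cons t), fun ts => ?_, ?_⟩
    · cases ts with
      | nil =>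
        -- The empty run is not a path here, because the configuration is not halting.
        have : c.options ≠ ∅ := hne.ne_empty
        simp [IsRun, final, Cfg.Halting, this]
      | cons t ts =>
        simp only [Finset.mem_biUnion, Finset.mem_image, List.cons.injEq, IsRun, final]
        constructor
        · rintro ⟨t', ht', ts', h, rfl, rfl⟩
          exact ⟨⟨ht', ((hP _ ht' _).1 h).1⟩, ((hP _ ht' _).1 h).2⟩
        · rintro ⟨⟨h1, h2⟩, h3⟩
          exact ⟨t, h1, ts, (hP _ h1 _).2 ⟨h2, h3⟩, rfl, rfl⟩
    · rw [Finset.sum_biUnion]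
      · refine Finset.sum_congr rfl fun t ht => ?_
        rw [Finset.sum_image (by simp), ← hsum t ht]
        rfl
      · intro t _ t' _ hne
        simp only [Function.onFun, Finset.disjoint_left, Finset.mem_image]
        rintro _ ⟨ts, _, rfl⟩ ⟨ts', _, h⟩
        exact hne (by simpa using (List.cons.inj h).1.symm)

theorem Tree.gap_eq {x : List Bool} {v : ℤ} {n : ℕ}
    (h : Tree (fun c v => v = leafSign c) (M.init x) v n) : M.gap x = v := by
  classical
  obtain ⟨P, hP, rfl⟩ := h.exists_finset
  have hacc : {ts | M.IsPath x ts ∧ (final (M.init x) ts).state ∈ M.accepting} =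
      ((P.filter fun ts => (final (M.init x) ts).state ∈ M.accepting : Finset _) :
        Set (List M.Trans)) := by
    ext ts; simp [hP, IsPath]
  have hrej : {ts | M.IsPath x ts ∧ (final (M.init x) ts).state ∉ M.accepting} =
      ((P.filter fun ts => (final (M.init x) ts).state ∉ M.accepting : Finset _) :
        Set (List M.Trans)) := by
    ext ts; simp [hP, IsPath]
  rw [gap, acc, rej, hacc, hrej, Set.ncard_coe_finset, Set.ncard_coe_finset]
  simp only [leafSign, Finset.sum_ite, Finset.sum_const]
  simp [sub_eq_add_neg]

/-- A time bound makes the computation tree finite: after each transition the bound drops by one,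
and bound 0 leaves no transition at all. -/
theorem exists_tree {c : M.Cfg} {n : ℕ} (h : ∀ ts, IsRun c ts → ts.length ≤ n) :
    ∃ v, Tree (fun c v => v = leafSign c) c v n := by
  classical
  induction n generalizing c with
  | zero =>
    refine ⟨_, .halt _ ?_ rfl⟩
    refine Finset.eq_empty_of_forall_notMem fun t ht => ?_
    simpa using h [t] ⟨ht, trivial⟩
  | succ n ih =>
    by_cases hc : c.Halting
    · exact ⟨_, .halt _ hc rfl⟩
    · have : ∀ t ∈ c.options, ∃ v, Tree (fun c v => v = leafSign c) (c.exec t) v n := by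
        intro t ht
        refine ih fun ts hts => ?_
        simpa using h (t :: ts) ⟨ht, hts⟩
      choose! v hv using this
      exact ⟨_, .step v (Finset.nonempty_iff_ne_empty.2 hc) hv⟩

theorem tree_gap {p : Polynomial ℕ} (hp : ∀ x ts, IsRun (M.init x) ts → ts.length ≤ p.eval x.length)
    (x : List Bool) :
    Tree (fun c v => v = leafSign c) (M.init x) (M.gap x) (p.eval x.length) := by
  obtain ⟨v, hv⟩ := exists_tree (hp x)
  rwa [hv.gap_eq]

/-- The single path of a deterministic machine is its whole tree. The weight 1 at the leaf is passed
up unchanged, as every sum has one term. -/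
theorem Deterministic.tree (hM : M.Deterministic) {c : M.Cfg} {ts : List M.Trans}
    (hr : IsRun c ts) (hf : (final c ts).Halting) (hW : W (final c ts) 1) :
    Tree W c 1 ts.length := by
  induction ts generalizing c with
  | nil => exact .halt _ hf hW
  | cons t ts ih =>
    have h1 : c.options = {t} :=
      (Finset.eq_of_subset_of_card_le (Finset.singleton_subset_iff.2 hr.1)
        ((hM _ _).trans (by simp))).symm
    have := Tree.step (W := W) (c := c) (fun _ => 1) (n := ts.length) (by simp [h1]) (by
      intro t' ht'
      rw [h1, Finset.mem_singleton] at ht'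
      subst ht'
      exact ih hr.2 hf hW)
    simpa [h1] using this

end TM

/-! ### Stack programs -/

/-- Programs acting on stacks `S → List A`. `case s N B` runs `N` if the stack `s` is empty, and
otherwise pops a symbol `a` from it and runs `B a`; `loop s B` does this until `s` is empty. The
instructions `left s` and `put s X` together push a symbol of `X` onto `s`, which is chosen
nondeterministically. The instruction `neg` changes the sign of the computation path. -/
inductive Prog (A S : Type) : Type
  | skip : Prog A S
  | neg : Prog A S
  | left (s : S) : Prog A S
  | put (s : S) (X : Finset A) : Prog A S
  | seq (P Q : Prog A S) : Prog A S
  | case (s : S) (N : Prog A S) (B : A → Prog A S) : Prog A S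
  | loop (s : S) (B : A → Prog A S) : Prog A S

namespace Prog

infixr:60 " ;; " => Prog.seq

variable {A S : Type}

/-- Push a symbol of `X`. -/
def guess (s : S) (X : Finset A) : Prog A S := left s ;; put s X

/-- Push the symbol `a`. -/
def push (s : S) (a : A) : Prog A S := guess s {a}

/-- The lists of instructions that remain to be executed during a run of `P`. -/
def reach : Prog A S → Set (List (Prog A S))
  | seq P Q => insert [seq P Q] ((fun L => L ++ [Q]) '' reach P ∪ reach Q)
  | case s N B => insert [case s N B] (reach N ∪ ⋃ a, reach (B a))
  | loop s B => insert [loop s B] (insert [] (⋃ a, (fun L => L ++ [loop s B]) '' reach (B a)))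
  | P => {[P], []}

theorem self_mem_reach (P : Prog A S) : [P] ∈ reach P := by
  cases P <;> simp [reach]

/-- The pending instructions inside a subprogram are those of the subprogram alone followed by a
fixed remainder. Finiteness allows these lists to serve as states of a Turing machine. -/
theorem finite_reach [Finite A] (P : Prog A S) : (reach P).Finite := by
  induction P with
  | seq P Q hP hQ => exact ((hP.image _).union hQ).insert _
  | case s N B hN hB => exact (hN.union (Set.finite_iUnion hB)).insert _
  | loop s B hB => exact ((Set.finite_iUnion fun a => (hB a).image _).insert _).insert _
  | _ => exact (Set.finite_singleton _).insert _

/-- What a transition does to the tapes. -/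
abbrev Act (A S : Type) : Type := S → Option A × Option Dir

/-- Leave all tapes unchanged. -/
def idle (h : S → Option A) : Act A S := fun s => (h s, none)

/-- Change only the tape `s`. -/
noncomputable def actAt (h : S → Option A) (s : S) (x : Option A) (d : Option Dir) : Act A S :=
  open Classical in Function.update (idle h) s (x, d)

/-- The transitions for an instruction: change of sign, instructions to be executed next, and
action on the tapes. -/
noncomputable def succ : Prog A S → (S → Option A) → Set (Bool × List (Prog A S) × Act A S)
  | skip, h => {(false, [], idle h)}
  | neg, h => {(true, [], idle h)}
  -- A transition writes before it moves, whereas a push has to move to the blank cell on the left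
  -- before it writes. Hence a push takes the two steps `left` and `put`.
  | left s, h => {(false, [], actAt h s (h s) (some .left))}
  | put s X, h => (fun a => (false, [], actAt h s (some a) none)) '' X
  | seq P Q, h => {(false, [P, Q], idle h)}
  | case s N B, h => match h s with
    | none => {(false, [N], idle h)}
    | some a => {(false, [B a], actAt h s none (some .right))}
  | loop s B, h => match h s with
    | none => {(false, [], idle h)}
    | some a => {(false, [B a, loop s B], actAt h s none (some .right))}

section

variable {s : S} {N : Prog A S} {B : A → Prog A S} {h : S → Option A}

theorem succ_case_none (hs : h s = none) : succ (case s N B) h = {(false, [N], idle h)} := by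
  simp only [succ, hs]

theorem succ_case_some {a : A} (hs : h s = some a) :
    succ (case s N B) h = {(false, [B a], actAt h s none (some .right))} := by
  simp only [succ, hs]

theorem succ_loop_none (hs : h s = none) : succ (loop s B) h = {(false, [], idle h)} := by
  simp only [succ, hs]

theorem succ_loop_some {a : A} (hs : h s = some a) :
    succ (loop s B) h = {(false, [B a, loop s B], actAt h s none (some .right))} := by
  simp only [succ, hs]

end

/-- The set `reach P` is closed under execution, so the transitions of the compiled machine stay
inside its state set. -/
theorem succ_mem_reach (P : Prog A S) {p : Prog A S} {C : List (Prog A S)} {h : S → Option A}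
    {e : Bool × List (Prog A S) × Act A S} (hL : p :: C ∈ reach P) (he : e ∈ succ p h) :
    e.2.1 ++ C ∈ reach P := by
  induction P generalizing C with
  | skip | neg | left | put =>
    simp only [reach, Set.mem_insert_iff, Set.mem_singleton_iff, List.cons.injEq, reduceCtorEq,
      or_false] at hL
    obtain ⟨rfl, rfl⟩ := hL
    simp only [succ, Set.mem_singleton_iff, Set.mem_image] at he
    first
      | (subst he; simp [reach])
      | (obtain ⟨a, _, rfl⟩ := he; simp [reach])
  | seq P Q hP hQ =>
    rcases hL with hL | ⟨L, hL, hLe⟩ | hL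
    · obtain ⟨rfl, rfl⟩ := List.cons.inj hL
      simp only [succ, Set.mem_singleton_iff] at he
      subst he
      exact .inr (.inl ⟨[P], self_mem_reach P, rfl⟩)
    · cases L with
      | nil =>
        obtain ⟨rfl, rfl⟩ := List.cons.inj hLe
        exact .inr (.inr (hQ (self_mem_reach _)))
      | cons q L =>
        obtain ⟨rfl, rfl⟩ := List.cons.inj hLe
        exact .inr (.inl ⟨_, hP hL, by simp⟩)
    · exact .inr (.inr (hQ hL))
  | case s N B hN hB =>
    rcases hL with hL | hL | hL
    · obtain ⟨rfl, rfl⟩ := List.cons.inj hL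
      simp only [succ] at he
      split at he
      · rw [Set.mem_singleton_iff] at he
        subst he
        exact .inr (.inl (self_mem_reach N))
      · rw [Set.mem_singleton_iff] at he
        subst he
        exact .inr (.inr (Set.mem_iUnion.2 ⟨_, self_mem_reach _⟩))
    · exact .inr (.inl (hN hL))
    · obtain ⟨a, ha⟩ := Set.mem_iUnion.1 hL
      exact .inr (.inr (Set.mem_iUnion.2 ⟨a, hB a ha⟩))
  | loop s B hB =>
    -- The loop instruction is first in the list in two situations: at the start, and whenever the
    -- body has been completed.
    have key : ∀ {C}, p :: C = [loop s B] → e.2.1 ++ C ∈ reach (loop s B) := by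
      intro C hC
      obtain ⟨rfl, rfl⟩ := List.cons.inj hC
      simp only [succ] at he
      split at he
      · rw [Set.mem_singleton_iff] at he
        subst he
        exact .inr (.inl rfl)
      · rw [Set.mem_singleton_iff] at he
        subst he
        exact .inr (.inr (Set.mem_iUnion.2 ⟨_, _, self_mem_reach _, rfl⟩))
    rcases hL with hL | hL | hL
    · exact key hL
    · simp at hL
    · obtain ⟨a, L, hL', hLe⟩ := Set.mem_iUnion.1 hL
      cases L with
      | nil => exact key hLe.symm
      | cons q L =>
        obtain ⟨rfl, rfl⟩ := List.cons.inj hLe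
        exact .inr (.inr (Set.mem_iUnion.2 ⟨a, _, hB a hL', by simp⟩))

/-- Programs without nondeterministic choices. -/
def Det : Prog A S → Prop
  | put _ X => X.card ≤ 1
  | seq P Q => Det P ∧ Det Q
  | case _ N B => Det N ∧ ∀ a, Det (B a)
  | loop _ B => ∀ a, Det (B a)
  | _ => True

theorem Det.of_mem_reach {P : Prog A S} (hP : P.Det) {L : List (Prog A S)} (hL : L ∈ reach P) :
    ∀ p ∈ L, Det p := by
  induction P generalizing L with
  | skip | neg | left | put =>
    simp only [reach, Set.mem_insert_iff, Set.mem_singleton_iff] at hL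
    rcases hL with rfl | rfl <;> simp [hP]
  | seq P Q ihP ihQ =>
    rcases hL with rfl | ⟨L, hL, rfl⟩ | hL
    · simpa using hP
    · simp only [List.mem_append, List.mem_singleton]
      rintro p (hp | rfl)
      exacts [ihP hP.1 hL p hp, hP.2]
    · exact ihQ hP.2 hL
  | case s N B ihN ihB =>
    rcases hL with rfl | hL | hL
    · simpa using hP
    · exact ihN hP.1 hL
    · obtain ⟨a, ha⟩ := Set.mem_iUnion.1 hL
      exact ihB a (hP.2 a) ha
  | loop s B ihB =>
    rcases hL with rfl | rfl | hL
    · simpa using hP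
    · simp
    · obtain ⟨a, L, hL', rfl⟩ := Set.mem_iUnion.1 hL
      simp only [List.mem_append, List.mem_singleton]
      rintro p (hp | rfl)
      exacts [ihB a (hP a) hL' p hp, hP]

theorem Det.succ_subsingleton {P : Prog A S} (hP : P.Det) (h : S → Option A) :
    (succ P h).Subsingleton := by
  cases P with
  | skip | neg | left | seq => exact Set.subsingleton_singleton
  | put s X =>
    refine Set.Subsingleton.image ?_ _
    intro a ha b hb
    exact Finset.card_le_one.1 hP a ha b hb
  | case | loop => simp only [succ]; split <;> exact Set.subsingleton_singleton

/-- A bound for the number of steps before the first iteration of a loop. -/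
def weight [Fintype A] : Prog A S → ℕ
  | seq P Q => 1 + weight P + weight Q
  | case _ N B => 1 + weight N + ∑ a, weight (B a)
  | _ => 1

/-- A bound for the number of steps between two iterations of loops. -/
def cost [Fintype A] : Prog A S → ℕ
  | seq P Q => cost P + cost Q
  | case _ N B => cost N + ∑ a, cost (B a)
  | loop _ B => 1 + ∑ a, (weight (B a) + cost (B a))
  | _ => 0

/-! ### Semantics of stack programs: signed path counts and loop iterations -/

section Runs

variable [DecidableEq S]

/-- `Runs L m v m' t`: all runs of the instructions `L` from `m` end in `m'` after at most `t`
iterations of loops, and `v` is the sum of the signs of these runs. -/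
inductive Runs : List (Prog A S) → (S → List A) → ℤ → (S → List A) → ℕ → Prop
  | nil (m : S → List A) (t : ℕ) : Runs [] m 1 m t
  | skip {C m v m' t} : Runs C m v m' t → Runs (skip :: C) m v m' t
  | neg {C m v m' t} : Runs C m v m' t → Runs (neg :: C) m (-v) m' t
  | guess {C m m' t} {s : S} {X : Finset A} (v : A → ℤ) : X.Nonempty →
      (∀ a ∈ X, Runs C (Function.update m s (a :: m s)) (v a) m' t) →
      Runs (left s :: put s X :: C) m (∑ a ∈ X, v a) m' t
  | seq {P Q C m v m' t} : Runs (P :: Q :: C) m v m' t → Runs (P.seq Q :: C) m v m' t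
  | case_nil {s N B C m v m' t} : m s = [] → Runs (N :: C) m v m' t →
      Runs (case s N B :: C) m v m' t
  | case_cons {s N B C v m' t} {m : S → List A} {a l} : m s = a :: l →
      Runs (B a :: C) (Function.update m s l) v m' t → Runs (case s N B :: C) m v m' t
  | loop_nil {s B C m v m' t} : m s = [] → Runs C m v m' t → Runs (loop s B :: C) m v m' t
  | loop_cons {s B C v m' t} {m : S → List A} {a l} : m s = a :: l →
      Runs (B a :: loop s B :: C) (Function.update m s l) v m' t →
      Runs (loop s B :: C) m v m' (t + 1)

theorem Runs.mono {L : List (Prog A S)} {m m' : S → List A} {v : ℤ} {t t' : ℕ}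
    (h : Runs L m v m' t) (ht : t ≤ t') : Runs L m v m' t' := by
  induction h generalizing t' with
  | nil => exact .nil _ _
  | skip _ ih => exact .skip (ih ht)
  | neg _ ih => exact .neg (ih ht)
  | guess v hX _ ih => exact .guess v hX fun a ha => ih a ha ht
  | seq _ ih => exact .seq (ih ht)
  | case_nil h _ ih => exact .case_nil h (ih ht)
  | case_cons h _ ih => exact .case_cons h (ih ht)
  | loop_nil h _ ih => exact .loop_nil h (ih ht)
  | loop_cons h _ ih =>
    obtain ⟨k, rfl⟩ : ∃ k, t' = k + 1 := ⟨t' - 1, by omega⟩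
    exact .loop_cons h (ih (by omega))

/-- All runs of the first part end in the same memory, so each of them is continued by the same set
of runs of the second part, and the sum of the products of signs factors. This is what produces
products of gaps. -/
theorem Runs.append {L C : List (Prog A S)} {m m' m'' : S → List A} {v w : ℤ} {t t' : ℕ}
    (h : Runs L m v m' t) (h' : Runs C m' w m'' t') : Runs (L ++ C) m (v * w) m'' (t + t') := by
  induction h with
  | nil => simpa using h'.mono (by omega)
  | skip _ ih => exact .skip (ih h')
  | neg _ ih => rw [neg_mul]; exact .neg (ih h')
  | guess v hX _ ih =>
    rw [Finset.sum_mul]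
    exact .guess (fun a => v a * w) hX fun a ha => ih a ha h'
  | seq _ ih => exact .seq (ih h')
  | case_nil h _ ih => exact .case_nil h (ih h')
  | case_cons h _ ih => exact .case_cons h (ih h')
  | loop_nil h _ ih => exact .loop_nil h (ih h')
  | loop_cons h _ ih =>
    rw [add_right_comm]
    exact .loop_cons h (ih h')

theorem Runs.cons {P : Prog A S} {C : List (Prog A S)} {m m' m'' : S → List A} {v w : ℤ}
    {t t' : ℕ} (h : Runs [P] m v m' t) (h' : Runs C m' w m'' t') :
    Runs (P :: C) m (v * w) m'' (t + t') :=
  h.append h'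

theorem Runs.cons_one {P : Prog A S} {C : List (Prog A S)} {m m' m'' : S → List A} {w : ℤ}
    {t t' : ℕ} (h : Runs [P] m 1 m' t) (h' : Runs C m' w m'' t') :
    Runs (P :: C) m w m'' (t + t') := by
  simpa using h.append h'

theorem Runs.push {C : List (Prog A S)} {m m' : S → List A} {v : ℤ} {t : ℕ} {s : S} {a : A}
    (h : Runs C (Function.update m s (a :: m s)) v m' t) :
    Runs (Prog.push s a :: C) m v m' t := by
  have := Runs.guess (m := m) (m' := m') (t := t) (C := C) (s := s) (X := {a}) (fun _ => v)
    (by simp) (by simpa using h)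
  exact .seq (by simpa using this)

end Runs

end Prog

/-! ### Compiling stack programs -/

instance : Finite Dir :=
  Finite.of_injective (fun d : Dir => decide (d = .left)) fun a b => by cases a <;> cases b <;> simp

namespace Prog

section Tapes

variable {A S : Type}

/-- A stack as a tape. -/
def stackTape (l : List A) : Tape (Option A) := Tape.mk₁ (l.map some)

theorem moveHead_idle (T : S → Tape (Option A)) (s : S) :
    TM.moveHead (idle (fun s => (T s).head) s).2 ((T s).write (idle (fun s => (T s).head) s).1)
      = T s :=
  Tape.write_self _

theorem moveHead_actAt [DecidableEq S] (T : S → Tape (Option A)) (s : S) (x : Option A)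
    (d : Option Dir) (s' : S) :
    TM.moveHead (actAt (fun s => (T s).head) s x d s').2
      ((T s').write (actAt (fun s => (T s).head) s x d s').1)
      = Function.update T s (TM.moveHead d ((T s).write x)) s' := by
  by_cases h : s' = s
  · subst h; simp [actAt]
  · simpa [actAt, h] using moveHead_idle T s'

theorem stackTape_pop (a : A) (l : List A) :
    TM.moveHead (some .right) ((stackTape (a :: l)).write none) = stackTape l := by
  -- The popped cell has become blank and is absorbed by the empty left half of the tape.
  have h : ListBlank.cons (none : Option A) (ListBlank.mk []) = ListBlank.mk [] := by
    rw [ListBlank.cons_mk]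
    exact Quotient.sound' (.inr ⟨1, rfl⟩)
  simp only [stackTape, TM.moveHead, Tape.mk₁, Tape.mk₂, List.map_cons, ← ListBlank.cons_mk,
    Tape.write_mk', Tape.move_right_mk', ListBlank.head_cons, ListBlank.tail_cons, h]

theorem stackTape_push (a : A) (l : List A) :
    ((stackTape l).move .left).write (some a) = stackTape (a :: l) := by
  simp only [stackTape, Tape.mk₁, Tape.mk₂, Tape.move_left_mk', List.map_cons, Tape.write_mk',
    ← ListBlank.cons_mk]
  rfl

theorem stackTape_head (l : List A) : (stackTape l).head = l.head? := by
  cases l <;> rfl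

theorem stackTape_update [DecidableEq S] (m : S → List A) (s : S) (l : List A) :
    (fun s' => stackTape (Function.update m s l s'))
      = Function.update (fun s => stackTape (m s)) s (stackTape l) := by
  funext s'
  by_cases h : s' = s
  · subst h; simp
  · simp [h]

end Tapes

variable {A S : Type} [Finite A] [Finite S]

/-- The machine that executes the program `P`. A state consists of the sign of the computation path
and the instructions that remain to be executed. -/
noncomputable def compile (P : Prog A S) (bit : Bool → A) (hbit : Function.Injective bit)
    (inp out : S) : TM :=
  haveI : Finite {L // L ∈ reach P} := (finite_reach P).to_subtype
  { Q := Bool × {L // L ∈ reach P}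
    Γ := Option A
    K := S
    sym := fun b => some (bit b)
    sym_injective := (Option.some_injective A).comp hbit
    sym_ne_blank := fun _ => Option.some_ne_none _
    start := (true, ⟨[P], self_mem_reach P⟩)
    accepting := {q | q.1 = true}
    inp := inp
    out := out
    δ := fun q h => (Set.toFinite {t | ∃ p C, q.2.1 = p :: C ∧ ∃ e ∈ succ p h,
      t.1.1 = (e.1 ^^ q.1) ∧ t.1.2.1 = e.2.1 ++ C ∧ t.2 = e.2.2}).toFinset }

variable {P : Prog A S} {bit : Bool → A} {hbit : Function.Injective bit} {inp out : S}

/-- The configuration of the compiled machine with given sign, instructions and tapes. -/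
def conf (P : Prog A S) (bit : Bool → A) (hbit : Function.Injective bit) (inp out : S) (σ : Bool)
    (L : List (Prog A S)) (hL : L ∈ reach P) (T : S → Tape (Option A)) :
    (compile P bit hbit inp out).Cfg where
  state := (σ, ⟨L, hL⟩)
  tapes := T

theorem mem_compile_δ {q : (compile P bit hbit inp out).Q} {h : S → Option A}
    {t : (compile P bit hbit inp out).Trans} :
    t ∈ (compile P bit hbit inp out).δ q h ↔ ∃ p C, q.2.1 = p :: C ∧ ∃ e ∈ succ p h,
      t.1.1 = (e.1 ^^ q.1) ∧ t.1.2.1 = e.2.1 ++ C ∧ t.2 = e.2.2 :=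
  (Set.Finite.mem_toFinset _).trans Iff.rfl

theorem mem_options {σ : Bool} {p : Prog A S} {C : List (Prog A S)} {hL : p :: C ∈ reach P}
    {T : S → Tape (Option A)} {t : (compile P bit hbit inp out).Trans} :
    t ∈ (conf P bit hbit inp out σ (p :: C) hL T).options ↔
      ∃ e ∈ succ p fun s => (T s).head,
        t.1.1 = (e.1 ^^ σ) ∧ t.1.2.1 = e.2.1 ++ C ∧ t.2 = e.2.2 := by
  refine mem_compile_δ.trans ?_
  constructor
  · rintro ⟨p', C', h, he⟩
    obtain ⟨rfl, rfl⟩ := List.cons.inj h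
    exact he
  · exact fun h => ⟨p, C, rfl, h⟩

theorem options_nil {σ : Bool} {hL : [] ∈ reach P} {T : S → Tape (Option A)} :
    (conf P bit hbit inp out σ [] hL T).Halting := by
  refine Finset.eq_empty_of_forall_notMem fun t ht => ?_
  obtain ⟨p, C, h, _⟩ := mem_compile_δ.1 ht
  exact List.cons_ne_nil _ _ h.symm

theorem compile_deterministic (hP : P.Det) : (compile P bit hbit inp out).Deterministic := by
  intro q h
  refine Finset.card_le_one.2 fun t ht t' ht' => ?_
  obtain ⟨p, C, hq, e, he, h1, h2, h3⟩ := mem_compile_δ.1 ht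
  obtain ⟨p', C', hq', e', he', h1', h2', h3'⟩ := mem_compile_δ.1 ht'
  obtain ⟨rfl, rfl⟩ := List.cons.inj (hq.symm.trans hq')
  have hp : p.Det := hP.of_mem_reach q.2.2 p (by rw [hq]; simp)
  obtain rfl := hp.succ_subsingleton h he he'
  exact Prod.ext (Prod.ext (h1.trans h1'.symm) (Subtype.ext (h2.trans h2'.symm)))
    (h3.trans h3'.symm)

/-- The set `X` indexes the possible choices. Injectivity of `e` guarantees that different choices
are different transitions, so that none of the summands `v i` is lost. -/
theorem tree_of_succ {W : (compile P bit hbit inp out).Cfg → ℤ → Prop} {σ : Bool} {p : Prog A S}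
    {C : List (Prog A S)} {hL : p :: C ∈ reach P} {T : S → Tape (Option A)} {ι : Type}
    (X : Finset ι) (hX : X.Nonempty) (e : ι → Bool × List (Prog A S) × Act A S)
    (hinj : Set.InjOn e X) (he : (succ p fun s => (T s).head) = e '' X) (v : ι → ℤ) (n : ℕ)
    (h : ∀ i ∈ X, ∀ hL', TM.Tree W (conf P bit hbit inp out ((e i).1 ^^ σ) ((e i).2.1 ++ C) hL'
      fun s => TM.moveHead ((e i).2.2 s).2 ((T s).write ((e i).2.2 s).1)) (v i) n) :
    TM.Tree W (conf P bit hbit inp out σ (p :: C) hL T) (∑ i ∈ X, v i) (n + 1) := by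
  classical
  have hmem : ∀ i ∈ X, (e i).2.1 ++ C ∈ reach P := fun i hi =>
    succ_mem_reach P hL (by rw [he]; exact ⟨i, hi, rfl⟩)
  -- The new list is known to be a state only for indices in `X`; elsewhere the old list is an
  -- arbitrary substitute.
  let f : ι → (compile P bit hbit inp out).Trans := fun i =>
    if hi : i ∈ X then (((e i).1 ^^ σ, ⟨(e i).2.1 ++ C, hmem i hi⟩), (e i).2.2)
    else (((e i).1 ^^ σ, ⟨p :: C, hL⟩), (e i).2.2)
  have hf : ∀ i (hi : i ∈ X), f i =
      (((e i).1 ^^ σ, ⟨(e i).2.1 ++ C, hmem i hi⟩), (e i).2.2) := fun i hi => dif_pos hi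
  have hfinj : Set.InjOn f X := by
    intro i hi j hj hij
    rw [hf i hi, hf j hj] at hij
    apply hinj hi hj
    obtain ⟨h1, h3⟩ := Prod.ext_iff.1 hij
    obtain ⟨h1, h2⟩ := Prod.ext_iff.1 h1
    exact Prod.ext (Bool.xor_left_inj.1 h1)
      (Prod.ext (List.append_cancel_right (Subtype.ext_iff.1 h2)) h3)
  have hopt : (conf P bit hbit inp out σ (p :: C) hL T).options = X.image f := by
    ext t
    rw [mem_options, he, Finset.mem_image]
    constructor
    · rintro ⟨_, ⟨i, hi, rfl⟩, h1, h2, h3⟩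
      refine ⟨i, hi, ?_⟩
      rw [hf i hi]
      exact Prod.ext (Prod.ext h1.symm (Subtype.ext h2.symm)) h3.symm
    · rintro ⟨i, hi, rfl⟩
      rw [hf i hi]
      exact ⟨_, ⟨i, hi, rfl⟩, rfl, rfl, rfl⟩
  -- The weights are carried over from indices to transitions by summing over the fibres of `f`,
  -- which are singletons on `X`.
  have hv : ∃ v' : (compile P bit hbit inp out).Trans → ℤ, ∀ i ∈ X, v' (f i) = v i := by
    refine ⟨fun t => ∑ i ∈ X with f i = t, v i, fun i hi => ?_⟩
    refine Finset.sum_eq_single_of_mem i (by simp [hi]) ?_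
    intro j hj hne
    rw [Finset.mem_filter] at hj
    exact absurd (hfinj hj.1 hi hj.2) hne
  obtain ⟨v', hv'⟩ := hv
  have := TM.Tree.step (W := W) (c := conf P bit hbit inp out σ (p :: C) hL T) v' (n := n)
    (by rw [hopt]; exact hX.image f) (by
      rw [hopt]
      intro t ht
      obtain ⟨i, hi, rfl⟩ := Finset.mem_image.1 ht
      rw [hv' i hi]
      have := h i hi (hmem i hi)
      rw [hf i hi]
      exact this)
  rwa [hopt, Finset.sum_image hfinj, Finset.sum_congr rfl hv'] at this

theorem tree_of_succ_eq {W : (compile P bit hbit inp out).Cfg → ℤ → Prop} {σ : Bool}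
    {p : Prog A S} {C : List (Prog A S)} {hL : p :: C ∈ reach P} {T T' : S → Tape (Option A)}
    {b : Bool} {L : List (Prog A S)} {act : Act A S}
    (he : (succ p fun s => (T s).head) = {(b, L, act)})
    (hT : ∀ s, TM.moveHead (act s).2 ((T s).write (act s).1) = T' s) {v : ℤ} {n : ℕ}
    (h : ∀ hL', TM.Tree W (conf P bit hbit inp out (b ^^ σ) (L ++ C) hL' T') v n) :
    TM.Tree W (conf P bit hbit inp out σ (p :: C) hL T) v (n + 1) := by
  obtain rfl : (fun s => TM.moveHead (act s).2 ((T s).write (act s).1)) = T' := funext hT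
  simpa using tree_of_succ (W := W) (hL := hL) (σ := σ) (T := T) ({()} : Finset Unit) (by simp)
    (fun _ => (b, L, act)) (by simp) (by simpa using he) (fun _ => v) n (by simpa using h)

/-- The depth is bounded by a potential: the weights of the pending instructions plus `D` for each
loop iteration still allowed. A step outside loop iterations consumes weight. An iteration adds the
weight of a loop body, and that weight plus one is at most the cost of the loop, hence at most `D`.
The sign stored in the state enters as a factor in front of the value. -/
theorem tree_of_runs [Fintype A] [DecidableEq S] {W : (compile P bit hbit inp out).Cfg → ℤ → Prop}
    {D : ℕ} {L : List (Prog A S)} {m m' : S → List A} {v : ℤ} {t : ℕ} (h : Runs L m v m' t)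
    (hW : ∀ σ hL, W (conf P bit hbit inp out σ [] hL fun s => stackTape (m' s))
      (if σ then 1 else -1)) (hD : ∀ p ∈ L, cost p ≤ D) (σ : Bool) (hL : L ∈ reach P) :
    TM.Tree W (conf P bit hbit inp out σ L hL fun s => stackTape (m s))
      ((if σ then 1 else -1) * v) ((L.map weight).sum + t * D) := by
  induction h generalizing σ with
  | nil => exact .halt _ options_nil (by simpa using hW σ hL)
  | @skip C m v m' t _ ih =>
    have := tree_of_succ_eq (W := W) (σ := σ) (hL := hL) (p := skip) rfl (moveHead_idle _)
      fun hL' => ih hW (fun p hp => hD p (by simp [hp])) _ hL'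
    convert this using 1
    · simp
    · simp [weight]; ring
  | @neg C m v m' t _ ih =>
    have := tree_of_succ_eq (W := W) (σ := σ) (hL := hL) (p := neg) rfl (moveHead_idle _)
      fun hL' => ih hW (fun p hp => hD p (by simp [hp])) _ hL'
    convert this using 1
    · cases σ <;> simp
    · simp [weight]; ring
  | @guess C m m' t s X v hX _ ih =>
    -- These are the tapes between the two steps of a push, with the head of `s` on the blank cell
    -- in front of the stack.
    let T' := Function.update (fun s => stackTape (m s)) s
      (TM.moveHead (some .left) ((stackTape (m s)).write (stackTape (m s)).head))
    have := tree_of_succ_eq (W := W) (σ := σ) (hL := hL) (p := left s)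
      (T := fun s => stackTape (m s)) (T' := T') rfl (moveHead_actAt _ _ _ _)
      (v := (if σ then 1 else -1) * ∑ a ∈ X, v a)
      (n := ((C.map weight).sum + t * D) + 1) (by
        intro hL'
        rw [Finset.mul_sum]
        refine tree_of_succ (p := put s X) (C := C) (T := T') (σ := (false ^^ σ)) X hX
          (fun a => (false, [], actAt (fun s => (T' s).head) s (some a) none)) ?_ rfl _ _ ?_
        -- Different guessed symbols give different actions on the tape `s`.
        · intro a _ b _ hab
          have := congrFun (congrArg (fun x => x.2.2) hab) s
          simpa [actAt] using this
        · intro a ha hL''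
          have := ih a ha hW (fun p hp => hD p (by simp [hp])) σ hL''
          convert this using 2
          · simp
          · rfl
          · rw [stackTape_update]
            funext s'
            rw [moveHead_actAt]
            simp only [T', Function.update_idem, Function.update_self, Tape.write_self]
            by_cases h : s' = s
            · subst h
              simp only [Function.update_self]
              exact stackTape_push a (m s')
            · simp [h])
    convert this using 1
    simp [weight]; ring
  | @seq P Q C m v m' t _ ih =>
    have := tree_of_succ_eq (W := W) (σ := σ) (hL := hL) (p := P.seq Q) rfl (moveHead_idle _)
      fun hL' => ih hW (fun p hp => by
        have h1 := hD (P.seq Q) (by simp)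
        simp only [cost] at h1
        simp only [List.mem_cons] at hp
        rcases hp with rfl | rfl | hp
        exacts [by omega, by omega, hD p (by simp [hp])]) _ hL'
    convert this using 1
    · simp
    · simp [weight]; ring
  | @case_nil s N B C m v m' t hs _ ih =>
    have := tree_of_succ_eq (W := W) (σ := σ) (hL := hL) (p := case s N B)
      (T := fun s => stackTape (m s)) (succ_case_none (by simp [stackTape_head, hs])) (moveHead_idle _)
      fun hL' => ih hW (fun p hp => by
        have h1 := hD (case s N B) (by simp)
        simp only [cost] at h1
        simp only [List.mem_cons] at hp
        rcases hp with rfl | hp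
        exacts [by omega, hD p (by simp [hp])]) _ hL'
    refine TM.Tree.mono (n := ?_) ?_ ?_
    rotate_left
    · simpa using this
    · simp [weight]; omega
  | @case_cons s N B C v m' t m a l hs _ ih =>
    have := tree_of_succ_eq (W := W) (σ := σ) (hL := hL) (p := case s N B)
      (T := fun s => stackTape (m s)) (T' := fun s' => stackTape (Function.update m s l s'))
      (succ_case_some (by simp [stackTape_head, hs]))
      (by
        intro s'
        rw [moveHead_actAt, hs, stackTape_pop]
        exact (congrFun (stackTape_update m s l) s').symm)
      fun hL' => ih hW (fun p hp => by
        have h1 := hD (case s N B) (by simp)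
        simp only [cost] at h1
        have h2 := Finset.single_le_sum (f := fun a => cost (B a)) (by simp) (Finset.mem_univ a)
        simp only [List.mem_cons] at hp
        rcases hp with rfl | hp
        exacts [by omega, hD p (by simp [hp])]) _ hL'
    have h2 := Finset.single_le_sum (f := fun a => weight (B a)) (by simp) (Finset.mem_univ a)
    refine TM.Tree.mono (n := ?_) ?_ ?_
    rotate_left
    · simpa using this
    · simp [weight]; omega
  | @loop_nil s B C m v m' t hs _ ih =>
    have := tree_of_succ_eq (W := W) (σ := σ) (hL := hL) (p := loop s B)
      (T := fun s => stackTape (m s)) (succ_loop_none (by simp [stackTape_head, hs])) (moveHead_idle _)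
      fun hL' => ih hW (fun p hp => hD p (by simp [hp])) _ hL'
    convert this using 1
    · simp
    · simp [weight]; ring
  | @loop_cons s B C v m' t m a l hs _ ih =>
    have h1 := hD (loop s B) (by simp)
    simp only [cost, Finset.sum_add_distrib] at h1
    have h2 := Finset.single_le_sum (f := fun a => cost (B a)) (by simp) (Finset.mem_univ a)
    have h3 := Finset.single_le_sum (f := fun a => weight (B a)) (by simp) (Finset.mem_univ a)
    have := tree_of_succ_eq (W := W) (σ := σ) (hL := hL) (p := loop s B)
      (T := fun s => stackTape (m s)) (T' := fun s' => stackTape (Function.update m s l s'))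
      (succ_loop_some (by simp [stackTape_head, hs]))
      (by
        intro s'
        rw [moveHead_actAt, hs, stackTape_pop]
        exact (congrFun (stackTape_update m s l) s').symm)
      fun hL' => ih hW (fun p hp => by
        simp only [List.mem_cons] at hp
        rcases hp with rfl | rfl | hp
        exacts [by omega, hD _ (by simp), hD p (by simp [hp])]) _ hL'
    refine TM.Tree.mono (n := ?_) ?_ ?_
    rotate_left
    · simpa using this
    · simp [weight, add_mul]; omega

end Prog

/-! ### Polynomial bounds -/

/-- Functions that are bounded by a polynomial. -/
def PolyBdd (f : ℕ → ℕ) : Prop := ∃ p : Polynomial ℕ, ∀ n, f n ≤ p.eval n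

theorem Polynomial.eval_monotone_nat (p : Polynomial ℕ) : Monotone fun n : ℕ => p.eval n := by
  intro a b h
  simp only [Polynomial.eval_eq_sum]
  exact Finset.sum_le_sum fun i _ => Nat.mul_le_mul_left _ (Nat.pow_le_pow_left h i)

namespace PolyBdd

theorem eval (p : Polynomial ℕ) : PolyBdd fun n => p.eval n := ⟨p, fun _ => le_rfl⟩

theorem const (c : ℕ) : PolyBdd fun _ => c := ⟨Polynomial.C c, fun n => by simp⟩

theorem id : PolyBdd fun n => n := ⟨Polynomial.X, fun n => by simp⟩

theorem add {f g : ℕ → ℕ} (hf : PolyBdd f) (hg : PolyBdd g) : PolyBdd fun n => f n + g n := by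
  obtain ⟨p, hp⟩ := hf
  obtain ⟨q, hq⟩ := hg
  exact ⟨p + q, fun n => by rw [Polynomial.eval_add]; exact add_le_add (hp n) (hq n)⟩

theorem mul {f g : ℕ → ℕ} (hf : PolyBdd f) (hg : PolyBdd g) : PolyBdd fun n => f n * g n := by
  obtain ⟨p, hp⟩ := hf
  obtain ⟨q, hq⟩ := hg
  exact ⟨p * q, fun n => by rw [Polynomial.eval_mul]; exact Nat.mul_le_mul (hp n) (hq n)⟩

theorem pow {f : ℕ → ℕ} (hf : PolyBdd f) (c : ℕ) : PolyBdd fun n => f n ^ c := by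
  obtain ⟨p, hp⟩ := hf
  exact ⟨p ^ c, fun n => by rw [Polynomial.eval_pow]; exact Nat.pow_le_pow_left (hp n) c⟩

theorem comp {f g : ℕ → ℕ} (hf : PolyBdd f) (hg : PolyBdd g) : PolyBdd fun n => f (g n) := by
  obtain ⟨p, hp⟩ := hf
  obtain ⟨q, hq⟩ := hg
  refine ⟨p.comp q, fun n => ?_⟩
  rw [Polynomial.eval_comp]
  exact (hp _).trans (Polynomial.eval_monotone_nat p (hq n))

end PolyBdd

/-! ### Functions computed by stack programs -/

namespace Prog

variable {A S : Type} [Finite A] [Finite S] [DecidableEq S]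

/-- The initial stacks: the input stands on the stack `inp`. -/
def start (bit : Bool → A) (inp : S) (x : List Bool) : S → List A :=
  Function.update (fun _ => []) inp (x.map bit)

theorem init_compile {P : Prog A S} {bit : Bool → A} {hbit : Function.Injective bit} {inp out : S}
    (x : List Bool) : (compile P bit hbit inp out).init x =
      conf P bit hbit inp out true [P] (self_mem_reach P) fun s => stackTape (start bit inp x s) := by
  simp only [TM.init, conf, start]
  congr 1
  funext s
  change S at s
  by_cases h : s = inp
  · subst h
    refine (if_pos rfl).trans ?_
    simp only [Function.update_self, stackTape, List.map_map]
    rfl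
  · refine (if_neg h).trans ?_
    simp only [Function.update_of_ne h]
    rfl

theorem tree_compile [Fintype A] {P : Prog A S} {bit : Bool → A} {hbit : Function.Injective bit}
    {inp out : S} {x : List Bool} {v : ℤ} {m' : S → List A} {t : ℕ}
    (h : Runs [P] (start bit inp x) v m' t)
    {W : (compile P bit hbit inp out).Cfg → ℤ → Prop}
    (hW : ∀ σ hL, W (conf P bit hbit inp out σ [] hL fun s => stackTape (m' s))
      (if σ then 1 else -1)) :
    TM.Tree W ((compile P bit hbit inp out).init x) v (weight P + t * cost P) := by
  rw [init_compile]
  simpa using tree_of_runs h hW (D := cost P) (by simp) true (self_mem_reach P)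

theorem polyTime_compile [Fintype A] {P : Prog A S} {bit : Bool → A}
    {hbit : Function.Injective bit} {inp out : S} {v : List Bool → ℤ}
    {m' : List Bool → S → List A} {T : ℕ → ℕ} (hT : PolyBdd T)
    (h : ∀ x, Runs [P] (start bit inp x) (v x) (m' x) (T x.length)) :
    (compile P bit hbit inp out).PolyTime := by
  obtain ⟨p, hp⟩ := ((PolyBdd.const (weight P)).add (hT.mul (PolyBdd.const (cost P))))
  refine ⟨p, fun x ts hts => ((tree_compile (h x) (W := fun _ _ => True) ?_).length_le hts).trans
    (hp x.length)⟩
  intros; trivial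

/-- A path of the compiled machine accepts exactly when its sign is positive, so the gap is the sum
of signs recorded by `Runs`. -/
theorem mem_GapP_of_runs {P : Prog A S} {bit : Bool → A} (hbit : Function.Injective bit) (inp : S)
    {g : List Bool → ℤ} {m' : List Bool → S → List A} {T : ℕ → ℕ} (hT : PolyBdd T)
    (h : ∀ x, Runs [P] (start bit inp x) (g x) (m' x) (T x.length)) : g ∈ GapP := by
  have := Fintype.ofFinite A
  refine ⟨compile P bit hbit inp inp, polyTime_compile hT h, funext fun x => ?_⟩
  refine (tree_compile (h x) ?_).gap_eq
  intro σ hL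
  have : (conf P bit hbit inp inp σ [] hL fun s => stackTape (m' x s)).state ∈
      (compile P bit hbit inp inp).accepting ↔ σ = true := Iff.rfl
  simp only [TM.leafSign, this]

/-- For an output only the final memory matters. The sum of signs `v` plays no role, and the machine
is deterministic by `Det`. -/
theorem mem_FP_of_runs {P : Prog A S} (hP : P.Det) {bit : Bool → A}
    (hbit : Function.Injective bit) (inp out : S) {f v : List Bool → ℤ}
    {m' : List Bool → S → List A} {T : ℕ → ℕ} (hT : PolyBdd T)
    (h : ∀ x, Runs [P] (start bit inp x) (v x) (m' x) (T x.length))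
    (hout : ∀ x, m' x out = (encodeInt (f x)).map bit) : f ∈ FP := by
  have := Fintype.ofFinite A
  refine ⟨compile P bit hbit inp out, compile_deterministic hP, polyTime_compile hT h,
    fun x => ?_⟩
  obtain ⟨ts, h1, h2, v', h3⟩ := (tree_compile (out := out) (hbit := hbit) (h x)
    (W := fun c _ => c.tapes out = stackTape (m' x out)) (fun _ _ => rfl)).exists_path
  refine ⟨ts, ⟨h1, h2⟩, ?_⟩
  refine h3.trans ?_
  rw [hout, stackTape, List.map_map]
  rfl

end Prog

/-! ### Basic stack programs -/

namespace Prog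

section Basic

variable {A S : Type} [DecidableEq S]

theorem Runs.congr {L : List (Prog A S)} {m m' m'' : S → List A} {v w : ℤ} {t t' : ℕ}
    (h : Runs L m v m' t) (hv : v = w) (hm : m' = m'') (ht : t ≤ t') : Runs L m w m'' t' := by
  subst hv hm
  exact h.mono ht

theorem Runs.then {P Q : Prog A S} {m m' m'' : S → List A} {v w : ℤ} {t t' : ℕ}
    (h : Runs [P] m v m' t) (h' : Runs [Q] m' w m'' t') :
    Runs [P ;; Q] m (v * w) m'' (t + t') :=
  .seq (h.cons h')

theorem Runs.then_one {P Q : Prog A S} {m m' m'' : S → List A} {w : ℤ} {t t' : ℕ}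
    (h : Runs [P] m 1 m' t) (h' : Runs [Q] m' w m'' t') : Runs [P ;; Q] m w m'' (t + t') :=
  .seq (h.cons_one h')

/-- Push the symbols of a list; its first symbol ends up on top. -/
def pushList (s : S) : List A → Prog A S
  | [] => skip
  | a :: l => pushList s l ;; push s a

omit [DecidableEq S] in
theorem det_push (s : S) (a : A) : (push s a).Det := by simp [push, guess, Det]

omit [DecidableEq S] in
theorem det_pushList (s : S) (l : List A) : (pushList s l).Det := by
  induction l with
  | nil => trivial
  | cons a l ih => exact ⟨ih, det_push s a⟩

theorem runs_push (s : S) (a : A) (m : S → List A) :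
    Runs [push s a] m 1 (Function.update m s (a :: m s)) 0 :=
  .push (.nil _ _)

theorem Runs.pushList {C : List (Prog A S)} {m m' : S → List A} {v : ℤ} {t : ℕ} {s : S}
    {l : List A} (h : Runs C (Function.update m s (l ++ m s)) v m' t) :
    Runs (Prog.pushList s l :: C) m v m' t := by
  induction l generalizing C with
  | nil => exact .skip (by simpa using h)
  | cons a l ih => exact .seq (ih (.push (by simpa using h)))

/-- Pop all symbols `a` of `s` and push `φ a` onto `t` and `ψ a` onto `u`. -/
def pour₂ (s t : S) (φ : A → List A) (u : S) (ψ : A → List A) : Prog A S :=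
  loop s fun a => pushList t (φ a) ;; pushList u (ψ a)

/-- Pop all symbols `a` of `s` and push `φ a` onto `t`. -/
def pour (s t : S) (φ : A → List A) : Prog A S := loop s fun a => pushList t (φ a)

/-- Empty the stack `s`. -/
def clear (s : S) : Prog A S := loop s fun _ => skip

/-- Append the image of `s` under `φ` on top of `t`; the stack `u` must be empty. -/
def dup (s t u : S) (φ : A → List A) : Prog A S :=
  pour s u (fun a => [a]) ;; pour₂ u s (fun a => [a]) t φ

omit [DecidableEq S] in
theorem det_pour₂ (s t : S) (φ : A → List A) (u : S) (ψ : A → List A) : (pour₂ s t φ u ψ).Det :=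
  fun _ => ⟨det_pushList _ _, det_pushList _ _⟩

omit [DecidableEq S] in
theorem det_pour (s t : S) (φ : A → List A) : (pour s t φ).Det := fun _ => det_pushList _ _

omit [DecidableEq S] in
theorem det_clear (s : S) : (clear s : Prog A S).Det := fun _ => trivial

omit [DecidableEq S] in
theorem det_dup (s t u : S) (φ : A → List A) : (dup s t u φ).Det :=
  ⟨det_pour _ _ _, det_pour₂ _ _ _ _ _⟩

/-- The symbol popped first ends up lowest, so pouring reverses the order; this accounts for
`reverse` in the result. -/
theorem runs_pour₂ {s t u : S} (hst : s ≠ t) (hsu : s ≠ u) (htu : t ≠ u) (φ ψ : A → List A)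
    (m : S → List A) :
    Runs [pour₂ s t φ u ψ] m 1 (Function.update (Function.update (Function.update m
      t ((m s).reverse.flatMap φ ++ m t)) u ((m s).reverse.flatMap ψ ++ m u)) s [])
      (m s).length := by
  generalize hl : m s = l
  induction l generalizing m with
  | nil => exact .loop_nil hl ((Runs.nil _ _).congr rfl (by funext r; simp only [Function.update_apply]; split_ifs <;> simp_all) le_rfl)
  | cons a l ih =>
    refine .loop_cons hl (.seq (.pushList (.pushList ?_)))
    refine (ih _ (by simp [hst, hsu])).congr rfl ?_ le_rfl
    funext r
    simp only [Function.update_apply]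
    split_ifs <;> simp_all

theorem runs_pour {s t : S} (hst : s ≠ t) (φ : A → List A) (m : S → List A) :
    Runs [pour s t φ] m 1 (Function.update (Function.update m
      t ((m s).reverse.flatMap φ ++ m t)) s []) (m s).length := by
  generalize hl : m s = l
  induction l generalizing m with
  | nil => exact .loop_nil hl ((Runs.nil _ _).congr rfl (by funext r; simp only [Function.update_apply]; split_ifs <;> simp_all) le_rfl)
  | cons a l ih =>
    refine .loop_cons hl (.pushList ?_)
    refine (ih _ (by simp [hst])).congr rfl ?_ le_rfl
    funext r
    simp only [Function.update_apply]
    split_ifs <;> simp_all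

theorem runs_clear (s : S) (m : S → List A) :
    Runs [clear s] m 1 (Function.update m s []) (m s).length := by
  generalize hl : m s = l
  induction l generalizing m with
  | nil => exact .loop_nil hl ((Runs.nil _ _).congr rfl (by simp [← hl]) le_rfl)
  | cons a l ih =>
    refine .loop_cons hl (.skip ?_)
    exact (ih _ (by simp)).congr rfl (by simp) le_rfl

/-- The first pour reverses the stack and the second one reverses it back. Hence `s` is restored,
and the copy on `t` has the original order. -/
theorem runs_dup {s t u : S} (hst : s ≠ t) (hsu : s ≠ u) (htu : t ≠ u) (φ : A → List A)
    {m : S → List A} (hu : m u = []) :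
    Runs [dup s t u φ] m 1 (Function.update m t ((m s).flatMap φ ++ m t)) (2 * (m s).length) := by
  refine ((runs_pour hsu _ m).then_one (runs_pour₂ hsu.symm htu.symm hst _ φ _)).congr rfl ?_ ?_
  · funext r
    simp only [Function.update_apply]
    split_ifs <;> simp_all
  · simp [hu, hsu.symm]; omega

/-- Empty all stacks in a list. -/
def clears : List S → Prog A S
  | [] => skip
  | s :: ss => clear s ;; clears ss

omit [DecidableEq S] in
theorem det_clears (ss : List S) : (clears ss : Prog A S).Det := by
  induction ss with
  | nil => trivial
  | cons s ss ih => exact ⟨det_clear s, ih⟩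

theorem runs_clears {ss : List S} {m : S → List A} {N : ℕ} (h : ∀ s ∈ ss, (m s).length ≤ N) :
    Runs [clears ss] m 1 (fun s => if s ∈ ss then [] else m s) (ss.length * N) := by
  induction ss generalizing m with
  | nil => exact .skip ((Runs.nil _ _).congr rfl (by simp) le_rfl)
  | cons s ss ih =>
    refine ((runs_clear s m).then_one (ih (m := Function.update m s []) ?_)).congr rfl ?_ ?_
    · intro r hr
      by_cases hrs : r = s
      · simp [hrs]
      · simpa [hrs] using h r (by simp [hr])
    · funext r
      by_cases hr : r = s <;> simp [hr]
    · have := h s (by simp)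
      simp only [List.length_cons, add_mul, one_mul]
      omega

end Basic

end Prog

/-! ### The tape alphabet -/

/-- The symbols used by stack programs: signed binary digits and some others. -/
abbrev Sym (B : Type) : Type := SignType ⊕ B

namespace Sym

variable {B : Type}

/-- The digit `d` as a symbol. -/
def dg (d : SignType) : Sym B := .inl d

/-- The value of a symbol as a digit. -/
def dig : Sym B → SignType := Sum.elim id fun _ => 0

@[simp]
theorem dig_dg (d : SignType) : dig (dg d : Sym B) = d := rfl

/-- A bit as a symbol. -/
def bit (b : Bool) : Sym B := dg (if b then 1 else 0)

/-- The value of a symbol as a bit. -/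
def unbit (a : Sym B) : Bool := decide (dig a = 1)

@[simp]
theorem unbit_bit (b : Bool) : unbit (bit b : Sym B) = b := by cases b <;> rfl

theorem bit_injective : Function.Injective (bit : Bool → Sym B) :=
  Function.LeftInverse.injective unbit_bit

end Sym

open CountingClasses.Prog CountingClasses.Sym

/-! ### Simulating a Turing machine by a stack program -/

/-- Stacks and symbols for the simulation of the machine `M`: a stack for the state and two stacks
for every tape. -/
structure Host (M : TM) (A S : Type) where
  stack : Unit ⊕ M.K ⊕ M.K → S
  stack_injective : Function.Injective stack
  cQ : M.Q ↪ A
  cΓ : M.Γ ↪ A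
  cT : M.Trans ↪ A

namespace Host

variable {M : TM} {A S : Type} (H : Host M A S)

/-- The stack for the state. -/
def st : S := H.stack (.inl ())

/-- The stack for the part of tape `k` to the left of the head. -/
def lt (k : M.K) : S := H.stack (.inr (.inl k))

/-- The stack for the rest of tape `k`. -/
def rt (k : M.K) : S := H.stack (.inr (.inr k))

/-- Decode a state. -/
noncomputable def dQ : A → M.Q := haveI : Nonempty M.Q := ⟨M.start⟩; Function.invFun H.cQ

/-- Decode a tape symbol. -/
noncomputable def dΓ : A → M.Γ := Function.invFun H.cΓ

/-- Decode a transition. -/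
noncomputable def dT : A → M.Trans :=
  haveI : Nonempty M.Trans := ⟨(M.start, fun _ => (default, none))⟩
  Function.invFun H.cT

@[simp]
theorem dQ_cQ (q : M.Q) : H.dQ (H.cQ q) = q :=
  haveI : Nonempty M.Q := ⟨M.start⟩; Function.leftInverse_invFun H.cQ.injective q

@[simp]
theorem dΓ_cΓ (a : M.Γ) : H.dΓ (H.cΓ a) = a := Function.leftInverse_invFun H.cΓ.injective a

@[simp]
theorem dT_cT (t : M.Trans) : H.dT (H.cT t) = t :=
  haveI : Nonempty M.Trans := ⟨(M.start, fun _ => (default, none))⟩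
  Function.leftInverse_invFun H.cT.injective t

/-- The memory in which the stacks for the simulation have given contents. -/
noncomputable def mem (m : S → List A) (z : List A) (l r : M.K → List M.Γ) : S → List A :=
  Function.extend H.stack (Sum.elim (fun _ => z)
    (Sum.elim (fun k => (l k).map H.cΓ) fun k => (r k).map H.cΓ)) m

variable {H} {m : S → List A} {z : List A} {l r : M.K → List M.Γ}

@[simp]
theorem mem_st : H.mem m z l r H.st = z := H.stack_injective.extend_apply _ _ _

@[simp]
theorem mem_lt (k : M.K) : H.mem m z l r (H.lt k) = (l k).map H.cΓ :=
  H.stack_injective.extend_apply _ _ _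

@[simp]
theorem mem_rt (k : M.K) : H.mem m z l r (H.rt k) = (r k).map H.cΓ :=
  H.stack_injective.extend_apply _ _ _

theorem mem_of_notMem {s : S} (hs : s ∉ Set.range H.stack) : H.mem m z l r s = m s :=
  Function.extend_apply' _ _ _ hs

theorem update_extend {α β γ : Type*} [DecidableEq α] [DecidableEq β] {f : α → β}
    (hf : Function.Injective f) (g : α → γ) (e : β → γ) (a : α) (x : γ) :
    Function.update (Function.extend f g e) (f a) x = Function.extend f (Function.update g a x) e := by
  funext b
  by_cases hb : ∃ a', f a' = b
  · obtain ⟨a', rfl⟩ := hb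
    by_cases h : a' = a
    · subst h; simp [hf.extend_apply]
    · simp [hf.extend_apply, hf.ne h, h]
  · rw [Function.update_of_ne (fun h => hb ⟨a, h.symm⟩), Function.extend_apply' _ _ _ hb,
      Function.extend_apply' _ _ _ hb]

variable [DecidableEq S]

@[simp]
theorem update_mem_st (z' : List A) :
    Function.update (H.mem m z l r) H.st z' = H.mem m z' l r := by
  classical
  refine (update_extend H.stack_injective _ _ _ _).trans ?_
  unfold mem
  congr 1
  funext y
  rcases y with _ | k | k <;> simp

theorem update_mem_lt [DecidableEq M.K] (k : M.K) (x : List M.Γ) :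
    Function.update (H.mem m z l r) (H.lt k) (x.map H.cΓ) = H.mem m z (Function.update l k x) r := by
  refine (update_extend H.stack_injective _ _ _ _).trans ?_
  unfold mem
  congr 1
  funext y
  rcases y with _ | k' | k'
  · simp
  · by_cases h : k' = k
    · subst h; simp
    · simp [h]
  · simp

theorem update_mem_rt [DecidableEq M.K] (k : M.K) (x : List M.Γ) :
    Function.update (H.mem m z l r) (H.rt k) (x.map H.cΓ) = H.mem m z l (Function.update r k x) := by
  refine (update_extend H.stack_injective _ _ _ _).trans ?_
  unfold mem
  congr 1
  funext y
  rcases y with _ | k' | k'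
  · simp
  · simp
  · by_cases h : k' = k
    · subst h; simp
    · simp [h]

variable (H)

open Classical in
/-- Pop the symbols under the heads of the tapes in a list and continue as they demand. -/
noncomputable def readHeads (cont : (M.K → M.Γ) → Prog A S) :
    List M.K → (M.K → M.Γ) → Prog A S
  | [], h => cont h
  | k :: ks, h => case (H.rt k) (readHeads cont ks (Function.update h k default))
      fun a => readHeads cont ks (Function.update h k (H.dΓ a))

/-- Write a symbol and move the head, where the symbol under the head has been popped. -/
def writeMove (k : M.K) (a : M.Γ) : Option Dir → Prog A S
  | none => push (H.rt k) (H.cΓ a)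
  | some .right => push (H.lt k) (H.cΓ a)
  | some .left => push (H.rt k) (H.cΓ a) ;;
      case (H.lt k) (push (H.rt k) (H.cΓ default)) fun x => push (H.rt k) x

/-- Execute an action on the tapes in a list. -/
def apply (act : M.K → M.Γ × Option Dir) : List M.K → Prog A S
  | [] => skip
  | k :: ks => H.writeMove k (act k).1 (act k).2 ;; apply act ks

variable {H}

/-- The effect of `writeMove` on the two stacks of a tape. -/
def effect (a : M.Γ) : Option Dir → List M.Γ × List M.Γ → List M.Γ × List M.Γ
  | none, p => (p.1, a :: p.2)
  | some .right, p => (a :: p.1, p.2)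
  | some .left, p => (p.1.tail, p.1.headI :: a :: p.2)

theorem effect_length (a : M.Γ) (d : Option Dir) (p : List M.Γ × List M.Γ) :
    (effect a d p).1.length + (effect a d p).2.length ≤ p.1.length + p.2.length + 2 := by
  rcases d with _ | _ | _ <;> simp [effect] <;> omega

/-- The symbol under the head has already been popped, hence `r.tail`. Cells beyond the end of a
stack are blank, which `headI` and `tail` respect, so no case distinction on empty stacks is needed.
-/
theorem moveHead_write (a : M.Γ) (d : Option Dir) (l r : List M.Γ) :
    TM.moveHead d ((Tape.mk' (ListBlank.mk l) (ListBlank.mk r)).write a) =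
      Tape.mk' (ListBlank.mk (effect a d (l, r.tail)).1)
        (ListBlank.mk (effect a d (l, r.tail)).2) := by
  have h : (Tape.mk' (ListBlank.mk l) (ListBlank.mk r)).write a =
      Tape.mk' (ListBlank.mk l) (ListBlank.mk (a :: r.tail)) := by
    have hr : ListBlank.mk r = ListBlank.cons r.headI (ListBlank.mk r.tail) := by
      rw [← ListBlank.head_mk, ← ListBlank.tail_mk, ListBlank.cons_head_tail]
    rw [hr, Tape.write_mk', ListBlank.tail_cons, ListBlank.cons_mk]
  rw [h]
  rcases d with _ | _ | _
  · rfl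
  · simp only [TM.moveHead, effect, Tape.move_left_mk', ListBlank.head_mk, ListBlank.tail_mk,
      ListBlank.cons_mk]
  · simp only [TM.moveHead, effect, Tape.move_right_mk', ListBlank.head_mk, ListBlank.tail_mk,
      ListBlank.cons_mk, List.headI_cons, List.tail_cons]

/-- The symbols read are remembered by the branch of the program that is taken. Without repetitions
in `ks`, each stack is popped only once. -/
theorem runs_readHeads [DecidableEq M.K] {cont : (M.K → M.Γ) → Prog A S} {ks : List M.K}
    (hks : ks.Nodup) {h : M.K → M.Γ} {C : List (Prog A S)} {v : ℤ} {m' : S → List A} {t : ℕ}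
    (hr : Runs (cont (fun k => if k ∈ ks then (r k).headI else h k) :: C)
      (H.mem m z l fun k => if k ∈ ks then (r k).tail else r k) v m' t) :
    Runs (H.readHeads cont ks h :: C) (H.mem m z l r) v m' t := by
  induction ks generalizing h r with
  | nil => simpa [readHeads] using hr
  | cons k ks ih =>
    obtain ⟨hk, hks⟩ := List.nodup_cons.1 hks
    rcases hrk : r k with _ | ⟨a, x⟩
    · refine .case_nil (by simp [hrk]) (ih hks ?_)
      convert hr using 3
      · funext k'
        by_cases h' : k' = k
        · subst h'; simp [hk, hrk]
        · simp [h']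
      · rename_i k'
        by_cases h' : k' = k
        · subst h'; simp [hk, hrk]
        · simp [h']
    · refine .case_cons (a := H.cΓ a) (l := x.map H.cΓ) (by simp [hrk]) ?_
      rw [update_mem_rt]
      refine ih hks ?_
      convert hr using 3
      · funext k'
        by_cases h' : k' = k
        · subst h'; simp [hk, hrk]
        · simp [h']
      · rename_i k'
        by_cases h' : k' = k
        · subst h'; simp [hk, hrk]
        · simp [h']

theorem runs_writeMove [DecidableEq M.K] {k : M.K} {a : M.Γ} {d : Option Dir}
    {C : List (Prog A S)} {v : ℤ} {m' : S → List A} {t : ℕ}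
    (hr : Runs C (H.mem m z (Function.update l k (effect a d (l k, r k)).1)
      (Function.update r k (effect a d (l k, r k)).2)) v m' t) :
    Runs (H.writeMove k a d :: C) (H.mem m z l r) v m' t := by
  have hpush : ∀ {l r : M.K → List M.Γ} {a C},
      Runs C (H.mem m z l (Function.update r k (a :: r k))) v m' t →
      Runs (push (H.rt k) (H.cΓ a) :: C) (H.mem m z l r) v m' t := by
    intro l r a C h
    refine .push ?_
    rwa [mem_rt, ← List.map_cons, update_mem_rt]
  rcases d with _ | _ | _
  · refine hpush ?_
    simpa [effect] using hr
  · refine .seq (hpush ?_)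
    rcases hlk : l k with _ | ⟨b, x⟩
    · refine .case_nil (by simp [hlk]) (hpush ?_)
      have hl : Function.update l k [] = l := by rw [← hlk]; simp
      simpa [effect, hlk, hl] using hr
    · refine .case_cons (a := H.cΓ b) (l := x.map H.cΓ) (by simp [hlk]) ?_
      rw [update_mem_lt]
      refine hpush ?_
      simpa [effect, hlk] using hr
  · refine .push ?_
    rw [mem_lt, ← List.map_cons, update_mem_lt]
    simpa [effect] using hr

theorem runs_apply [DecidableEq M.K] {act : M.K → M.Γ × Option Dir} {ks : List M.K}
    (hks : ks.Nodup) {C : List (Prog A S)} {v : ℤ} {m' : S → List A} {t : ℕ}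
    (hr : Runs C (H.mem m z
      (fun k => if k ∈ ks then (effect (act k).1 (act k).2 (l k, r k)).1 else l k)
      (fun k => if k ∈ ks then (effect (act k).1 (act k).2 (l k, r k)).2 else r k)) v m' t) :
    Runs (H.apply act ks :: C) (H.mem m z l r) v m' t := by
  induction ks generalizing l r with
  | nil => exact .skip (by simpa using hr)
  | cons k ks ih =>
    obtain ⟨hk, hks⟩ := List.nodup_cons.1 hks
    refine .seq (runs_writeMove (ih hks ?_))
    convert hr using 2
    · funext k'
      by_cases h' : k' = k
      · subst h'; simp [hk]
      · simp [h']
    · funext k'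
      by_cases h' : k' = k
      · subst h'; simp [hk]
      · simp [h']

variable (H)

/-- The list of all tapes. -/
noncomputable def tapes (M : TM) : List M.K :=
  haveI := M.finK; haveI := Fintype.ofFinite M.K; Finset.univ.toList

omit [DecidableEq S] in
theorem mem_tapes (k : M.K) : k ∈ tapes M := by simp [tapes]

omit [DecidableEq S] in
theorem nodup_tapes : (tapes M).Nodup := Finset.nodup_toList _

open Classical in
/-- Simulate a step of `M`, and run `fin` with the last state when `M` has halted. -/
noncomputable def step (fin : M.Q → Prog A S) (a : A) : Prog A S :=
  H.readHeads (fun h =>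
    if M.δ (H.dQ a) h = ∅ then H.apply (fun k => (h k, none)) (tapes M) ;; fin (H.dQ a)
    else guess H.st ((M.δ (H.dQ a) h).map H.cT) ;;
      case H.st skip fun b => H.apply (H.dT b).2 (tapes M) ;; push H.st (H.cQ (H.dT b).1))
    (tapes M) default

/-- Simulate `M`. -/
noncomputable def sim (fin : M.Q → Prog A S) : Prog A S := loop H.st (H.step fin)

omit [DecidableEq S] in
theorem det_apply (act : M.K → M.Γ × Option Dir) (ks : List M.K) : (H.apply act ks).Det := by
  induction ks with
  | nil => trivial
  | cons k ks ih =>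
    refine ⟨?_, ih⟩
    generalize (act k).2 = d
    rcases d with _ | _ | _
    · exact det_push _ _
    · exact ⟨det_push _ _, det_push _ _, fun _ => det_push _ _⟩
    · exact det_push _ _

omit [DecidableEq S] in
theorem det_sim {fin : M.Q → Prog A S} (hM : M.Deterministic) (hfin : ∀ q, (fin q).Det) :
    (H.sim fin).Det := by
  intro a
  have h1 : ∀ (cont : (M.K → M.Γ) → Prog A S), (∀ h, (cont h).Det) →
      ∀ ks h, (H.readHeads cont ks h).Det := by
    intro cont hcont ks
    induction ks with
    | nil => exact hcont
    | cons k ks ih => exact fun h => ⟨ih _, fun a => ih _⟩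
  refine h1 _ (fun h => ?_) _ _
  split_ifs
  · exact ⟨H.det_apply _ _, hfin _⟩
  · exact ⟨⟨trivial, by simpa [Det] using hM _ _⟩, trivial, fun b => ⟨H.det_apply _ _, det_push _ _⟩⟩

variable {H}

/-- The proof follows the computation tree: one loop iteration simulates one transition, which is
guessed on the stack for the state. That stack receives the next state unless the machine has
halted, in which case it stays empty and the loop ends. The memory `m'` must not depend on the leaf,
as `Runs` demands a common final memory; `fin` has to clean up accordingly. In `hN`, every step adds
at most two symbols to a tape, and one more may come from putting the head symbol back at the end.
-/
theorem runs_sim {fin : M.Q → Prog A S} {W : M.Cfg → ℤ → Prop} {m' : S → List A} {N tf : ℕ}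
    (hm' : m' H.st = [])
    (hfin : ∀ (c : M.Cfg) (v : ℤ) (l r : M.K → List M.Γ), W c v →
      (∀ k, c.tapes k = Tape.mk' (ListBlank.mk (l k)) (ListBlank.mk (r k))) →
      (∀ k, (l k).length + (r k).length ≤ N) →
      Runs [fin c.state] (H.mem m [] l r) v m' tf)
    {c : M.Cfg} {v : ℤ} {n : ℕ} (hT : TM.Tree W c v n)
    (htapes : ∀ k, c.tapes k = Tape.mk' (ListBlank.mk (l k)) (ListBlank.mk (r k)))
    (hN : ∀ k, (l k).length + (r k).length + 2 * n + 1 ≤ N) :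
    Runs [H.sim fin] (H.mem m [H.cQ c.state] l r) v m' (n + 1 + tf) := by
  classical
  induction hT generalizing l r with
  | @halt c v n hc hv =>
    have hhead : (fun k => (r k).headI) = fun k => (c.tapes k).head := by
      funext k; simp [htapes]
    have hδ : M.δ c.state (fun k => (r k).headI) = ∅ := by rw [hhead]; exact hc
    refine ((Runs.loop_cons (t := tf) mem_st ?_).mono (by omega))
    rw [update_mem_st]
    refine runs_readHeads nodup_tapes ?_
    simp only [mem_tapes, if_true, dQ_cQ, hδ]
    refine .seq (runs_apply nodup_tapes ?_)
    simp only [mem_tapes, if_true, effect]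
    -- The symbols under the heads were popped for reading and are back on their stacks here; a
    -- blank may have been made explicit.
    have h := (hfin c v l (fun k => (r k).headI :: (r k).tail) hv (fun k => by
      rw [htapes, ← ListBlank.cons_mk, ← ListBlank.head_mk, ← ListBlank.tail_mk,
        ListBlank.cons_head_tail]) (fun k => by
      have := hN k; simp only [List.length_cons, List.length_tail]; omega)).cons
      (Runs.loop_nil (B := H.step fin) hm' (.nil m' 0))
    simpa using h
  | @step c v n hne _ ih =>
    have hhead : (fun k => (r k).headI) = fun k => (c.tapes k).head := by
      funext k; simp [htapes]
    have hδ : M.δ c.state (fun k => (r k).headI) = c.options := by rw [hhead]; rfl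
    have h : Runs [H.sim fin] (H.mem m [H.cQ c.state] l r) (∑ t ∈ c.options, v t) m'
        (n + 1 + tf + 1) := by
      refine Runs.loop_cons mem_st ?_
      rw [update_mem_st]
      refine runs_readHeads nodup_tapes ?_
      simp only [mem_tapes, if_true, dQ_cQ, hδ, hne.ne_empty, if_false]
      have := Runs.guess (C := [case H.st skip fun b =>
        H.apply (H.dT b).2 (tapes M) ;; push H.st (H.cQ (H.dT b).1), H.sim fin])
        (m := H.mem m [] l fun k => (r k).tail) (m' := m') (t := n + 1 + tf) (s := H.st)
        (X := c.options.map H.cT) (fun a => v (H.dT a)) (by simpa using hne) (by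
          intro a ha
          obtain ⟨t, ht, rfl⟩ := Finset.mem_map.1 ha
          -- The guessed transition is popped at once; its only purpose was to select the branch.
          refine .case_cons (by simp; exact ⟨rfl, rfl⟩) (.seq ?_)
          rw [mem_st, update_mem_st, update_mem_st]
          refine runs_apply nodup_tapes (.push ?_)
          simp only [mem_tapes, if_true, dT_cT, mem_st, update_mem_st]
          refine ih t ht (fun k => ?_) (fun k => ?_)
          · simp only [TM.Cfg.exec, htapes, moveHead_write]
          · have h1 := effect_length (t.2 k).1 (t.2 k).2 (l k, (r k).tail)
            have h2 := hN k
            simp only [List.length_tail] at h1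
            omega)
      refine .seq (.seq ?_)
      simpa [sim] using this
    exact h.mono (by omega)

end Host

/-! ### Calling a Turing machine from a stack program -/

namespace Host

section

variable {M : TM} {A S : Type} {H : Host M A S} {m : S → List A}

theorem mem_empty (hm : ∀ y, m (H.stack y) = []) : H.mem m [] (fun _ => []) (fun _ => []) = m := by
  funext s
  by_cases hs : s ∈ Set.range H.stack
  · obtain ⟨y, rfl⟩ := hs
    rw [mem, H.stack_injective.extend_apply, hm]
    rcases y with _ | _ | _ <;> rfl
  · exact mem_of_notMem hs

theorem update_mem [DecidableEq S] {z : List A} {l r : M.K → List M.Γ} {s : S}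
    (hs : s ∉ Set.range H.stack) (x : List A) :
    Function.update (H.mem m z l r) s x = H.mem (Function.update m s x) z l r := by
  funext s'
  by_cases hs' : s' ∈ Set.range H.stack
  · have : s' ≠ s := fun h => hs (h ▸ hs')
    rw [Function.update_of_ne this]
    obtain ⟨y, rfl⟩ := hs'
    rw [mem, mem, H.stack_injective.extend_apply, H.stack_injective.extend_apply]
  · rw [mem_of_notMem hs']
    by_cases h : s' = s
    · subst h; simp
    · rw [Function.update_of_ne h, Function.update_of_ne h, mem_of_notMem hs']

variable (H)

/-- The list of all stacks for the simulation. -/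
noncomputable def regs : List S :=
  haveI := M.finK; haveI := Fintype.ofFinite M.K; Finset.univ.toList.map H.stack

theorem mem_regs {s : S} : s ∈ H.regs ↔ s ∈ Set.range H.stack := by
  simp [regs, -Sum.exists]

theorem mem_apply_length {l r : M.K → List M.Γ} {N : ℕ}
    (hN : ∀ k, (l k).length + (r k).length ≤ N) {s : S} (hs : s ∈ Set.range H.stack) :
    (H.mem m [] l r s).length ≤ N := by
  obtain ⟨y, rfl⟩ := hs
  rw [mem, H.stack_injective.extend_apply]
  rcases y with _ | k | k
  · simp
  · simpa using (Nat.le_add_right _ _).trans (hN k)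
  · simpa using (Nat.le_add_left _ _).trans (hN k)

theorem init_tapes [DecidableEq M.K] (x : List Bool) (k : M.K) : (M.init x).tapes k =
    Tape.mk' (ListBlank.mk [])
      (ListBlank.mk (Function.update (fun _ => []) M.inp (x.map M.sym) k)) := by
  by_cases h : k = M.inp
  · subst h
    simp [TM.init, Tape.mk₁, Tape.mk₂]
  · simp [TM.init, h]
    rfl

end

variable {M : TM} {B S : Type} (H : Host M (Sym B) S)

/-- Move the input from `s` to the input tape of the simulated machine. -/
def load (s : S) : Prog (Sym B) S :=
  pour s (H.lt M.inp) (fun a => [H.cΓ (M.sym (unbit a))]) ;;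
    pour (H.lt M.inp) (H.rt M.inp) (fun a => [a]) ;; push H.st (H.cQ M.start)

open Classical in
/-- Change the sign of the path if the simulated machine has rejected, and clean up. -/
noncomputable def finGap (q : M.Q) : Prog (Sym B) S :=
  (if q ∈ M.accepting then skip else neg) ;; clears H.regs

/-- Run the machine on the string in `s` for its gap. -/
noncomputable def callGap (s : S) : Prog (Sym B) S := H.load s ;; H.sim H.finGap

open Classical in
/-- Decode a tape symbol as a bit; this gives nothing for other symbols. -/
noncomputable def decode (a : M.Γ) : List Bool :=
  if a = M.sym true then [true] else if a = M.sym false then [false] else []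

/-- Move the output of the simulated machine to `s`, and clean up. -/
noncomputable def finOut [DecidableEq S] (s : S) : Prog (Sym B) S :=
  clears (H.regs.filter fun s => s ≠ H.rt M.out) ;;
    pour (H.rt M.out) (H.lt M.out) (fun a => (decode (H.dΓ a)).map bit) ;;
    pour (H.lt M.out) s fun a => [a]

/-- Run the machine on the string in `s` and replace this string by the output. -/
noncomputable def callOut [DecidableEq S] (s : S) : Prog (Sym B) S := H.load s ;; H.sim fun _ => H.finOut s

theorem det_load (s : S) : (H.load s).Det := ⟨det_pour _ _ _, det_pour _ _ _, det_push _ _⟩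

theorem det_callOut [DecidableEq S] (hM : M.Deterministic) (s : S) : (H.callOut s).Det :=
  ⟨H.det_load s, H.det_sim hM fun _ => ⟨det_clears _, det_pour _ _ _, det_pour _ _ _⟩⟩

theorem decode_sym (b : Bool) : decode (M.sym b) = [b] := by
  cases b <;> simp [decode, M.sym_injective.eq_iff]

theorem decode_default : decode (default : M.Γ) = [] := by
  simp [decode, (M.sym_ne_blank _).symm]

theorem flatMap_decode_sym (y : List Bool) : (y.map M.sym).flatMap decode = y := by
  induction y with
  | nil => rfl
  | cons b y ih => simp [decode_sym, ih]

/-- Equal half-tapes may be represented by lists that differ in trailing blanks. Decoding maps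
blanks to nothing, so the string read off does not depend on the representative. -/
theorem flatMap_decode {l : List M.Γ} {y : List Bool}
    (h : ListBlank.mk l = ListBlank.mk (y.map M.sym)) : l.flatMap decode = y := by
  have hblank : ∀ n, (List.replicate n (default : M.Γ)).flatMap decode = [] := by
    intro n
    induction n with
    | zero => rfl
    | succ n ih => simp [List.replicate_succ, decode_default, ih]
  have := flatMap_decode_sym (M := M) y
  rcases Quotient.exact h with ⟨n, hn⟩ | ⟨n, hn⟩
  · rw [hn, List.flatMap_append, hblank, List.append_nil] at this
    exact this
  · rw [hn, List.flatMap_append, hblank, List.append_nil]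
    exact this

theorem length_decode_le (l : List M.Γ) : (l.flatMap decode).length ≤ l.length := by
  induction l with
  | nil => simp
  | cons a l ih =>
    have : (decode a).length ≤ 1 := by unfold decode; split_ifs <;> simp
    simp only [List.flatMap_cons, List.length_append, List.length_cons]
    omega

/-- A leaf of a computation tree whose tapes are not too long. -/
theorem exists_leaf {W : M.Cfg → ℤ → Prop} {l r : M.K → List M.Γ} {N : ℕ} {c : M.Cfg} {v : ℤ}
    {n : ℕ} (hT : TM.Tree W c v n)
    (htapes : ∀ k, c.tapes k = Tape.mk' (ListBlank.mk (l k)) (ListBlank.mk (r k)))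
    (hN : ∀ k, (l k).length + (r k).length + 2 * n ≤ N) :
    ∃ (c : M.Cfg) (v : ℤ) (l r : M.K → List M.Γ), W c v ∧
      (∀ k, c.tapes k = Tape.mk' (ListBlank.mk (l k)) (ListBlank.mk (r k))) ∧
      ∀ k, (l k).length + (r k).length ≤ N := by
  induction hT generalizing l r with
  | @halt c v n hc hv => exact ⟨c, v, l, r, hv, htapes, fun k => by have := hN k; omega⟩
  | @step c v n hne _ ih =>
    obtain ⟨t, ht⟩ := hne
    refine ih t ht (l := fun k => (effect (t.2 k).1 (t.2 k).2 (l k, (r k).tail)).1)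
      (r := fun k => (effect (t.2 k).1 (t.2 k).2 (l k, (r k).tail)).2) (fun k => ?_) fun k => ?_
    · simp only [TM.Cfg.exec, htapes, moveHead_write]
    · have h1 := effect_length (t.2 k).1 (t.2 k).2 (l k, (r k).tail)
      have h2 := hN k
      simp only [List.length_tail] at h1
      omega

/-! ### Correctness and running time of machine calls -/

variable {H}

theorem lt_ne_rt (k k' : M.K) : H.lt k ≠ H.rt k' := fun h => by
  simpa using H.stack_injective h

variable [DecidableEq S] {m : S → List (Sym B)} {s : S}

/-- The input passes through the left stack of the input tape. Two pours reverse it twice, so its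
first symbol is under the head. -/
theorem runs_load [DecidableEq M.K] (hm : ∀ y, m (H.stack y) = []) (hs : s ∉ Set.range H.stack)
    {x : List Bool} (hx : m s = x.map bit) :
    Runs [H.load s] m 1 (H.mem (Function.update m s []) [H.cQ M.start] (fun _ => [])
      (Function.update (fun _ => []) M.inp (x.map M.sym))) (2 * x.length) := by
  have hsl : s ≠ H.lt M.inp := fun h => hs ⟨_, h.symm⟩
  have h1 := runs_pour hsl (fun a => [H.cΓ (M.sym (unbit a))]) m
  have e1 : Function.update (Function.update m (H.lt M.inp)
      ((m s).reverse.flatMap (fun a => [H.cΓ (M.sym (unbit a))]) ++ m (H.lt M.inp))) s [] =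
      H.mem (Function.update m s []) [] (Function.update (fun _ => []) M.inp (x.map M.sym).reverse)
        (fun _ => []) := by
    rw [← update_mem hs, ← update_mem_lt, mem_empty hm]
    congr 2
    rw [show m (H.lt M.inp) = [] from hm _, hx, ← List.map_reverse, List.append_nil]
    rw [← List.map_eq_flatMap, List.map_map, List.map_reverse, List.map_reverse, List.map_map]
    simp [Function.comp_def]
  rw [e1] at h1
  have h2 := runs_pour (lt_ne_rt (H := H) M.inp M.inp) (fun a => [a])
    (H.mem (Function.update m s []) [] (Function.update (fun _ => []) M.inp (x.map M.sym).reverse)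
        (fun _ => []))
  have e2 : ∀ w : List (Sym B), w.flatMap (fun a => [a]) = w := by simp
  have e3 : ((x.map M.sym).reverse.map H.cΓ).reverse = (x.map M.sym).map H.cΓ := by
    rw [← List.map_reverse, List.reverse_reverse]
  rw [mem_lt, mem_rt, e2, Function.update_self, e3, List.map_nil, List.append_nil, update_mem_rt, ← List.map_nil (f := H.cΓ), update_mem_lt,
    Function.update_idem, Function.update_eq_self_iff.2 rfl] at h2
  refine (h1.then_one (h2.then_one (runs_push _ _ _))).congr rfl ?_ ?_
  · simp
  · simp [hx]; omega

/-- Different paths of the machine leave different tapes. They are all erased at the end, which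
gives the common final memory required by `Runs`, and rejecting paths change their sign. -/
theorem runs_callGap {p : Polynomial ℕ}
    (hp : ∀ x ts, TM.IsRun (M.init x) ts → ts.length ≤ p.eval x.length) :
    ∃ q : Polynomial ℕ, ∀ (x : List Bool) (m : S → List (Sym B)) (s : S),
      (∀ y, m (H.stack y) = []) → s ∉ Set.range H.stack → m s = x.map bit →
      Runs [H.callGap s] m (M.gap x) (Function.update m s []) (q.eval x.length) := by
  classical
  have hbdd : PolyBdd fun n => 2 * n + (p.eval n + 1 + H.regs.length * (n + 2 * p.eval n + 1)) :=
    ((PolyBdd.const 2).mul .id).add (((PolyBdd.eval p).add (.const 1)).add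
      ((PolyBdd.const _).mul ((PolyBdd.id.add ((PolyBdd.const 2).mul (.eval p))).add (.const 1))))
  obtain ⟨q, hq⟩ := hbdd
  refine ⟨q, fun x m s hm hs hx => Runs.mono ?_ (hq x.length)⟩
  have hm' : ∀ y, Function.update m s [] (H.stack y) = [] := fun y => by
    rw [Function.update_of_ne (fun h => hs ⟨y, h⟩), hm]
  refine (runs_load hm hs hx).then_one (runs_sim
    (N := x.length + 2 * p.eval x.length + 1) (hm' _) ?_ (TM.tree_gap hp x)
    (init_tapes x) fun k => ?_)
  · rintro c v l r hv - hN
    have hcl := runs_clears (ss := H.regs) (m := H.mem (Function.update m s []) [] l r)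
      fun s' hs' => H.mem_apply_length hN (H.mem_regs.1 hs')
    have e : (fun s' => if s' ∈ H.regs then [] else H.mem (Function.update m s []) [] l r s') =
        Function.update m s [] := by
      funext s'
      by_cases h : s' ∈ Set.range H.stack
      · rw [if_pos (H.mem_regs.2 h)]
        obtain ⟨y, rfl⟩ := h
        exact (hm' y).symm
      · rw [if_neg (fun h' => h (H.mem_regs.1 h')), mem_of_notMem h]
    rw [e] at hcl
    refine .seq ?_
    by_cases hacc : c.state ∈ M.accepting
    · rw [if_pos hacc]
      rw [hv, TM.leafSign, if_pos hacc]
      exact .skip hcl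
    · rw [if_neg hacc]
      rw [hv, TM.leafSign, if_neg hacc]
      exact .neg hcl
  · by_cases h : k = M.inp
    · subst h; simp
    · simp [h]

theorem runs_callOut {f : List Bool → List Bool} {p : Polynomial ℕ} (hM : M.Deterministic)
    (hp : ∀ x ts, TM.IsRun (M.init x) ts → ts.length ≤ p.eval x.length) (hf : M.Computes f) :
    ∃ q : Polynomial ℕ, ∀ x : List Bool, (f x).length ≤ q.eval x.length ∧
      ∀ (m : S → List (Sym B)) (s : S),
      (∀ y, m (H.stack y) = []) → s ∉ Set.range H.stack → m s = x.map bit →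
      Runs [H.callOut s] m 1 (Function.update m s ((f x).map bit)) (q.eval x.length) := by
  classical
  have hbdd : PolyBdd fun n => 2 * n + (p.eval n + 1 +
      (H.regs.length * (n + 2 * p.eval n + 1) + 2 * (n + 2 * p.eval n + 1))) :=
    have h1 : PolyBdd fun n => n + 2 * p.eval n + 1 :=
      (PolyBdd.id.add ((PolyBdd.const 2).mul (.eval p))).add (.const 1)
    ((PolyBdd.const 2).mul .id).add (((PolyBdd.eval p).add (.const 1)).add
      (((PolyBdd.const _).mul h1).add ((PolyBdd.const _).mul h1)))
  obtain ⟨q, hq⟩ := hbdd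
  have htree : ∀ x, TM.Tree (fun c v => v = 1 ∧ c.tapes M.out = Tape.mk₁ ((f x).map M.sym))
      (M.init x) 1 (p.eval x.length) := by
    intro x
    obtain ⟨ts, ⟨h1, h2⟩, h3⟩ := hf x
    -- The weights of the tree carry the information that the output is on the tape at the leaf.
    exact (hM.tree h1 h2 ⟨rfl, h3⟩).mono (hp x ts h1)
  have hsize : ∀ x : List Bool, ∀ k, ([] : List M.Γ).length +
      (Function.update (fun _ => []) M.inp (x.map M.sym) k : List M.Γ).length +
        2 * p.eval x.length + 1 ≤ x.length + 2 * p.eval x.length + 1 := by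
    intro x k
    by_cases h : k = M.inp
    · subst h; simp
    · simp [h]
  have hout : ∀ {x : List Bool} {c : M.Cfg} {l r : M.K → List M.Γ},
      c.tapes M.out = Tape.mk₁ ((f x).map M.sym) →
      (∀ k, c.tapes k = Tape.mk' (ListBlank.mk (l k)) (ListBlank.mk (r k))) →
      (r M.out).flatMap decode = f x := by
    intro x c l r h1 h2
    rw [h2] at h1
    have := congrArg Tape.right₀ h1
    rw [Tape.mk₁, Tape.mk₂, Tape.mk'_right₀, Tape.mk'_right₀] at this
    exact flatMap_decode this
  refine ⟨q, fun x => ⟨?_, fun m s hm hs hx => Runs.mono ?_ (hq x.length)⟩⟩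
  -- The length of the output is bounded by the tape length at the leaf, since each cell decodes to
  -- at most one bit.
  · obtain ⟨c, v, l, r, ⟨-, h1⟩, h2, h3⟩ := exists_leaf (l := fun _ => [])
      (r := Function.update (fun _ => []) M.inp (x.map M.sym)) (htree x) (init_tapes x)
      (N := x.length + 2 * p.eval x.length + 1) fun k => by have := hsize x k; omega
    have h4 := length_decode_le (r M.out)
    rw [hout h1 h2] at h4
    have h5 := h3 M.out
    have h6 := hq x.length
    nlinarith [Nat.zero_le (H.regs.length * (x.length + 2 * p.eval x.length + 1))]
  have hm' : ∀ y, Function.update m s [] (H.stack y) = [] := fun y => by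
    rw [Function.update_of_ne (fun h => hs ⟨y, h⟩), hm]
  have hst : H.st ≠ s := fun h => hs ⟨_, h⟩
  refine (runs_load hm hs hx).then_one (runs_sim (by
    rw [Function.update_of_ne hst]; exact hm _) ?_ (htree x) (init_tapes x) (hsize x))
  rintro c v l r ⟨rfl, hv⟩ htapes hN
  have hr := hout hv htapes
  have hcl := runs_clears (ss := H.regs.filter fun s => s ≠ H.rt M.out)
    (m := H.mem (Function.update m s []) [] l r)
    fun s' hs' => H.mem_apply_length hN (H.mem_regs.1 (List.mem_of_mem_filter hs'))
  have e : (fun s' => if s' ∈ H.regs.filter (fun s => s ≠ H.rt M.out) then [] else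
      H.mem (Function.update m s []) [] l r s') =
      Function.update (Function.update m s []) (H.rt M.out) ((r M.out).map H.cΓ) := by
    funext s'
    by_cases h0 : s' = H.rt M.out
    · subst h0; simp
    by_cases h : s' ∈ Set.range H.stack
    · rw [if_pos (by simpa [h0] using H.mem_regs.2 h), Function.update_of_ne h0]
      obtain ⟨y, rfl⟩ := h
      exact (hm' y).symm
    · rw [if_neg (fun h' => h (H.mem_regs.1 (List.mem_of_mem_filter h'))), mem_of_notMem h,
        Function.update_of_ne h0]
  rw [e] at hcl
  have hsl : H.lt M.out ≠ s := fun h => hs ⟨_, h⟩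
  have hsr : H.rt M.out ≠ s := fun h => hs ⟨_, h⟩
  have hlr := lt_ne_rt (H := H) M.out M.out
  have hl0 : m (H.lt M.out) = [] := hm _
  have hr0 : m (H.rt M.out) = [] := hm _
  have e3 : ((r M.out).map H.cΓ).reverse.flatMap (fun a => (decode (H.dΓ a)).map bit) =
      ((f x).map (bit : Bool → Sym B)).reverse := by
    rw [← List.map_reverse, List.flatMap_map, ← hr, ← List.map_reverse, List.reverse_flatMap,
      List.map_flatMap]
    congr 1
    funext a
    -- A symbol decodes to at most one bit, so reversing the tape reverses the decoded string.
    have : (decode a).reverse = decode a := by unfold decode; split_ifs <;> rfl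
    simp [this]
  have e4 : ∀ w : List (Sym B), w.flatMap (fun a => [a]) = w := by simp
  unfold finOut
  refine (hcl.then_one ((runs_pour hlr.symm _ _).then_one (runs_pour hsl _ _))).congr rfl ?_ ?_
  · funext s'
    simp only [Function.update_self, Function.update_apply, e3, e4, hlr, hsl, hsl.symm,
      hsr.symm, hl0, if_false, List.append_nil, List.reverse_reverse]
    split_ifs <;> simp_all
  · have h1 : (H.regs.filter fun s => s ≠ H.rt M.out).length ≤ H.regs.length :=
      List.length_filter_le _ _
    have h2 := hN M.out
    have h3 := length_decode_le (r M.out)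
    rw [hr] at h3
    have h4 := Nat.mul_le_mul_right (x.length + 2 * p.eval x.length + 1) h1
    simp only [Function.update_self, Function.update_apply, e3, hlr, hsl, hl0, if_false,
      List.append_nil, List.length_reverse, List.length_map]
    omega

end Host

/-! ### Signed binary digits -/

/-- The integer given by a list of signed binary digits, least significant digit first. -/
def value : List SignType → ℤ
  | [] => 0
  | d :: l => d + 2 * value l

/-- The last digit of a sum of three digits. -/
noncomputable def lowDigit (a b c : SignType) : SignType := SignType.sign (Int.tmod (a + b + c) 2)

/-- The carry of a sum of three digits. -/
noncomputable def carryDigit (a b c : SignType) : SignType := SignType.sign (Int.tdiv (a + b + c) 2)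

/-- The sum lies between -3 and 3, so quotient and remainder of truncated division by 2 are again
digits, and taking signs loses nothing. -/
theorem lowDigit_add_carryDigit (a b c : SignType) :
    (lowDigit a b c : ℤ) + 2 * carryDigit a b c = a + b + c := by
  cases a <;> cases b <;> cases c <;> rfl

/-- Addition of two numbers and a carry. -/
noncomputable def addDigits (c : SignType) : List SignType → List SignType → List SignType
  | [], [] => if c = 0 then [] else [c]
  | [], b :: l => lowDigit c 0 b :: addDigits (carryDigit c 0 b) [] l
  | a :: k, [] => lowDigit c a 0 :: addDigits (carryDigit c a 0) k []
  | a :: k, b :: l => lowDigit c a b :: addDigits (carryDigit c a b) k l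

theorem value_addDigits (c : SignType) (k l : List SignType) :
    value (addDigits c k l) = c + value k + value l := by
  induction k generalizing c l with
  | nil =>
    induction l generalizing c with
    | nil =>
      unfold addDigits
      split_ifs with h <;> simp [value, h]
    | cons b l ih =>
      have := lowDigit_add_carryDigit c 0 b
      simp only [addDigits, value, ih, SignType.coe_zero] at this ⊢
      linarith
  | cons a k ih =>
    cases l with
    | nil =>
      have := lowDigit_add_carryDigit c a 0
      simp only [addDigits, value, ih, SignType.coe_zero] at this ⊢
      linarith
    | cons b l =>
      have := lowDigit_add_carryDigit c a b
      simp only [addDigits, value, ih] at this ⊢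
      linarith

theorem length_addDigits (c : SignType) (k l : List SignType) :
    (addDigits c k l).length ≤ max k.length l.length + 1 := by
  induction k generalizing c l with
  | nil =>
    induction l generalizing c with
    | nil => unfold addDigits; split_ifs <;> simp
    | cons b l ih => have := ih (carryDigit c 0 b); simp [addDigits] at this ⊢; omega
  | cons a k ih =>
    cases l with
    | nil => have := ih (carryDigit c a 0) []; simp [addDigits] at this ⊢; omega
    | cons b l => have := ih (carryDigit c a b) l; simp [addDigits] at this ⊢; omega

/-- A bit as a digit. -/
def bitDigit (b : Bool) : SignType := if b then 1 else 0

theorem map_bit {B : Type} (l : List Bool) : l.map (bit : Bool → Sym B) = (l.map bitDigit).map dg := by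
  rw [List.map_map]; rfl

theorem addDigits_zero (l : List SignType) : addDigits 0 l [] = l := by
  induction l with
  | nil => simp [addDigits]
  | cons a l ih =>
    have h1 : lowDigit 0 a 0 = a := by cases a <;> rfl
    have h2 : carryDigit 0 a 0 = 0 := by cases a <;> rfl
    rw [addDigits, h1, h2, ih]

/-- Adding one to a canonical binary representation yields the canonical one, so an incremented
register holds exactly the string that `pair` expects. -/
theorem addDigits_bits (n : ℕ) :
    addDigits 1 (n.bits.map bitDigit) [] = (n + 1).bits.map bitDigit := by
  induction n using Nat.binaryRec' with
  | zero => simp [addDigits]; rfl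
  | bit b n h ih =>
    rw [Nat.bits_append_bit n b h, List.map_cons, addDigits]
    cases b with
    | false =>
      have h1 : Nat.bit false n + 1 = Nat.bit true n := by simp [Nat.bit_val]
      rw [h1, Nat.bits_append_bit n true (fun _ => rfl)]
      have h2 : carryDigit 1 (bitDigit false) 0 = 0 := by rfl
      rw [h2, addDigits_zero]
      rfl
    | true =>
      have h1 : Nat.bit true n + 1 = Nat.bit false (n + 1) := by simp [Nat.bit_val]; ring
      rw [h1, Nat.bits_append_bit (n + 1) false (by simp)]
      have h2 : carryDigit 1 (bitDigit true) 0 = 1 := by rfl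
      rw [h2, ih]
      rfl

theorem length_bits_le (n : ℕ) : n.bits.length ≤ n := by
  rw [Nat.size_eq_bits_len]
  exact Nat.size_le.2 Nat.lt_two_pow_self

/-! ### Registers, indices and loops -/

/-- The registers of the programs below. -/
inductive Reg
  | inp | base | arg | tmp | carry | count | idxI | idxJ | ctrI | ctrJ
  | acc | res | mult | out
  deriving DecidableEq

instance : Finite Reg :=
  Set.finite_univ_iff.1 <| Set.Finite.subset (Set.toFinite {.inp, .base, .arg, .tmp, .carry, .count,
    .idxI, .idxJ, .ctrI, .ctrJ, .acc, .res, .mult, .out}) fun r _ => by cases r <;> simp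

namespace Prog

variable {B Z : Type} [DecidableEq Z]

/-- Add the numbers on `s₁` and `s₂`, where `c` contains the carry; the digits of the sum are
pushed onto `t`. -/
noncomputable def addStacks {S : Type} (c s₁ s₂ t : S) : Prog (Sym B) S :=
  loop c fun x => case s₁
    (case s₂ (if dig x = 0 then skip else push t x) fun b =>
      push t (dg (lowDigit (dig x) 0 (dig b))) ;; push c (dg (carryDigit (dig x) 0 (dig b))))
    fun a => case s₂
      (push t (dg (lowDigit (dig x) (dig a) 0)) ;; push c (dg (carryDigit (dig x) (dig a) 0)))
      fun b => push t (dg (lowDigit (dig x) (dig a) (dig b))) ;;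
        push c (dg (carryDigit (dig x) (dig a) (dig b)))

theorem det_addStacks {S : Type} (c s₁ s₂ t : S) : (addStacks c s₁ s₂ t : Prog (Sym B) S).Det := by
  intro x
  refine ⟨⟨?_, fun b => ⟨det_push _ _, det_push _ _⟩⟩, fun a => ⟨⟨det_push _ _, det_push _ _⟩,
    fun b => ⟨det_push _ _, det_push _ _⟩⟩⟩
  split_ifs
  exacts [trivial, det_push _ _]

/-- The loop continues while a carry lies on `c`. The last iteration finds both summands exhausted,
writes a nonzero carry and supplies no new one. Low digits are pushed first, so the sum appears in
reverse. -/
theorem runs_addStacks {S : Type} [DecidableEq S] {c s₁ s₂ t : S} (h1 : c ≠ s₁) (h2 : c ≠ s₂)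
    (h3 : c ≠ t) (h4 : s₁ ≠ s₂) (h5 : s₁ ≠ t) (h6 : s₂ ≠ t) {m : S → List (Sym B)} {x : SignType}
    {k l : List SignType} (hc : m c = [dg x]) (hk : m s₁ = k.map dg) (hl : m s₂ = l.map dg) :
    Runs [addStacks c s₁ s₂ t] m 1 (Function.update (Function.update (Function.update
      (Function.update m c []) s₁ []) s₂ []) t ((addDigits x k l).reverse.map dg ++ m t))
      (k.length + l.length + 1) := by
  -- Either one or both summands become shorter in an iteration, hence the induction on a bound for
  -- the total length.
  suffices h : ∀ n, k.length + l.length ≤ n → Runs [addStacks c s₁ s₂ t] m 1 (Function.update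
      (Function.update (Function.update (Function.update m c []) s₁ []) s₂ []) t
      ((addDigits x k l).reverse.map dg ++ m t)) (n + 1) from h _ le_rfl
  intro n hn
  induction n generalizing m x k l with
  | zero =>
    obtain ⟨rfl, rfl⟩ : k = [] ∧ l = [] := by
      constructor <;> apply List.eq_nil_of_length_eq_zero <;> omega
    refine .loop_cons hc (.case_nil (by simpa [h1.symm] using hk)
      (.case_nil (by simpa [h2.symm] using hl) ?_))
    rw [List.map_nil] at hk hl
    by_cases hx : x = 0
    · rw [if_pos (by simpa using hx)]
      refine .skip (.loop_nil (by simp) ((Runs.nil _ _).congr rfl ?_ le_rfl))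
      funext r
      simp only [Function.update_apply, addDigits, hx]
      split_ifs <;> simp_all
    · rw [if_neg (by simpa using hx)]
      refine .push (.loop_nil (by simp [h3]) ((Runs.nil _ _).congr rfl ?_ le_rfl))
      funext r
      simp only [Function.update_apply, addDigits, hx]
      split_ifs <;> simp_all
  | succ n ih =>
    rcases k with _ | ⟨a, k⟩
    · rcases l with _ | ⟨b, l⟩
      · exact (ih hc hk hl (by simp)).mono (by omega)
      refine .loop_cons hc (.case_nil (by simpa [h1.symm] using hk)
        (.case_cons (a := dg b) (l := l.map dg) (by simpa [h2.symm] using hl) (.seq ?_)))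
      refine .push (.push ((ih (x := carryDigit x 0 b) (k := []) (l := l) ?_ ?_ ?_ ?_).congr rfl
        ?_ le_rfl))
      · simp [h2, h3]
      · simp [h1.symm, h4, h5, hk]
      · simp [h2.symm, h6]
      · simpa using hn
      · funext r
        simp only [Function.update_apply, addDigits]
        split_ifs <;> simp_all
    · rcases l with _ | ⟨b, l⟩
      · refine .loop_cons hc (.case_cons (a := dg a) (l := k.map dg)
          (by simpa [h1.symm] using hk) (.case_nil (by simp [h2.symm, h4.symm, hl]) (.seq ?_)))
        refine .push (.push ((ih (x := carryDigit x a 0) (k := k) (l := []) ?_ ?_ ?_ ?_).congr rfl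
          ?_ le_rfl))
        · simp [h1, h3]
        · simp [h1.symm, h5]
        · simp [h2.symm, h6, h4.symm, hl]
        · simpa using hn
        · funext r
          simp only [Function.update_apply, addDigits]
          split_ifs <;> simp_all
      · refine .loop_cons hc (.case_cons (a := dg a) (l := k.map dg)
          (by simpa [h1.symm] using hk) (.case_cons (a := dg b) (l := l.map dg)
          (by simp [h2.symm, h4.symm, hl]) (.seq ?_)))
        refine .push (.push (((ih (x := carryDigit x a b) (k := k) (l := l) ?_ ?_ ?_ ?_).mono
          (Nat.le_refl _)).congr rfl ?_ le_rfl))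
        · simp [h1, h2, h3]
        · simp [h1.symm, h4, h5]
        · simp [h2.symm, h6]
        · simp at hn; omega
        · funext r
          simp only [Function.update_apply, addDigits]
          split_ifs <;> simp_all

end Prog

/-! ### Programs with registers -/

namespace Prog

variable {B Z : Type} [DecidableEq Z]

/-- The scratch registers and the stacks for the simulation of machines are empty. -/
structure Idle (m : Reg ⊕ Z → List (Sym B)) : Prop where
  machine : ∀ z, m (.inr z) = []
  arg : m (.inl .arg) = []
  tmp : m (.inl .tmp) = []
  carry : m (.inl .carry) = []
  count : m (.inl .count) = []

omit [DecidableEq Z] in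
theorem map_pair (x : List Bool) (i : ℕ) : (pair x i).map (bit : Bool → Sym B) =
    ((x.map bit).flatMap fun a => [a, a]) ++ ([bit false, bit true] ++ i.bits.map bit) := by
  simp [pair, List.map_flatMap, List.flatMap_map]

/-- Replace the binary number in register `i` by its successor. -/
noncomputable def incr (i : Reg) : Prog (Sym B) (Reg ⊕ Z) :=
  push (.inl .carry) (dg 1) ;; addStacks (.inl .carry) (.inl i) (.inl .arg) (.inl .tmp) ;;
    pour (.inl .tmp) (.inl i) fun a => [a]

/-- Write the pair of the string in `base` and the number in register `i` to `arg`. -/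
def pairArg (i : Reg) : Prog (Sym B) (Reg ⊕ Z) :=
  dup (.inl i) (.inl .arg) (.inl .tmp) (fun a => [a]) ;;
    pushList (.inl .arg) [bit false, bit true] ;;
    dup (.inl .base) (.inl .arg) (.inl .tmp) fun a => [a, a]

/-- Multiply the length of register `ctr` by that of `base`. -/
def mulBase (ctr : Reg) : Prog (Sym B) (Reg ⊕ Z) :=
  loop (.inl ctr) (fun _ => dup (.inl .base) (.inl .count) (.inl .tmp) fun _ => [dg 0]) ;;
    pour (.inl .count) (.inl ctr) fun a => [a]

/-- Write `n ^ c` symbols to register `ctr`, where `n` is the length of `base`. -/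
def powBase (ctr : Reg) : ℕ → Prog (Sym B) (Reg ⊕ Z)
  | 0 => push (.inl ctr) (dg 0)
  | c + 1 => powBase ctr c ;; mulBase ctr

/-- Run `body` for the values from `1` to `n ^ c + c` of register `i`, where `n` is the length of
`base`. -/
noncomputable def forIdx (c : ℕ) (ctr i : Reg) (body : Prog (Sym B) (Reg ⊕ Z)) :
    Prog (Sym B) (Reg ⊕ Z) :=
  powBase ctr c ;; pushList (.inl ctr) (List.replicate c (dg 0)) ;;
    loop (.inl ctr) (fun _ => incr i ;; body) ;; clear (.inl i)

omit [DecidableEq Z] in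
theorem det_forIdx {c : ℕ} {ctr i : Reg} {body : Prog (Sym B) (Reg ⊕ Z)} (h : body.Det) :
    (forIdx c ctr i body).Det := by
  refine ⟨?_, det_pushList _ _, fun _ => ⟨⟨det_push _ _, det_addStacks _ _ _ _, det_pour _ _ _⟩, h⟩,
    det_clear _⟩
  induction c with
  | zero => exact det_push _ _
  | succ c ih => exact ⟨ih, fun _ => det_dup _ _ _ _, det_pour _ _ _⟩

omit [DecidableEq Z] in
theorem det_pairArg (i : Reg) : (pairArg i : Prog (Sym B) (Reg ⊕ Z)).Det :=
  ⟨det_dup _ _ _ _, det_pushList _ _, det_dup _ _ _ _⟩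

/-! ### Correctness and running time of the register programs -/

variable {m : Reg ⊕ Z → List (Sym B)}

theorem runs_incr {i : Reg} (hi : i ∉ [Reg.arg, .tmp, .carry, .count]) (hm : Idle m) {k : ℕ}
    (hk : m (.inl i) = k.bits.map bit) :
    Runs [incr i] m 1 (Function.update m (.inl i) ((k + 1).bits.map bit)) (2 * k + 2) := by
  simp only [List.mem_cons, List.not_mem_nil, or_false, not_or] at hi
  obtain ⟨h1, h2, h3, h4⟩ := hi
  refine (Runs.then_one (runs_push _ _ _) (Runs.then_one (runs_addStacks (x := 1)
    (k := k.bits.map bitDigit) (l := []) ?_ ?_ ?_ ?_ ?_ ?_ ?_ ?_ ?_)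
    (runs_pour ?_ _ _))).congr rfl ?_ ?_
  · simp [Ne.symm h3]
  · simp
  · simp
  · simp [h1]
  · simp [h2]
  · simp
  · simp [hm.carry]
  · simp [h3, hk, map_bit]
  · simp [hm.arg]
  · simp [Ne.symm h2]
  · rw [addDigits_bits, map_bit]
    funext r
    simp only [Function.update_apply, ← List.map_eq_flatMap]
    have := hm.carry
    have := hm.arg
    have := hm.tmp
    split_ifs <;> simp_all
  · have e1 := length_bits_le k
    have e2 := length_bits_le (k + 1)
    rw [addDigits_bits]
    simp [hm.tmp]
    omega

/-- The string is built from its end: the number, then the separator, then the doubled bits of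
`base`. -/
theorem runs_pairArg {i : Reg} (hi : i ∉ [Reg.arg, .tmp, .base]) (hm : Idle m) {ys : List Bool}
    (hy : m (.inl .base) = ys.map bit) {k : ℕ} (hk : m (.inl i) = k.bits.map bit) :
    Runs [pairArg i] m 1 (Function.update m (.inl .arg) ((pair ys k).map bit))
      (2 * k + 2 * ys.length) := by
  simp only [List.mem_cons, List.not_mem_nil, or_false, not_or] at hi
  obtain ⟨h1, h2, h3⟩ := hi
  refine (Runs.then_one (runs_dup (by simpa using h1) (by simpa using h2) (by simp) _ hm.tmp)
    (Runs.then_one (Runs.pushList (.nil _ 0)) (runs_dup (by simp) (by simp) (by simp) _ ?_))).congr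
    rfl ?_ ?_
  · simp [hm.tmp]
  · rw [map_pair]
    simp [hm.arg, hk, hy]
  · have := length_bits_le k
    simp [hk, hy]
    omega

theorem runs_mulBase {ctr : Reg} (hc : ctr ∉ [Reg.tmp, .count, .base])
    (htmp : m (.inl .tmp) = []) (hcount : m (.inl .count) = []) {a : ℕ}
    (ha : m (.inl ctr) = List.replicate a (dg 0)) {n : ℕ} (hn : (m (.inl .base)).length = n) :
    Runs [mulBase ctr] m 1 (Function.update m (.inl ctr) (List.replicate (a * n) (dg 0)))
      (a * (3 * n + 1)) := by
  simp only [List.mem_cons, List.not_mem_nil, or_false, not_or] at hc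
  obtain ⟨h1, h2, h3⟩ := hc
  have hflat : ∀ l : List (Sym B),
      (l.flatMap fun _ => [(dg 0 : Sym B)]) = List.replicate l.length (dg 0) := by
    intro l
    rw [← List.map_eq_flatMap, List.map_const']
  have key : ∀ (a : ℕ) (m : Reg ⊕ Z → List (Sym B)), m (.inl .tmp) = [] →
      m (.inl ctr) = List.replicate a (dg 0) → (m (.inl .base)).length = n →
      Runs [loop (.inl ctr) fun _ => dup (.inl .base) (.inl .count) (.inl .tmp) fun _ => [dg 0]] m 1
        (Function.update (Function.update m (.inl .count)
          (List.replicate (a * n) (dg 0) ++ m (.inl .count))) (.inl ctr) []) (a * (2 * n + 1)) := by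
    intro a
    induction a with
    | zero =>
      intro m _ hc _
      refine .loop_nil (by simpa using hc) ((Runs.nil _ _).congr rfl ?_ le_rfl)
      funext r
      simp only [Function.update_apply]
      split_ifs <;> simp_all
    | succ a ih =>
      intro m ht hc hn
      have hd := runs_dup (s := (.inl .base : Reg ⊕ Z)) (t := .inl .count) (u := .inl .tmp)
        (by simp) (by simp) (by simp) (fun _ => [dg 0])
        (m := Function.update m (.inl ctr) (List.replicate a (dg 0))) (by simp [Ne.symm h1, ht])
      refine ((Runs.loop_cons (t := 2 * n + a * (2 * n + 1)) (by
        rw [hc, List.replicate_succ]) ((hd.cons_one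
        (ih _ ?_ ?_ ?_)).mono ?_)).congr rfl ?_ ?_)
      · simp [Ne.symm h1, ht]
      · simp [h2]
      · simp [Ne.symm h3, hn]
      · simp [Ne.symm h3, hn]
      · have e : List.replicate ((a + 1) * n) (dg 0 : Sym B) =
            List.replicate (a * n) (dg 0) ++ List.replicate n (dg 0) := by
          rw [List.replicate_append_replicate]; congr 1; ring
        rw [e]
        have hbc : (Sum.inl Reg.base : Reg ⊕ Z) ≠ .inl ctr := by simpa using Ne.symm h3
        simp only [hflat, Function.update_of_ne hbc, hn]
        funext r
        simp only [Function.update_apply]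
        split_ifs <;> simp_all [-List.replicate_append_replicate]
      · apply le_of_eq; ring
  refine ((key a m htmp ha hn).then_one (runs_pour ?_ _ _)).congr rfl ?_ ?_
  · simp [Ne.symm h2]
  · funext r
    simp only [← List.map_eq_flatMap, Function.update_apply]
    split_ifs <;> simp_all
  · simp [Ne.symm h2, hcount]
    apply le_of_eq; ring

/-- The running time of `powBase`. -/
def powTime : ℕ → ℕ → ℕ
  | 0, _ => 0
  | c + 1, n => powTime c n + n ^ c * (3 * n + 1)

omit [DecidableEq Z] in
theorem polyBdd_powTime (c : ℕ) : PolyBdd (powTime c) := by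
  induction c with
  | zero => exact .const 0
  | succ c ih =>
    exact ih.add ((PolyBdd.id.pow c).mul (((PolyBdd.const 3).mul .id).add (.const 1)))

theorem runs_powBase {ctr : Reg} (hc : ctr ∉ [Reg.tmp, .count, .base])
    (htmp : m (.inl .tmp) = []) (hcount : m (.inl .count) = []) (ha : m (.inl ctr) = []) {n : ℕ}
    (hn : (m (.inl .base)).length = n) (c : ℕ) :
    Runs [powBase ctr c] m 1 (Function.update m (.inl ctr) (List.replicate (n ^ c) (dg 0)))
      (powTime c n) := by
  have hc' := hc
  simp only [List.mem_cons, List.not_mem_nil, or_false, not_or] at hc'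
  obtain ⟨h1, h2, h3⟩ := hc'
  induction c with
  | zero =>
    refine (runs_push _ _ _).congr rfl ?_ le_rfl
    simp [ha]
  | succ c ih =>
    refine (ih.then_one (runs_mulBase hc ?_ ?_ (a := n ^ c) ?_ (n := n) ?_)).congr rfl ?_ le_rfl
    · simp [Ne.symm h1, htmp]
    · simp [Ne.symm h2, hcount]
    · simp
    · simp [Ne.symm h3, hn]
    · simp [pow_succ]

theorem Idle.update {m : Reg ⊕ Z → List (Sym B)} (hm : Idle m) {i : Reg}
    (hi : i ∉ [Reg.arg, .tmp, .carry, .count]) (l : List (Sym B)) :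
    Idle (Function.update m (.inl i) l) := by
  simp only [List.mem_cons, List.not_mem_nil, or_false, not_or] at hi
  obtain ⟨h1, h2, h3, h4⟩ := hi
  obtain ⟨e1, e2, e3, e4, e5⟩ := hm
  constructor <;> simp [*, Ne.symm h1, Ne.symm h2, Ne.symm h3, Ne.symm h4]

/-- The memory after `k` iterations is `μ k`, apart from the two loop registers: `i` holds the index
in binary and `ctr` the remaining iterations in unary. The body has to work for every content `w` of
`ctr`. Iterations are composed sequentially, so their sums of signs multiply. -/
theorem runs_forIdx {c : ℕ} {ctr i : Reg} (hctr : ctr ∉ [Reg.arg, .tmp, .carry, .count, .base])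
    (hi : i ∉ [Reg.arg, .tmp, .carry, .count, .base]) (hne : ctr ≠ i)
    {body : Prog (Sym B) (Reg ⊕ Z)} {μ : ℕ → Reg ⊕ Z → List (Sym B)} {v : ℕ → ℤ} {τ n r : ℕ}
    (hr : n ^ c + c = r) (hμ : ∀ k, Idle (μ k)) (hbase : (μ 0 (.inl .base)).length = n)
    (hc0 : ∀ k, μ k (.inl ctr) = []) (hi0 : ∀ k, μ k (.inl i) = [])
    (hbody : ∀ k w, k < r → Runs [body]
      (Function.update (Function.update (μ k) (.inl i) ((k + 1).bits.map bit)) (.inl ctr) w)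
      (v (k + 1))
      (Function.update (Function.update (μ (k + 1)) (.inl i) ((k + 1).bits.map bit)) (.inl ctr) w)
      τ) :
    Runs [forIdx c ctr i body] (μ 0) (∏ k ∈ Finset.range r, v (k + 1)) (μ r)
      (powTime c n + r * (2 * r + 2 + τ) + 2 * r) := by
  have hctr' := hctr
  have hi' := hi
  simp only [List.mem_cons, List.not_mem_nil, or_false, not_or] at hctr' hi'
  obtain ⟨h1, h2, h3, h4, h5⟩ := hctr'
  obtain ⟨g1, g2, g3, g4, g5⟩ := hi'
  have hctr4 : ctr ∉ [Reg.arg, .tmp, .carry, .count] := by simp [h1, h2, h3, h4]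
  have hi4 : i ∉ [Reg.arg, .tmp, .carry, .count] := by simp [g1, g2, g3, g4]
  -- Here `k` iterations are done and `a` remain.
  have key : ∀ a k, k + a = r →
      Runs [loop (.inl ctr) fun _ => incr i ;; body]
        (Function.update (Function.update (μ k) (.inl i) (k.bits.map bit)) (.inl ctr)
          (List.replicate a (dg 0)))
        (∏ j ∈ Finset.range a, v (k + j + 1))
        (Function.update (μ r) (.inl i) (r.bits.map bit)) (a * (2 * r + 3 + τ)) := by
    intro a
    induction a with
    | zero =>
      rintro k rfl
      refine .loop_nil (by simp) ?_
      simp only [Finset.range_zero, Finset.prod_empty]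
      refine (Runs.nil _ _).congr rfl ?_ le_rfl
      rw [Nat.add_zero, List.replicate_zero, Function.update_eq_self_iff, Function.update_of_ne (by simpa using hne)]
      exact (hc0 _).symm
    | succ a ih =>
      intro k hk
      have hinc := runs_incr (m := Function.update (Function.update (μ k) (.inl i)
        (k.bits.map bit)) (.inl ctr) (List.replicate a (dg 0))) hi4
        (((hμ k).update hi4 _).update hctr4 _) (k := k) (by simp [Ne.symm hne])
      have e : Function.update (Function.update (Function.update (μ k) (.inl i)
          (k.bits.map bit)) (.inl ctr) (List.replicate a (dg 0))) (.inl i)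
            ((k + 1).bits.map bit) = Function.update (Function.update (μ k) (.inl i)
          ((k + 1).bits.map bit)) (.inl ctr) (List.replicate a (dg 0)) := by
        rw [Function.update_comm (by simpa using hne), Function.update_idem]
      rw [e] at hinc
      have hb := hbody k (List.replicate a (dg 0)) (by omega)
      have hrest := ((hinc.then_one hb).cons (ih (k + 1) (by omega))).mono
        (t' := (a + 1) * (2 * r + 3 + τ) - 1) ?_
      · have := Runs.loop_cons (m := Function.update (Function.update (μ k) (.inl i)
          (k.bits.map bit)) (.inl ctr) (List.replicate (a + 1) (dg 0))) (s := .inl ctr)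
          (B := fun _ => incr i ;; body) (C := [])
          (by rw [Function.update_self, List.replicate_succ])
          (by rw [Function.update_idem]; exact hrest)
        refine this.congr ?_ rfl ?_
        · rw [Finset.prod_range_succ', mul_comm]
          simp only [add_zero]
          congr 1
          refine Finset.prod_congr rfl fun j _ => ?_
          congr 1
          ring
        · have : 1 ≤ (a + 1) * (2 * r + 3 + τ) := Nat.mul_pos (by omega) (by omega)
          omega
      · have : (a + 1) * (2 * r + 3 + τ) = a * (2 * r + 3 + τ) + (2 * r + 3 + τ) := by ring
        omega
  have hpow := runs_powBase (m := μ 0) (ctr := ctr) (by simp [h2, h4, h5]) (hμ 0).tmp (hμ 0).count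
    (hc0 0) hbase c
  have hk := key r 0 (by omega)
  have hfin := runs_clear (.inl i) (Function.update (μ r) (.inl i) (r.bits.map bit))
  rw [Function.update_idem, Function.update_self,
    (Function.update_eq_self_iff (f := μ r) (a := .inl i) (b := [])).2 (hi0 r).symm] at hfin
  have h0 : Function.update (Function.update (μ 0) (.inl ctr) (List.replicate (n ^ c) (dg 0)))
      (.inl ctr) (List.replicate c (dg 0) ++ Function.update (μ 0) (.inl ctr)
        (List.replicate (n ^ c) (dg 0)) (.inl ctr)) =
      Function.update (Function.update (μ 0) (.inl i) ((0 : ℕ).bits.map bit)) (.inl ctr)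
        (List.replicate r (dg 0)) := by
    -- The binary representation of 0 is empty, so the empty index register already holds 0.
    have : Function.update (μ 0) (.inl i) ((0 : ℕ).bits.map bit) = μ 0 := by
      rw [Function.update_eq_self_iff]; simp [hi0]
    rw [this, Function.update_idem, Function.update_self, List.replicate_append_replicate, ← hr,
      add_comm]
  refine (hpow.then_one (Runs.then_one (Runs.pushList (.nil _ 0)) (Runs.then
    (by rw [h0]; exact hk) hfin))).congr ?_ rfl ?_
  · simp
  · have := length_bits_le r
    have e : r * (2 * r + 3 + τ) = r * (2 * r + 2 + τ) + r := by ring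
    simp only [List.length_map]
    omega

end Prog

/-! ### Producing given gaps -/

theorem value_bits (n : ℕ) : value (n.bits.map bitDigit) = n := by
  induction n using Nat.binaryRec' with
  | zero => simp [value]
  | bit b n h ih =>
    rw [Nat.bits_append_bit n b h, List.map_cons, value, ih, Nat.bit_val]
    cases b <;> simp [bitDigit]; ring

namespace Prog

variable {B Z : Type} [DecidableEq Z]

/-- Digits as symbols, as an embedding. -/
def dgEmb : SignType ↪ Sym B := ⟨dg, Sum.inl_injective⟩

@[simp]
theorem dig_dgEmb (d : SignType) : dig (dgEmb d : Sym B) = d := rfl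

/-- Choose nondeterministically between `P` and `Q`. -/
def choice (P Q : Prog (Sym B) (Reg ⊕ Z)) : Prog (Sym B) (Reg ⊕ Z) :=
  guess (.inl .tmp) (Finset.map dgEmb {0, 1}) ;;
    case (.inl .tmp) skip fun a => if dig a = 0 then P else Q

variable {m : Reg ⊕ Z → List (Sym B)}

theorem runs_choice {P Q : Prog (Sym B) (Reg ⊕ Z)} {m' : Reg ⊕ Z → List (Sym B)} {v w : ℤ} {t : ℕ}
    (ht : m (.inl .tmp) = []) (hP : Runs [P] m v m' t) (hQ : Runs [Q] m w m' t) :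
    Runs [choice P Q] m (v + w) m' t := by
  refine .seq (.seq ((Runs.guess (fun a => if dig a = 0 then v else w) (by simp) ?_).congr ?_ rfl
    le_rfl))
  · intro a ha
    refine .case_cons (Function.update_self _ _ _) ?_
    rw [Function.update_idem, ht, (Function.update_eq_self_iff).2 ht.symm]
    split_ifs
    exacts [hP, hQ]
  · simp

/-- Produce the gap given by the binary number in `arg`. -/
def weighNat : Prog (Sym B) (Reg ⊕ Z) :=
  loop (.inl .arg) (fun b =>
    guess (.inl .tmp) (Finset.map dgEmb (if unbit b then Finset.univ else {0, 1})) ;;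
      case (.inl .tmp) skip fun a =>
        if dig a = -1 then push (.inl .count) (dg 0) ;; clear (.inl .arg) else skip) ;;
    case (.inl .count) (choice skip neg) fun _ => skip

/-- Produce the gap given by the integer in `arg`. -/
def weigh : Prog (Sym B) (Reg ⊕ Z) :=
  case (.inl .arg) skip fun s => (if unbit s then neg else skip) ;; weighNat

/-- Horner's rule for gaps: a bit `b` contributes `b + 2 * value l`. The choices 0 and 1 both
continue with the remaining bits; the choice -1, offered only for a set bit, stops as one positive
path and marks this on `count`. An unmarked path at the end splits into a positive and a negative
one, which cancel. -/
theorem runs_weighNat (l : List Bool) (ht : m (.inl .tmp) = []) (hc : m (.inl .count) = [])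
    (ha : m (.inl .arg) = l.map bit) :
    Runs [weighNat] m (value (l.map bitDigit)) (Function.update m (.inl .arg) [])
      (2 * l.length) := by
  refine .seq ?_
  induction l generalizing m with
  | nil =>
    refine .loop_nil (by simpa using ha) (.case_nil hc ?_)
    rw [(Function.update_eq_self_iff).2 (by simpa using ha.symm)]
    exact (runs_choice ht (.skip (.nil _ _)) (.neg (.nil _ _))).congr (by simp [value]) rfl le_rfl
  | cons b l ih =>
    refine Runs.mono (t := 2 * l.length + 1 + 1) (.loop_cons (by rw [ha, List.map_cons]) (.seq (.seq
      ((Runs.guess (fun a => if dig a = -1 then 1 else value (l.map bitDigit))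
        (by split_ifs <;> simp) ?_).congr ?_ rfl le_rfl)))) (by simp; omega)
    · intro a _
      refine .case_cons (Function.update_self _ _ _) ?_
      rw [Function.update_idem]
      have e : Function.update (Function.update m (.inl .arg) (l.map bit)) (.inl .tmp)
          (Function.update m (.inl .arg) (l.map bit) (.inl .tmp)) =
          Function.update m (.inl .arg) (l.map bit) := by simp
      rw [e]
      by_cases hd : dig a = -1
      · rw [if_pos hd, if_pos hd]
        refine .seq (.push ((((runs_clear _ _).cons_one (.loop_nil (by simp) (.case_cons (a := dg 0)
          (l := []) ?_ (.skip (.nil _ 0)))))).congr rfl ?_ ?_))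
        · simp [hc]
        · funext r
          simp only [Function.update_apply]
          split_ifs <;> simp_all
        · simp; omega
      · rw [if_neg hd, if_neg hd]
        refine .skip ((ih ?_ ?_ ?_).congr rfl ?_ (by omega))
        · simp [ht]
        · simp [hc]
        · simp
        · simp
    · rw [Finset.sum_map]
      simp only [dig_dgEmb, unbit_bit, List.map_cons, value]
      cases b
      · simp [bitDigit]; ring
      · have : (Finset.univ : Finset SignType) = {0, -1, 1} := rfl
        rw [if_pos rfl, this]
        simp [bitDigit]; ring

theorem runs_weigh (v : ℤ) (ht : m (.inl .tmp) = []) (hc : m (.inl .count) = [])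
    (ha : m (.inl .arg) = (encodeInt v).map bit) :
    Runs [weigh] m v (Function.update m (.inl .arg) []) (2 * (encodeInt v).length) := by
  have h := runs_weighNat (m := Function.update m (.inl .arg) (v.natAbs.bits.map bit))
    v.natAbs.bits (by simp [ht]) (by simp [hc]) (by simp)
  rw [Function.update_idem, value_bits] at h
  refine .case_cons (by rw [ha, encodeInt, List.map_cons]) (.seq ?_)
  by_cases hv : v < 0
  · simp only [hv, decide_true, unbit_bit, if_true]
    exact (Runs.neg h).congr (by omega) rfl (by simp [encodeInt])
  · simp only [hv, decide_false, unbit_bit]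
    exact (Runs.skip h).congr (by omega) rfl (by simp [encodeInt])

/-- `E` replaces the argument `x` of `f` in `arg` by `f x`, in time at most `q |x|`. -/
def Evaluates (E : Prog (Sym B) (Reg ⊕ Z)) (f : List Bool → ℤ) (q : Polynomial ℕ) : Prop :=
  ∀ x, (encodeInt (f x)).length ≤ q.eval x.length ∧ ∀ m, Idle m →
    Runs [E] (Function.update m (.inl .arg) (x.map bit)) 1
      (Function.update m (.inl .arg) ((encodeInt (f x)).map bit)) (q.eval x.length)

/-- `E` removes `x` from `arg` and produces the gap `g x`, in time at most `q |x|`. -/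
def Weighs (E : Prog (Sym B) (Reg ⊕ Z)) (g : List Bool → ℤ) (q : Polynomial ℕ) : Prop :=
  ∀ x m, Idle m →
    Runs [E] (Function.update m (.inl .arg) (x.map bit)) (g x) m (q.eval x.length)

/-- The contents of the registers during the computation for the input `x` with base `y`. -/
structure Ready (x y : List Bool) (m : Reg ⊕ Z → List (Sym B)) : Prop where
  idle : Idle m
  inp : m (.inl .inp) = x.map bit
  base : m (.inl .base) = y.map bit

theorem Ready.update {x y : List Bool} (hm : Ready x y m) {i : Reg}
    (hi : i ∉ [Reg.arg, .tmp, .carry, .count, .inp, .base]) (l : List (Sym B)) :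
    Ready x y (Function.update m (.inl i) l) := by
  simp only [List.mem_cons, List.not_mem_nil, or_false, not_or] at hi
  obtain ⟨h1, h2, h3, h4, h5, h6⟩ := hi
  exact ⟨hm.idle.update (by simp [*]) l, by simp [Ne.symm h5, hm.inp], by simp [Ne.symm h6, hm.base]⟩

theorem length_pair (y : List Bool) (k : ℕ) : (pair y k).length ≤ 2 * y.length + 2 + k := by
  have := length_bits_le k
  simp [pair, List.length_flatMap]
  omega

/-- A bound for the time to evaluate a function at pairs. -/
def evalTime (q : Polynomial ℕ) (n r : ℕ) : ℕ := 2 * r + 2 * n + q.eval (2 * n + 2 + r)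

theorem runs_eval {E : Prog (Sym B) (Reg ⊕ Z)} {f : List Bool → ℤ} {q : Polynomial ℕ}
    (hE : Evaluates E f q) {x y : List Bool} (hm : Ready x y m) {i : Reg}
    (hi : i ∉ [Reg.arg, .tmp, .base]) {k r : ℕ} (hk : m (.inl i) = k.bits.map bit) (hkr : k ≤ r) :
    (encodeInt (f (pair y k))).length ≤ q.eval (2 * y.length + 2 + r) ∧
    Runs [pairArg i ;; E] m 1
      (Function.update m (.inl .arg) ((encodeInt (f (pair y k))).map bit))
      (evalTime q y.length r) := by
  have hq := Polynomial.eval_monotone_nat q (a := (pair y k).length) (b := 2 * y.length + 2 + r)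
    ((length_pair y k).trans (by omega))
  refine ⟨(hE (pair y k)).1.trans hq, ((runs_pairArg hi hm.idle hm.base hk).then_one
    ((hE (pair y k)).2 m hm.idle)).mono ?_⟩
  simp only [evalTime] at hq ⊢
  omega

/-- This is FP ⊆ GapP in program form. The memory is restored, so it can be used inside loops. -/
theorem runs_eval_weigh {E : Prog (Sym B) (Reg ⊕ Z)} {f : List Bool → ℤ} {q : Polynomial ℕ}
    (hE : Evaluates E f q) {x y : List Bool} (hm : Ready x y m) {i : Reg}
    (hi : i ∉ [Reg.arg, .tmp, .base]) {k r : ℕ} (hk : m (.inl i) = k.bits.map bit) (hkr : k ≤ r) :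
    Runs [(pairArg i ;; E) ;; weigh] m (f (pair y k)) m (3 * evalTime q y.length r) := by
  obtain ⟨h1, h2⟩ := runs_eval hE hm hi hk hkr
  refine (h2.then_one (runs_weigh _ ?_ ?_ (Function.update_self _ _ _))).congr rfl ?_ ?_
  · simp [hm.idle.tmp]
  · simp [hm.idle.count]
  · simp [hm.idle.arg]
  · simp only [evalTime] at h1 ⊢
    omega

/-- Produce the gap `∏ i, (fA ⟨y, j⟩ - fR ⟨y, i⟩)`. -/
noncomputable def gapProd (c : ℕ) (EA ER : Prog (Sym B) (Reg ⊕ Z)) : Prog (Sym B) (Reg ⊕ Z) :=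
  forIdx c .ctrI .idxI <| choice ((pairArg .idxJ ;; EA) ;; weigh)
    (neg ;; (pairArg .idxI ;; ER) ;; weigh)

/-- Produce the gap `∏ i, (g x - fR ⟨y, i⟩)`. -/
noncomputable def gapProdInp (c : ℕ) (Eg ER : Prog (Sym B) (Reg ⊕ Z)) : Prog (Sym B) (Reg ⊕ Z) :=
  forIdx c .ctrI .idxI <| choice (dup (.inl .inp) (.inl .arg) (.inl .tmp) (fun a => [a]) ;; Eg)
    (neg ;; (pairArg .idxI ;; ER) ;; weigh)

/-- The product of the differences between `a` and the values `f ⟨y, i⟩`. -/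
def diffProd (f : List Bool → ℤ) (y : List Bool) (r : ℕ) (a : ℤ) : ℤ :=
  ∏ i ∈ Finset.range r, (a - f (pair y (i + 1)))

/-- A bound for the time of a loop over indices. -/
def loopTime (c n τ : ℕ) : ℕ :=
  powTime c n + (n ^ c + c) * (2 * (n ^ c + c) + 2 + τ) + 2 * (n ^ c + c)

/-- A difference is a choice between two branches, the second with changed sign; the product over
the index comes from the loop. As the body restores the memory, `μ` is constant. -/
theorem runs_gapProd {c : ℕ} {EA ER : Prog (Sym B) (Reg ⊕ Z)} {fA fR : List Bool → ℤ}
    {qA qR : Polynomial ℕ} (hA : Evaluates EA fA qA) (hR : Evaluates ER fR qR) {x y : List Bool}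
    (hm : Ready x y m) (hc : m (.inl .ctrI) = []) (hi : m (.inl .idxI) = []) {j r : ℕ}
    (hr : y.length ^ c + c = r) (hj : m (.inl .idxJ) = j.bits.map bit) (hjr : j ≤ r) :
    Runs [gapProd c EA ER] m (diffProd fR y r (fA (pair y j))) m (loopTime c y.length
      (3 * evalTime qA y.length r + 3 * evalTime qR y.length r)) := by
  have := runs_forIdx (c := c) (ctr := .ctrI) (i := .idxI) (by simp) (by simp) (by simp)
    (body := choice ((pairArg .idxJ ;; EA) ;; weigh) (neg ;; (pairArg .idxI ;; ER) ;; weigh))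
    (μ := fun _ => m) (v := fun i => fA (pair y j) - fR (pair y i))
    (τ := 3 * evalTime qA y.length r + 3 * evalTime qR y.length r) hr (fun _ => hm.idle)
    (by simp [hm.base]) (fun _ => hc) (fun _ => hi) ?_
  · refine this.congr rfl rfl ?_
    simp [loopTime, hr]
  · intro k w hk
    have hm' := (hm.update (i := .idxI) (by simp) ((k + 1).bits.map bit)).update
      (i := .ctrI) (by simp) w
    rw [sub_eq_add_neg]
    refine runs_choice hm'.idle.tmp
      ((runs_eval_weigh hA hm' (by simp) (by simp [hj]) hjr).mono (by omega)) (.seq (.neg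
      ((runs_eval_weigh hR hm' (by simp) (by simp) hk).mono (by omega))))

theorem runs_gapProdInp {c : ℕ} {Eg ER : Prog (Sym B) (Reg ⊕ Z)} {g fR : List Bool → ℤ}
    {qg qR : Polynomial ℕ} (hg : Weighs Eg g qg) (hR : Evaluates ER fR qR) {x y : List Bool}
    (hm : Ready x y m) (hc : m (.inl .ctrI) = []) (hi : m (.inl .idxI) = []) {r : ℕ}
    (hr : y.length ^ c + c = r) :
    Runs [gapProdInp c Eg ER] m (diffProd fR y r (g x)) m (loopTime c y.length
      (2 * x.length + qg.eval x.length + 3 * evalTime qR y.length r)) := by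
  have := runs_forIdx (c := c) (ctr := .ctrI) (i := .idxI) (by simp) (by simp) (by simp)
    (body := choice (dup (.inl .inp) (.inl .arg) (.inl .tmp) (fun a => [a]) ;; Eg)
      (neg ;; (pairArg .idxI ;; ER) ;; weigh))
    (μ := fun _ => m) (v := fun i => g x - fR (pair y i))
    (τ := 2 * x.length + qg.eval x.length + 3 * evalTime qR y.length r) hr (fun _ => hm.idle)
    (by simp [hm.base]) (fun _ => hc) (fun _ => hi) ?_
  · refine this.congr rfl rfl ?_
    simp [loopTime, hr]
  · intro k w hk
    have hm' := (hm.update (i := .idxI) (by simp) ((k + 1).bits.map bit)).update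
      (i := .ctrI) (by simp) w
    rw [sub_eq_add_neg]
    refine runs_choice hm'.idle.tmp ?_ (.seq (.neg
      ((runs_eval_weigh hR hm' (by simp) (by simp) hk).mono (by omega))))
    have hd := runs_dup (A := Sym B) (S := Reg ⊕ Z) (s := .inl .inp) (t := .inl .arg) (u := .inl .tmp) (by simp) (by simp)
      (by simp) (fun a => [a]) hm'.idle.tmp
    simp only [hm'.inp, hm'.idle.arg, List.flatMap_singleton', List.append_nil, List.length_map]
      at hd
    exact (hd.then_one (hg x _ hm'.idle)).mono (by omega)

/-- Produce the gap `∏ j, c j - ∏ j, (c j - G)`, where `c j = ∏ i, (fA ⟨y, j⟩ - fR ⟨y, i⟩)` and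
`G = ∏ i, (g x - fR ⟨y, i⟩)`. -/
noncomputable def gapDiff (c : ℕ) (Eg EA ER : Prog (Sym B) (Reg ⊕ Z)) : Prog (Sym B) (Reg ⊕ Z) :=
  choice (forIdx c .ctrJ .idxJ (gapProd c EA ER))
    (neg ;; forIdx c .ctrJ .idxJ (choice (gapProd c EA ER) (neg ;; gapProdInp c Eg ER)))

/-- The same two constructions once more, with the products over `i` as summands and the loop over
`j` outside. -/
theorem runs_gapDiff {c : ℕ} {Eg EA ER : Prog (Sym B) (Reg ⊕ Z)} {g fA fR : List Bool → ℤ}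
    {qg qA qR : Polynomial ℕ} (hg : Weighs Eg g qg) (hA : Evaluates EA fA qA)
    (hR : Evaluates ER fR qR) {x y : List Bool}
    (hm : Ready x y m) (hcI : m (.inl .ctrI) = []) (hiI : m (.inl .idxI) = [])
    (hcJ : m (.inl .ctrJ) = []) (hiJ : m (.inl .idxJ) = []) {r : ℕ}
    (hr : y.length ^ c + c = r) :
    Runs [gapDiff c Eg EA ER] m
      (∏ j ∈ Finset.range r, diffProd fR y r (fA (pair y (j + 1))) -
        ∏ j ∈ Finset.range r, (diffProd fR y r (fA (pair y (j + 1))) - diffProd fR y r (g x))) m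
      (loopTime c y.length
        (loopTime c y.length (3 * evalTime qA y.length r + 3 * evalTime qR y.length r) +
        loopTime c y.length
          (2 * x.length + qg.eval x.length + 3 * evalTime qR y.length r))) := by
  set τ₁ := loopTime c y.length (3 * evalTime qA y.length r + 3 * evalTime qR y.length r)
  set τ₂ := loopTime c y.length (2 * x.length + qg.eval x.length + 3 * evalTime qR y.length r)
  have h1 : ∀ k w, k < r → Runs [gapProd c EA ER]
      (Function.update (Function.update m (.inl .idxJ) ((k + 1).bits.map bit)) (.inl .ctrJ) w)
      (diffProd fR y r (fA (pair y (k + 1))))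
      (Function.update (Function.update m (.inl .idxJ) ((k + 1).bits.map bit)) (.inl .ctrJ) w)
      (τ₁ + τ₂) := by
    intro k w hk
    exact (runs_gapProd hA hR ((hm.update (by simp) _).update (by simp) _) (by simpa) (by simpa) hr
      (by simp) hk).mono (by omega)
  have h2 : ∀ k w, k < r → Runs [gapProdInp c Eg ER]
      (Function.update (Function.update m (.inl .idxJ) ((k + 1).bits.map bit)) (.inl .ctrJ) w)
      (diffProd fR y r (g x))
      (Function.update (Function.update m (.inl .idxJ) ((k + 1).bits.map bit)) (.inl .ctrJ) w)
      (τ₁ + τ₂) := by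
    intro k w hk
    exact (runs_gapProdInp hg hR ((hm.update (by simp) _).update (by simp) _) (by simpa)
      (by simpa) hr).mono (by omega)
  have hT : loopTime c y.length (τ₁ + τ₂) =
    powTime c y.length + r * (2 * r + 2 + (τ₁ + τ₂)) + 2 * r := by simp [loopTime, hr]
  rw [hT, sub_eq_add_neg]
  refine runs_choice hm.idle.tmp (runs_forIdx (μ := fun _ => m)
    (v := fun j => diffProd fR y r (fA (pair y j))) (by simp) (by simp) (by simp)
    hr (fun _ => hm.idle) (by simp [hm.base]) (fun _ => hcJ) (fun _ => hiJ) h1)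
    (.seq (.neg (runs_forIdx (μ := fun _ => m)
    (v := fun j => diffProd fR y r (fA (pair y j)) - diffProd fR y r (g x)) (by simp) (by simp)
    (by simp) hr (fun _ => hm.idle) (by simp [hm.base]) (fun _ => hcJ) (fun _ => hiJ) ?_)))
  intro k w hk
  rw [sub_eq_add_neg]
  exact runs_choice ((hm.idle.update (by simp) _).update (by simp) _).tmp (h1 k w hk)
    (.seq (.neg (h2 k w hk)))

end Prog

/-! ### Programs that call several machines -/

section Family

variable {ι : Type} (M : ι → TM)

/-- The symbols for the simulation of a family of machines. -/
abbrev Symbols : Type := Σ i, (M i).Q ⊕ (M i).Γ ⊕ (M i).Trans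

/-- The stacks for the simulation of a family of machines. -/
abbrev Stacks : Type := Σ i, Unit ⊕ (M i).K ⊕ (M i).K

instance [Finite ι] : Finite (Symbols M) :=
  haveI (i : ι) : Finite ((M i).Q ⊕ (M i).Γ ⊕ (M i).Trans) :=
    haveI := (M i).finQ; haveI := (M i).finΓ; haveI := (M i).finK; inferInstance
  inferInstance

instance [Finite ι] : Finite (Stacks M) :=
  haveI (i : ι) : Finite (Unit ⊕ (M i).K ⊕ (M i).K) := haveI := (M i).finK; inferInstance
  inferInstance

/-- A host for each machine of a family. -/
def hostOf (i : ι) : Host (M i) (Sym (Symbols M)) (Reg ⊕ Stacks M) where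
  stack y := .inr ⟨i, y⟩
  stack_injective _ _ h := by simpa using h
  cQ := ⟨fun q => .inr ⟨i, .inl q⟩, fun _ _ h => by simpa using h⟩
  cΓ := ⟨fun a => .inr ⟨i, .inr (.inl a)⟩, fun _ _ h => by simpa using h⟩
  cT := ⟨fun t => .inr ⟨i, .inr (.inr t)⟩, fun _ _ h => by simpa using h⟩

@[simp]
theorem hostOf_stack (i : ι) (y : Unit ⊕ (M i).K ⊕ (M i).K) :
    (hostOf M i).stack y = .inr ⟨i, y⟩ := rfl

variable {M} [DecidableEq (Stacks M)] {i : ι}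

omit [DecidableEq (Stacks M)] in
theorem arg_notMem_range : (Sum.inl .arg : Reg ⊕ Stacks M) ∉ Set.range (hostOf M i).stack := by
  simp

theorem exists_weighs (h : (M i).PolyTime) :
    ∃ E : Prog (Sym (Symbols M)) (Reg ⊕ Stacks M), ∃ q, Weighs E (M i).gap q := by
  obtain ⟨p, hp⟩ := h
  obtain ⟨q, hq⟩ := Host.runs_callGap (H := hostOf M i) hp
  refine ⟨_, q, fun x m hm => (hq x _ _ (fun y => ?_) arg_notMem_range
    (Function.update_self _ _ _)).congr rfl ?_ le_rfl⟩
  · simpa using hm.machine _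
  · rw [Function.update_idem, ← hm.arg, Function.update_eq_self]

theorem exists_evaluates {f : List Bool → ℤ} (hM : (M i).Deterministic) (h : (M i).PolyTime)
    (hf : (M i).Computes fun x => encodeInt (f x)) :
    ∃ E : Prog (Sym (Symbols M)) (Reg ⊕ Stacks M), E.Det ∧ ∃ q, Evaluates E f q := by
  obtain ⟨p, hp⟩ := h
  obtain ⟨q, hq⟩ := Host.runs_callOut (H := hostOf M i) hM hp hf
  refine ⟨_, (hostOf M i).det_callOut hM _, q, fun x => ⟨(hq x).1, fun m hm =>
    ((hq x).2 _ _ (fun y => ?_) arg_notMem_range (Function.update_self _ _ _)).congr rfl ?_ le_rfl⟩⟩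
  · simpa using hm.machine _
  · rw [Function.update_idem]

end Family

namespace Prog

variable {B Z : Type} [DecidableEq Z]

/-- Write the image of the input under `φ` to `base`. -/
def setBase (φ : Bool → Bool) : Prog (Sym B) (Reg ⊕ Z) :=
  dup (.inl .inp) (.inl .base) (.inl .tmp) fun a => [bit (φ (unbit a))]

/-- The memory with given contents of `inp` and `base`. -/
def baseMem (x y : List Bool) : Reg ⊕ Z → List (Sym B) :=
  Function.update (Function.update (fun _ => []) (.inl .inp) (x.map bit)) (.inl .base) (y.map bit)

theorem runs_setBase (φ : Bool → Bool) (x : List Bool) :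
    Runs [(setBase φ : Prog (Sym B) (Reg ⊕ Z))] (start bit (.inl .inp) x) 1 (baseMem x (x.map φ))
      (2 * x.length) := by
  refine (runs_dup (by simp) (by simp) (by simp) _ (by simp [start])).congr rfl ?_ ?_
  · simp [start, baseMem, ← List.map_eq_flatMap, Function.comp_def]
  · simp [start]

theorem ready_baseMem (x y : List Bool) : Ready x y (baseMem x y : Reg ⊕ Z → List (Sym B)) := by
  constructor
  · constructor <;> simp [baseMem]
  · simp [baseMem]
  · simp [baseMem]

omit [DecidableEq Z] in
theorem polyBdd_loopTime (c : ℕ) {τ : ℕ → ℕ} (hτ : PolyBdd τ) :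
    PolyBdd fun n => loopTime c n (τ n) := by
  have hr : PolyBdd fun n => n ^ c + c := (PolyBdd.id.pow c).add (.const c)
  exact ((polyBdd_powTime c).add (hr.mul ((((PolyBdd.const 2).mul hr).add (.const 2)).add hτ))).add
    ((PolyBdd.const 2).mul hr)

omit [DecidableEq Z] in
theorem polyBdd_evalTime (c : ℕ) (q : Polynomial ℕ) :
    PolyBdd fun n => evalTime q n (n ^ c + c) := by
  have hr : PolyBdd fun n => n ^ c + c := (PolyBdd.id.pow c).add (.const c)
  have hn : PolyBdd fun n => 2 * n := (PolyBdd.const 2).mul .id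
  exact (((PolyBdd.const 2).mul hr).add hn).add
    ((PolyBdd.eval q).comp ((hn.add (.const 2)).add hr))

end Prog

/-- The map `φ` turns the input into the string on which the targets depend: a constant map yields
`0ⁿ` for LWPP, the identity yields the input itself for WPP. -/
theorem gapDiff_mem_GapP {g fA fR : List Bool → ℤ} (hg : g ∈ GapP) (hA : fA ∈ FP) (hR : fR ∈ FP)
    (φ : Bool → Bool) (c : ℕ) :
    (fun x : List Bool =>
      ∏ j ∈ Finset.range (x.length ^ c + c),
        diffProd fR (x.map φ) (x.length ^ c + c) (fA (pair (x.map φ) (j + 1))) -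
      ∏ j ∈ Finset.range (x.length ^ c + c),
        (diffProd fR (x.map φ) (x.length ^ c + c) (fA (pair (x.map φ) (j + 1))) -
          diffProd fR (x.map φ) (x.length ^ c + c) (g x))) ∈ GapP := by
  classical
  obtain ⟨N, hN, rfl⟩ := hg
  obtain ⟨MA, hA1, hA2, hA3⟩ := hA
  obtain ⟨MR, hR1, hR2, hR3⟩ := hR
  -- The machines for `g`, `fA` and `fR` get disjoint stacks and symbols within one program.
  let M : Fin 3 → TM := ![N, MA, MR]
  obtain ⟨Eg, qg, hEg⟩ := exists_weighs (M := M) (i := 0) hN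
  obtain ⟨EA, -, qA, hEA⟩ := exists_evaluates (M := M) (i := 1) hA1 hA2 hA3
  obtain ⟨ER, -, qR, hER⟩ := exists_evaluates (M := M) (i := 2) hR1 hR2 hR3
  have hT : PolyBdd fun n => 2 * n + loopTime c n
      (loopTime c n (3 * evalTime qA n (n ^ c + c) + 3 * evalTime qR n (n ^ c + c)) +
        loopTime c n (2 * n + qg.eval n + 3 * evalTime qR n (n ^ c + c))) := by
    have h3 := (PolyBdd.const 3).mul (polyBdd_evalTime c qR)
    have h2 := (PolyBdd.const 2).mul .id
    exact h2.add (polyBdd_loopTime c ((polyBdd_loopTime c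
      (((PolyBdd.const 3).mul (polyBdd_evalTime c qA)).add h3)).add
        (polyBdd_loopTime c ((h2.add (.eval qg)).add h3))))
  refine mem_GapP_of_runs (P := setBase φ ;; gapDiff c Eg EA ER) bit_injective (.inl .inp)
    (m' := fun x => baseMem x (x.map φ)) hT fun x => (runs_setBase φ x).then_one ?_
  have := runs_gapDiff hEg hEA hER (ready_baseMem x (x.map φ)) (by simp [baseMem])
    (by simp [baseMem]) (by simp [baseMem]) (by simp [baseMem]) (c := c) rfl
  rw [List.length_map] at this
  exact this

/-! ### Arithmetic with signed binary digits -/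

theorem value_map_mul (δ : SignType) (l : List SignType) :
    value (l.map fun a => δ * a) = δ * value l := by
  induction l with
  | nil => simp [value]
  | cons a l ih => rw [List.map_cons, value, ih, value, SignType.coe_mul]; ring

/-- The digits of `ε * z`. -/
def intDigits (ε : SignType) (z : ℤ) : List SignType :=
  (z.natAbs.bits.map bitDigit).map fun a => (if z < 0 then -ε else ε) * a

theorem value_intDigits (ε : SignType) (z : ℤ) : value (intDigits ε z) = ε * z := by
  rw [intDigits, value_map_mul, value_bits]
  split_ifs with h
  · rw [SignType.coe_neg, Int.ofNat_natAbs_of_nonpos h.le]; ring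
  · rw [Int.natAbs_of_nonneg (by omega)]

theorem length_intDigits (ε : SignType) (z : ℤ) :
    (intDigits ε z).length + 1 = (encodeInt z).length := by
  simp [intDigits, encodeInt]

/-- The digits of `a - b`. -/
noncomputable def subDigits (a b : ℤ) : List SignType := addDigits 0 (intDigits 1 a) (intDigits (-1) b)

theorem value_subDigits (a b : ℤ) : value (subDigits a b) = a - b := by
  rw [subDigits, value_addDigits, value_intDigits, value_intDigits]
  simp; ring

theorem length_subDigits (a b : ℤ) :
    (subDigits a b).length ≤ (encodeInt a).length + (encodeInt b).length := by
  have := length_addDigits 0 (intDigits 1 a) (intDigits (-1) b)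
  have := length_intDigits 1 a
  have := length_intDigits (-1) b
  rw [subDigits]
  omega

/-- The digits of a product. -/
noncomputable def mulDigits (k : List SignType) : List SignType → List SignType
  | [] => []
  | δ :: l => addDigits 0 (0 :: mulDigits k l) (k.map fun a => δ * a)

theorem value_mulDigits (k l : List SignType) : value (mulDigits k l) = value k * value l := by
  induction l with
  | nil => simp [mulDigits, value]
  | cons δ l ih =>
    rw [mulDigits, value_addDigits, value_map_mul, value, value, ih]
    simp; ring

/-- Each digit of `l` costs at most two places, one for the shift and one for the carry. The bound
is additive in the factors, so products of polynomially many factors keep polynomial length. -/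
theorem length_mulDigits (k l : List SignType) :
    (mulDigits k l).length ≤ k.length + 2 * l.length := by
  induction l with
  | nil => simp [mulDigits]
  | cons δ l ih =>
    have := length_addDigits 0 (0 :: mulDigits k l) (k.map fun a => δ * a)
    simp only [mulDigits, List.length_cons, List.length_map] at this ⊢
    omega

/-- The digits of the product of the first numbers of a sequence with a given number. -/
noncomputable def prodDigits (u : ℕ → List SignType) (l : List SignType) : ℕ → List SignType
  | 0 => l
  | k + 1 => mulDigits (prodDigits u l k) (u k)

theorem value_prodDigits (u : ℕ → List SignType) (l : List SignType) (k : ℕ) :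
    value (prodDigits u l k) = value l * ∏ i ∈ Finset.range k, value (u i) := by
  induction k with
  | zero => simp [prodDigits]
  | succ k ih => rw [prodDigits, value_mulDigits, ih, Finset.prod_range_succ, mul_assoc]

theorem length_prodDigits {u : ℕ → List SignType} {D r : ℕ} (hu : ∀ i < r, (u i).length ≤ D)
    (l : List SignType) {k : ℕ} (hk : k ≤ r) :
    (prodDigits u l k).length ≤ l.length + 2 * D * k := by
  induction k with
  | zero => simp [prodDigits]
  | succ k ih =>
    have h1 := length_mulDigits (prodDigits u l k) (u k)
    have h2 := ih (by omega)
    have h3 := hu k (by omega)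
    rw [prodDigits, mul_add]
    omega

/-! ### From signed digits to the standard binary representation -/

/-- The sign of a number. -/
def signDigit : List SignType → SignType
  | [] => 0
  | d :: l => if signDigit l = 0 then d else signDigit l

/-- The leading nonzero digit determines the sign: if the higher part is a nonzero integer, doubling
it outweighs one more digit. -/
theorem value_bounds (l : List SignType) : (signDigit l = 0 → value l = 0) ∧
    (signDigit l = 1 → 0 < value l) ∧ (signDigit l = -1 → value l < 0) := by
  induction l with
  | nil => simp [signDigit, value]
  | cons d l ih =>
    obtain ⟨h0, h1, h2⟩ := ih
    simp only [signDigit, value]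
    rcases hs : signDigit l with _ | _ | _
    · have := h0 hs
      cases d <;> simp [this]
    · have := h2 hs
      cases d <;> simp <;> omega
    · have := h1 hs
      cases d <;> simp <;> omega

/-- The last bit of the sum of a digit and a borrow. -/
def borrowBit (d b : SignType) : Bool := decide (d * d ≠ b * b)

/-- The borrow of the sum of a digit and a borrow. -/
def nextBorrow (d b : SignType) : SignType := if (d : ℤ) + b < 0 then -1 else 0

/-- The bits of the sum of a nonnegative number and a borrow. -/
def borrowBits : SignType → List SignType → List Bool
  | _, [] => []
  | b, d :: l => borrowBit d b :: borrowBits (nextBorrow d b) l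

/-- A digit plus a borrow is one of -2, -1, 0, 1. Its parity becomes the bit, and a negative sum
passes on a borrow, as in -1 = 1 - 2 and -2 = 0 - 2. Nonnegativity of the total rules out a borrow
left over at the end. -/
theorem value_borrowBits {b : SignType} {l : List SignType} (hb : b ≤ 0) (h : 0 ≤ b + value l) :
    value ((borrowBits b l).map bitDigit) = b + value l := by
  induction l generalizing b with
  | nil => cases b <;> simp_all [borrowBits, value]
  | cons d l ih =>
    simp only [borrowBits, borrowBit, nextBorrow, List.map_cons, value] at h ⊢
    rw [ih]
    · cases b <;> cases d <;> simp_all [bitDigit] <;> ring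
    · split_ifs <;> simp
    · cases b <;> cases d <;> simp_all <;> omega

theorem length_borrowBits (b : SignType) (l : List SignType) :
    (borrowBits b l).length = l.length := by
  induction l generalizing b with
  | nil => rfl
  | cons d l ih => simp [borrowBits, ih]

/-- Remove leading zeros. -/
def trim : List Bool → List Bool
  | [] => []
  | b :: l => if b = false ∧ trim l = [] then [] else b :: trim l

/-- A bit list without leading zeros is determined by its value, which connects the computed bits
with `Nat.bits`. -/
theorem trim_eq_bits (l : List Bool) {n : ℕ} (h : value (l.map bitDigit) = n) : trim l = n.bits := by
  induction l generalizing n with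
  | nil =>
    obtain rfl : n = 0 := by simpa [value] using h.symm
    simp [trim]
  | cons b l ih =>
    -- The higher bits represent a natural number, to which the induction hypothesis applies.
    obtain ⟨k, hk⟩ : ∃ k : ℕ, value (l.map bitDigit) = k := by
      clear ih h
      induction l with
      | nil => exact ⟨0, rfl⟩
      | cons b l ih =>
        obtain ⟨k, hk⟩ := ih
        refine ⟨Nat.bit b k, ?_⟩
        rw [List.map_cons, value, hk, Nat.bit_val]
        cases b <;> simp [bitDigit]; ring
    obtain rfl : n = Nat.bit b k := by
      rw [List.map_cons, value, hk] at h
      rw [Nat.bit_val]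
      cases b <;> simp [bitDigit] at h ⊢ <;> omega
    rw [trim, ih hk]
    by_cases hb : b = false ∧ k.bits = []
    · have : k = 0 := by
        have h2 := hb.2
        rw [← List.length_eq_zero_iff, Nat.size_eq_bits_len, Nat.size_eq_zero] at h2
        exact h2
      rw [if_pos hb, hb.1, this]
      simp
    · rw [if_neg hb, Nat.bits_append_bit]
      rintro rfl
      by_contra hb'
      exact hb ⟨by simpa using hb', by simp⟩

/-- Multiplying all digits by the sign gives digits of the absolute value; this is nonnegative, so
the borrow procedure applies and trimming makes the result canonical. -/
theorem encodeInt_value {l : List SignType} {σ : SignType} (hσ : signDigit l = σ) (h0 : σ ≠ 0) :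
    encodeInt (value l) = decide (σ = -1) :: trim (borrowBits 0 (l.map fun a => σ * a)) := by
  obtain ⟨-, h1, h2⟩ := value_bounds l
  have h3 : ((0 : SignType) : ℤ) + value (l.map fun a => σ * a) = (value l).natAbs := by
    rw [value_map_mul, SignType.coe_zero, zero_add]
    rcases σ with _ | _ | _
    · exact absurd rfl h0
    · simp [abs_of_neg (h2 hσ)]
    · simp [abs_of_pos (h1 hσ)]
  rw [trim_eq_bits _ ((value_borrowBits le_rfl (by rw [h3]; positivity)).trans h3), encodeInt]
  congr 1
  rcases σ with _ | _ | _
  · exact absurd rfl h0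
  · simpa using h2 hσ
  · simpa using (h1 hσ).le

/-! ### Computing products of differences -/

namespace Prog

variable {B Z : Type} [DecidableEq Z]

/-- Move the digits of `ε` times the integer in `arg` to `t`. -/
def unpackInt (ε : SignType) (t : Reg) : Prog (Sym B) (Reg ⊕ Z) :=
  case (.inl .arg) skip fun s =>
    pour (.inl .arg) (.inl .tmp) (fun a => [dg ((if unbit s then -ε else ε) * dig a)]) ;;
      pour (.inl .tmp) (.inl t) fun a => [a]

/-- Write the digits of the difference of the values of `EA` at `idxJ` and `ER` at `idxI` to `mult`,
most significant digit first. -/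
noncomputable def factor (EA ER : Prog (Sym B) (Reg ⊕ Z)) : Prog (Sym B) (Reg ⊕ Z) :=
  (pairArg .idxJ ;; EA) ;; unpackInt 1 .res ;; (pairArg .idxI ;; ER) ;; unpackInt (-1) .arg ;;
    push (.inl .carry) (dg 0) ;; addStacks (.inl .carry) (.inl .res) (.inl .arg) (.inl .mult)

/-- One step of the multiplication. -/
noncomputable def mulStep (δ : SignType) : Prog (Sym B) (Reg ⊕ Z) :=
  push (.inl .res) (dg 0) ;;
    dup (.inl .acc) (.inl .arg) (.inl .tmp) (fun a => [dg (δ * dig a)]) ;;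
    push (.inl .carry) (dg 0) ;;
    addStacks (.inl .carry) (.inl .res) (.inl .arg) (.inl .tmp) ;;
    pour (.inl .tmp) (.inl .res) fun a => [a]

/-- Multiply `acc` by `mult`, which is emptied. -/
noncomputable def mulAcc : Prog (Sym B) (Reg ⊕ Z) :=
  loop (.inl .mult) (fun a => mulStep (dig a)) ;; clear (.inl .acc) ;;
    pour (.inl .res) (.inl .tmp) (fun a => [a]) ;; pour (.inl .tmp) (.inl .acc) fun a => [a]

/-- Multiply `acc` by all differences. -/
noncomputable def prodLoop (c : ℕ) (EA ER : Prog (Sym B) (Reg ⊕ Z)) : Prog (Sym B) (Reg ⊕ Z) :=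
  forIdx c .ctrJ .idxJ (forIdx c .ctrI .idxI (factor EA ER ;; mulAcc))

omit [DecidableEq Z] in
theorem det_prodLoop {c : ℕ} {EA ER : Prog (Sym B) (Reg ⊕ Z)} (hA : EA.Det) (hR : ER.Det) :
    (prodLoop c EA ER).Det :=
  have hu : ∀ ε t, (unpackInt ε t : Prog (Sym B) (Reg ⊕ Z)).Det :=
    fun _ _ => ⟨trivial, fun _ => ⟨det_pour _ _ _, det_pour _ _ _⟩⟩
  det_forIdx (det_forIdx ⟨⟨⟨det_pairArg _, hA⟩, hu _ _, ⟨det_pairArg _, hR⟩, hu _ _, det_push _ _,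
    det_addStacks _ _ _ _⟩, fun _ => ⟨det_push _ _, det_dup _ _ _ _, det_push _ _,
      det_addStacks _ _ _ _, det_pour _ _ _⟩, det_clear _, det_pour _ _ _, det_pour _ _ _⟩)

variable {m : Reg ⊕ Z → List (Sym B)}

/-- The target `t` may be `arg` itself, so its old content is read after `arg` has been emptied. -/
theorem runs_unpackInt (ε : SignType) {t : Reg} (ht : t ≠ .tmp) (htmp : m (.inl .tmp) = []) {z : ℤ}
    (ha : m (.inl .arg) = (encodeInt z).map bit) :
    Runs [unpackInt ε t] m 1 (Function.update (Function.update m (.inl .arg) []) (.inl t)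
      ((intDigits ε z).map dg ++ Function.update m (.inl .arg) [] (.inl t)))
      (2 * (encodeInt z).length) := by
  refine .case_cons (by rw [ha, encodeInt, List.map_cons]) (((runs_pour (by simp) _ _).then_one
    (runs_pour (by simpa using Ne.symm ht) _ _)).congr rfl ?_ ?_)
  · have e : (z.natAbs.bits.map (bit : Bool → Sym B)).flatMap
        (fun a => [(dg ((if unbit (bit (decide (z < 0)) : Sym B) then -ε else ε) * dig a) :
          Sym B)]) = (intDigits ε z).map dg := by
      rw [← List.map_eq_flatMap, map_bit, intDigits]
      simp [Function.comp_def]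
    funext r
    simp only [Function.update_self, ← List.map_eq_flatMap] at e ⊢
    simp only [Function.update_apply, ← e]
    split_ifs <;> simp_all
  · simp only [← List.map_eq_flatMap]
    simp [encodeInt, htmp]
    omega

/-- The difference is left with its most significant digit on top, the order in which the
multiplication consumes it. -/
theorem runs_factor {EA ER : Prog (Sym B) (Reg ⊕ Z)} {fA fR : List Bool → ℤ}
    {qA qR : Polynomial ℕ} (hA : Evaluates EA fA qA) (hR : Evaluates ER fR qR) {x y : List Bool}
    (hm : Ready x y m) (hres : m (.inl .res) = []) (hmult : m (.inl .mult) = []) {i j r : ℕ}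
    (hi : m (.inl .idxI) = i.bits.map bit) (hir : i ≤ r)
    (hj : m (.inl .idxJ) = j.bits.map bit) (hjr : j ≤ r) :
    (subDigits (fA (pair y j)) (fR (pair y i))).length ≤
      evalTime qA y.length r + evalTime qR y.length r ∧
    Runs [factor EA ER] m 1 (Function.update m (.inl .mult)
      ((subDigits (fA (pair y j)) (fR (pair y i))).reverse.map dg))
      (4 * (evalTime qA y.length r + evalTime qR y.length r)) := by
  set a := fA (pair y j)
  set b := fR (pair y i)
  obtain ⟨h1, h2⟩ := runs_eval hA hm (i := .idxJ) (by simp) hj hjr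
  have hm' : Ready x y (Function.update m (.inl .res) ((intDigits 1 a).map dg)) :=
    hm.update (by simp) _
  obtain ⟨h3, h4⟩ := runs_eval hR hm' (i := .idxI) (by simp) (by simpa using hi) hir
  have h5 := runs_unpackInt (B := B) (Z := Z) (m := Function.update m (.inl .arg)
    ((encodeInt a).map bit)) (t := .res) 1 (by simp) (by simp [hm.idle.tmp]) (z := a) (by simp)
  have e : Function.update m (.inl .arg) [] = m := by
    rw [Function.update_eq_self_iff]; exact hm.idle.arg.symm
  rw [Function.update_idem, e, hres, List.append_nil] at h5
  have h6 := runs_unpackInt (B := B) (Z := Z) (m := Function.update (Function.update m (.inl .res)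
    ((intDigits 1 a).map dg)) (.inl .arg) ((encodeInt b).map bit)) (t := .arg) (-1) (by simp)
    (by simp [hm.idle.tmp]) (z := b) (by simp)
  have e1 := length_subDigits a b
  have e2 := length_intDigits 1 a
  have e3 := length_intDigits (-1) b
  have e4 : (encodeInt a).length ≤ evalTime qA y.length r := h1.trans (by simp [evalTime])
  have e5 : (encodeInt b).length ≤ evalTime qR y.length r := h3.trans (by simp [evalTime])
  refine ⟨by omega, (h2.then_one (h5.then_one (h4.then_one (h6.then_one ((runs_push _ _ _).then_one
    (runs_addStacks (x := 0) (k := intDigits 1 a) (l := intDigits (-1) b) (by simp) (by simp)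
      (by simp) (by simp) (by simp) (by simp) ?_ ?_ ?_)))))).congr rfl ?_ ?_⟩
  · simp [hm.idle.carry]
  · simp
  · simp
  · have := hm.idle.arg
    have := hm.idle.carry
    funext r
    simp only [Function.update_apply, subDigits]
    split_ifs <;> simp_all
  · omega

/-- One Horner step: `res` is doubled by pushing a zero, and `δ` times `acc` is added. -/
theorem runs_mulStep (hm : Idle m) {k l : List SignType} {δ : SignType} {N : ℕ}
    (hN : k.length + l.length + 2 ≤ N)
    (hacc : m (.inl .acc) = k.map dg) (hres : m (.inl .res) = l.map dg) :
    Runs [mulStep δ] m 1 (Function.update m (.inl .res)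
      ((addDigits 0 (0 :: l) (k.map fun a => δ * a)).map dg)) (5 * N) := by
  have hlen := length_addDigits 0 (0 :: l) (k.map fun a => δ * a)
  refine ((runs_push _ _ _).then_one ((runs_dup (by simp) (by simp) (by simp) _ ?_).then_one
    ((runs_push _ _ _).then_one ((runs_addStacks (x := 0) (k := 0 :: l)
      (l := k.map fun a => δ * a) (by simp) (by simp)
      (by simp) (by simp) (by simp) (by simp) ?_ ?_ ?_).then_one (runs_pour ?_ _ _))))).congr rfl ?_ ?_
  · simp [hm.tmp]
  · simp [hm.carry]
  · simp [hres]
  · simp [hm.arg, hacc, ← List.map_eq_flatMap]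
  · simp
  · funext r
    rcases r with r | z
    · cases r <;> simp [← List.map_eq_flatMap, Function.comp_def, hm.arg, hm.tmp, hm.carry, hacc, hres]
    · simp
  · simp [hm.tmp, hacc] at hlen ⊢
    omega

theorem runs_mulAcc (hm : Idle m) {k d : List SignType} {N : ℕ}
    (hN : k.length + (k.length + 2 * d.length) + 2 ≤ N)
    (hacc : m (.inl .acc) = k.map dg) (hres : m (.inl .res) = []) :
    Runs [mulAcc] (Function.update m (.inl .mult) (d.reverse.map dg)) 1
      (Function.update (Function.update m (.inl .mult) []) (.inl .acc) ((mulDigits k d).map dg))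
      (d.length * (5 * N + 1) + 3 * N) := by
  -- The higher digits `d₂` have been processed and the lower digits `d₁` still lie on `mult`. The
  -- next digit is the last one of `d₁`, hence the induction from the end of the list.
  have key : ∀ d₁ d₂ : List SignType, k.length + (k.length + 2 * (d₁.length + d₂.length)) + 2 ≤ N →
      Runs [loop (.inl .mult) fun a => mulStep (dig a)] (Function.update (Function.update m
        (.inl .res) ((mulDigits k d₂).map dg)) (.inl .mult) (d₁.reverse.map dg)) 1
        (Function.update (Function.update m (.inl .res) ((mulDigits k (d₁ ++ d₂)).map dg))
          (.inl .mult) []) (d₁.length * (5 * N + 1)) := by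
    intro d₁
    induction d₁ using List.reverseRecOn with
    | nil =>
      intro d₂ _
      exact .loop_nil (by simp) ((Runs.nil _ _).congr rfl (by simp) le_rfl)
    | append_singleton d₁ δ ih =>
      intro d₂ h
      simp only [List.length_append, List.length_singleton] at h
      have hlen := length_mulDigits k d₂
      have hs := runs_mulStep (m := Function.update (Function.update m
        (.inl .res) ((mulDigits k d₂).map dg)) (.inl .mult) (d₁.reverse.map dg)) (δ := δ)
        ((hm.update (by simp) _).update (by simp) _) (k := k) (l := mulDigits k d₂) (N := N)
        (by omega) (by simpa using hacc) (by simp)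
      have e : ∀ l l', Function.update (Function.update (Function.update m (.inl .res) l)
          (.inl .mult) (d₁.reverse.map dg)) (.inl .res) l' = Function.update (Function.update m
            (.inl .res) l') (.inl .mult) (d₁.reverse.map dg) := fun l l' => by
        rw [Function.update_comm (by simp), Function.update_idem]
      rw [e] at hs
      have hrest := hs.cons_one (ih (δ :: d₂) (by simp; omega))
      refine Runs.mono (t := 5 * N + d₁.length * (5 * N + 1) + 1) (.loop_cons (a := dg δ)
        (l := d₁.reverse.map dg) (by simp) ?_) (by simp; linarith)
      rw [Function.update_idem]
      simpa using hrest
  have h := key d [] (by simpa using hN)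
  have hlen := length_mulDigits k d
  have e : Function.update m (.inl .res) ((mulDigits k []).map dg) = m := by
    rw [Function.update_eq_self_iff, hres]; rfl
  rw [e, List.append_nil] at h
  refine (h.then_one ((runs_clear _ _).then_one ((runs_pour (by simp) _ _).then_one
    (runs_pour (by simp) _ _)))).congr rfl ?_ ?_
  · funext r
    rcases r with r | z
    · cases r <;> simp [hm.arg, hm.tmp, hm.carry, hres]
    · simp
  · simp [hm.tmp, hacc]
    omega

/-- The digits of the product of all differences for the first `j` values of `fA`. -/
noncomputable def accDigits (fA fR : List Bool → ℤ) (y : List Bool) (r : ℕ) : ℕ → List SignType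
  | 0 => [1]
  | j + 1 => prodDigits (fun i => subDigits (fA (pair y (j + 1))) (fR (pair y (i + 1))))
      (accDigits fA fR y r j) r

omit [DecidableEq Z] in
theorem value_accDigits (fA fR : List Bool → ℤ) (y : List Bool) (r j : ℕ) :
    value (accDigits fA fR y r j) =
      ∏ k ∈ Finset.range j, diffProd fR y r (fA (pair y (k + 1))) := by
  induction j with
  | zero => simp [accDigits, value]
  | succ j ih =>
    rw [accDigits, value_prodDigits, ih, Finset.prod_range_succ]
    simp only [value_subDigits, diffProd]

omit [DecidableEq Z] in
-- Every factor has at most `D` digits and lengthens the product by at most `2 * D`, and there are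
-- at most `r` factors for each `j`. This keeps the accumulator polynomially long.
theorem length_accDigits {fA fR : List Bool → ℤ} {y : List Bool} {r D : ℕ}
    (hD : ∀ j ≤ r, ∀ i ≤ r, (subDigits (fA (pair y j)) (fR (pair y i))).length ≤ D) {j : ℕ}
    (hj : j ≤ r) : (accDigits fA fR y r j).length ≤ 1 + 2 * D * r * j := by
  induction j with
  | zero => simp [accDigits]
  | succ j ih =>
    have h1 := ih (by omega)
    have h2 := length_prodDigits (r := r) (D := D)
      (u := fun i => subDigits (fA (pair y (j + 1))) (fR (pair y (i + 1))))
      (fun i hi => hD _ hj _ hi) (accDigits fA fR y r j) le_rfl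
    rw [accDigits, mul_add, mul_one]
    omega

/-- A bound for the time of a step in the computation of a product. -/
def stepTime (D r : ℕ) : ℕ :=
  4 * D + (D * (5 * (2 * (1 + 2 * D * r * r) + 2 * D + 2) + 1) +
    3 * (2 * (1 + 2 * D * r * r) + 2 * D + 2))

theorem runs_prodLoop {c : ℕ} {EA ER : Prog (Sym B) (Reg ⊕ Z)} {fA fR : List Bool → ℤ}
    {qA qR : Polynomial ℕ} (hA : Evaluates EA fA qA) (hR : Evaluates ER fR qR) {x y : List Bool}
    (hm : Ready x y m) (hcI : m (.inl .ctrI) = []) (hiI : m (.inl .idxI) = [])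
    (hcJ : m (.inl .ctrJ) = []) (hiJ : m (.inl .idxJ) = []) (hres : m (.inl .res) = [])
    (hmult : m (.inl .mult) = []) {r D : ℕ} (hr : y.length ^ c + c = r)
    (hD : evalTime qA y.length r + evalTime qR y.length r = D) :
    (accDigits fA fR y r r).length ≤ 1 + 2 * D * r * r ∧
    Runs [prodLoop c EA ER] (Function.update m (.inl .acc) [dg 1]) 1
      (Function.update m (.inl .acc) ((accDigits fA fR y r r).map dg))
      (loopTime c y.length (loopTime c y.length (stepTime D r))) := by
  have hfac : ∀ j ≤ r, ∀ i ≤ r, (subDigits (fA (pair y j)) (fR (pair y i))).length ≤ D := by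
    intro j hj i hi
    rw [← hD]
    -- The bound on the factors does not depend on the memory, so any memory with the right indices
    -- will do.
    exact (runs_factor hA hR (m := Function.update (Function.update (baseMem x y) (.inl .idxI)
      (i.bits.map bit)) (.inl .idxJ) (j.bits.map bit)) (((ready_baseMem x y).update (by simp) _).update
        (by simp) _) (by simp [baseMem]) (by simp [baseMem]) (by simp) hi (by simp) hj).1
  refine ⟨length_accDigits hfac le_rfl, ?_⟩
  set u : ℕ → ℕ → List SignType := fun j i =>
    subDigits (fA (pair y (j + 1))) (fR (pair y (i + 1)))
  have hT : ∀ τ, loopTime c y.length τ = powTime c y.length + r * (2 * r + 2 + τ) + 2 * r := by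
    intro τ; simp [loopTime, hr]
  have outer := runs_forIdx (c := c) (ctr := .ctrJ) (i := .idxJ) (by simp) (by simp) (by simp)
    (body := forIdx c .ctrI .idxI (factor EA ER ;; mulAcc))
    (μ := fun j => Function.update m (.inl .acc) ((accDigits fA fR y r j).map dg)) (v := fun _ => 1)
    (τ := loopTime c y.length (stepTime D r)) hr (fun _ => hm.idle.update (by simp) _)
    (by simp [hm.base]) (fun _ => by simpa) (fun _ => by simpa) ?_
  · rw [hT]
    exact outer.congr (by simp) rfl le_rfl
  intro j w hj
  -- Within an outer iteration, the memory after `i` inner ones contains the product of the first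
  -- `i` differences with the old accumulator. The signs are all 1, since the computation is
  -- deterministic.
  have inner := runs_forIdx (c := c) (ctr := .ctrI) (i := .idxI) (by simp) (by simp) (by simp)
    (body := factor EA ER ;; mulAcc)
    (μ := fun i => Function.update (Function.update (Function.update m (.inl .acc)
      ((prodDigits (u j) (accDigits fA fR y r j) i).map dg)) (.inl .idxJ) ((j + 1).bits.map bit))
        (.inl .ctrJ) w) (v := fun _ => 1)
    (τ := stepTime D r) hr
    (fun _ => ((hm.idle.update (by simp) _).update (by simp) _).update (by simp) _)
    (by simp [hm.base]) (fun _ => by simpa) (fun _ => by simpa) ?_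
  · rw [hT]
    exact inner.congr (by simp) rfl le_rfl
  intro i w' hi
  have hk := length_prodDigits (u := u j) (r := r) (D := D)
    (fun i hi => hfac _ hj _ hi) (accDigits fA fR y r j) hi.le
  have hacc := length_accDigits hfac hj.le
  have hd : (subDigits (fA (pair y (j + 1))) (fR (pair y (i + 1)))).length ≤ D := hfac _ hj _ hi
  have hkN : (prodDigits (u j) (accDigits fA fR y r j) i).length ≤ 1 + 2 * D * r * r := by
    have h1 : 2 * D * i ≤ 2 * D * r := Nat.mul_le_mul_left _ hi.le
    have h2 : 2 * D * r * (j + 1) ≤ 2 * D * r * r := Nat.mul_le_mul_left _ hj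
    rw [mul_add, mul_one] at h2
    omega
  set k := prodDigits (u j) (accDigits fA fR y r j) i with hkdef
  set M := Function.update (Function.update (Function.update (Function.update (Function.update m
    (.inl .acc) (k.map dg)) (.inl .idxJ) ((j + 1).bits.map bit)) (.inl .ctrJ) w) (.inl .idxI)
      ((i + 1).bits.map bit)) (.inl .ctrI) w' with hM
  have hMready : Ready x y M := ((((hm.update (by simp) _).update (by simp) _).update
    (by simp) _).update (by simp) _).update (by simp) _
  have hf := (runs_factor hA hR hMready (by simp [hM, hres]) (by simp [hM, hmult])
    (i := i + 1) (j := j + 1) (r := r) (by simp [hM]) hi (by simp [hM]) hj).2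
  have hmul := runs_mulAcc hMready.idle (k := k)
    (d := subDigits (fA (pair y (j + 1))) (fR (pair y (i + 1))))
    (N := 2 * (1 + 2 * D * r * r) + 2 * D + 2) (by omega) (by simp [hM]) (by simp [hM, hres])
  refine (hf.then_one hmul).congr rfl ?_ ?_
  · rw [hM, prodDigits]
    funext s
    simp only [Function.update_apply]
    split_ifs <;> simp_all [u]
  · rw [hD, stepTime]
    gcongr

end Prog

/-! ### Writing an integer -/

namespace Prog

variable {B Z : Type} [DecidableEq Z]

/-- Move `acc` to `tmp` in reverse order, and write its sign to `carry`. -/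
def findSign : Prog (Sym B) (Reg ⊕ Z) :=
  push (.inl .carry) (dg 0) ;; loop (.inl .acc) fun a => push (.inl .tmp) a ;;
    if dig a = 0 then skip else clear (.inl .carry) ;; push (.inl .carry) a

/-- Replace the digits in `acc` by bits, which are written to `mult` in reverse order. -/
def borrow : Prog (Sym B) (Reg ⊕ Z) :=
  push (.inl .count) (dg 0) ;; loop (.inl .acc) fun a => case (.inl .count) skip fun b =>
    push (.inl .mult) (bit (borrowBit (dig a) (dig b))) ;;
      push (.inl .count) (dg (nextBorrow (dig a) (dig b)))

/-- Move the bits in `mult` to `out`, without leading zeros. -/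
def dropZeros : Prog (Sym B) (Reg ⊕ Z) :=
  loop (.inl .mult) fun a => if unbit a then push (.inl .out) a else
    case (.inl .out) skip fun b => push (.inl .out) b ;; push (.inl .out) a

/-- Write the integer with sign `s` given by the digits in `tmp` to `out`. -/
def writeSigned (s : SignType) : Prog (Sym B) (Reg ⊕ Z) :=
  if s = 0 then push (.inl .out) (bit false) else
    pour (.inl .tmp) (.inl .acc) (fun a => [dg (s * dig a)]) ;; borrow ;; dropZeros ;;
      push (.inl .out) (bit (decide (s = -1)))

/-- Write the integer given by the digits in `acc` to `out`. -/
def writeInt : Prog (Sym B) (Reg ⊕ Z) :=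
  findSign ;; case (.inl .carry) skip fun s => writeSigned (dig s)

omit [DecidableEq Z] in
theorem det_writeInt : (writeInt : Prog (Sym B) (Reg ⊕ Z)).Det := by
  refine ⟨⟨det_push _ _, fun a => ⟨det_push _ _, ?_⟩⟩, trivial, fun a => ?_⟩
  · split_ifs
    exacts [trivial, ⟨det_clear _, det_push _ _⟩]
  · dsimp only [writeSigned]
    split_ifs
    · exact det_push _ _
    · refine ⟨det_pour _ _ _, ⟨det_push _ _, fun _ => ⟨trivial, fun _ => ⟨det_push _ _,
        det_push _ _⟩⟩⟩, fun _ => ?_, det_push _ _⟩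
      dsimp only
      split_ifs
      exacts [det_push _ _, ⟨trivial, fun _ => ⟨det_push _ _, det_push _ _⟩⟩]

theorem Runs.congr_left {A S : Type} [DecidableEq S] {L : List (Prog A S)} {m m₀ m' : S → List A}
    {v : ℤ} {t : ℕ} (h : Runs L m v m' t) (e : m₀ = m) : Runs L m₀ v m' t := e ▸ h

variable {m : Reg ⊕ Z → List (Sym B)}

/-- The digits come least significant first, so the last nonzero digit seen is the leading one.
`carry` is overwritten at every nonzero digit. -/
theorem runs_findSign {l : List SignType} (hacc : m (.inl .acc) = l.map dg)
    (hc : m (.inl .carry) = []) :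
    Runs [findSign] m 1 (Function.update (Function.update (Function.update m (.inl .acc) [])
      (.inl .tmp) (l.reverse.map dg ++ m (.inl .tmp))) (.inl .carry) [dg (signDigit l)])
      (2 * l.length) := by
  -- Here `s` is the last nonzero digit seen so far, or 0.
  have key : ∀ (l : List SignType) (s : SignType) (m : Reg ⊕ Z → List (Sym B)),
      m (.inl .acc) = l.map dg → m (.inl .carry) = [dg s] →
      Runs [loop (.inl .acc) fun a => push (.inl .tmp) a ;;
        if dig a = 0 then skip else clear (.inl .carry) ;; push (.inl .carry) a] m 1
        (Function.update (Function.update (Function.update m (.inl .acc) [])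
          (.inl .tmp) (l.reverse.map dg ++ m (.inl .tmp))) (.inl .carry)
            [dg (if signDigit l = 0 then s else signDigit l)]) (2 * l.length) := by
    intro l
    induction l with
    | nil =>
      intro s m ha hc
      refine .loop_nil (by simpa using ha) ((Runs.nil _ _).congr rfl ?_ le_rfl)
      rw [List.map_nil] at ha
      funext r
      rcases r with r | z
      · cases r <;> simp [signDigit, ha, hc]
      · simp
    | cons d l ih =>
      intro s m ha hc
      refine Runs.mono (t := 2 * l.length + 1 + 1) (.loop_cons (by rw [ha, List.map_cons])
        (.seq (.push ?_))) (by simp; omega)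
      rw [dig_dg]
      by_cases hd : d = 0
      · rw [if_pos hd]
        refine .skip ((ih s _ (by simp) (by simp [hc])).congr rfl ?_ (by omega))
        funext r
        rcases r with r | z
        · cases r <;> simp [signDigit, hd]
          split_ifs <;> simp_all
        · simp
      · rw [if_neg hd]
        refine .seq (((runs_clear _ _).cons_one (.push (ih d _ (by simp) (by simp)))).congr rfl ?_ ?_)
        · funext r
          rcases r with r | z
          · cases r <;> simp [signDigit]
            split_ifs <;> simp_all
          · simp
        · simp [hc]; omega
  refine ((runs_push _ _ _).then_one (key l 0 _ (by simpa) (by simp [hc]))).congr rfl ?_ (by omega)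
  have : (if signDigit l = 0 then 0 else signDigit l) = signDigit l := by
    split_ifs with h
    exacts [h.symm, rfl]
  rw [this]
  funext r
  rcases r with r | z
  · cases r <;> simp
  · simp

/-- The borrow left on `count` is of no interest later and remains unspecified. -/
theorem runs_borrow {l : List SignType} (hacc : m (.inl .acc) = l.map dg)
    (hc : m (.inl .count) = []) :
    ∃ c, Runs [borrow] m 1 (Function.update (Function.update (Function.update m (.inl .acc) [])
      (.inl .mult) ((borrowBits 0 l).reverse.map bit ++ m (.inl .mult))) (.inl .count) c)
      l.length := by
  have key : ∀ (l : List SignType) (b : SignType) (m : Reg ⊕ Z → List (Sym B)),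
      m (.inl .acc) = l.map dg → m (.inl .count) = [dg b] → ∃ c,
      Runs [loop (.inl .acc) fun a => case (.inl .count) skip fun b =>
        push (.inl .mult) (bit (borrowBit (dig a) (dig b))) ;;
          push (.inl .count) (dg (nextBorrow (dig a) (dig b)))] m 1
        (Function.update (Function.update (Function.update m (.inl .acc) [])
          (.inl .mult) ((borrowBits b l).reverse.map bit ++ m (.inl .mult))) (.inl .count) c)
        l.length := by
    intro l
    induction l with
    | nil =>
      intro b m ha hc
      refine ⟨[dg b], .loop_nil (by simpa using ha) ((Runs.nil _ _).congr rfl ?_ le_rfl)⟩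
      rw [List.map_nil] at ha
      funext r
      rcases r with r | z
      · cases r <;> simp [borrowBits, ha, hc]
      · simp
    | cons d l ih =>
      intro b m ha hc
      obtain ⟨c, hr⟩ := ih (nextBorrow d b) (Function.update (Function.update
        (Function.update m (.inl .acc) (l.map dg)) (.inl .mult)
          (bit (borrowBit d b) :: m (.inl .mult))) (.inl .count)
            [dg (nextBorrow d b)]) (by simp) (by simp)
      refine ⟨c, .loop_cons (by rw [ha, List.map_cons]) (.case_cons (a := dg b) (l := [])
        (by simp [hc]) (.seq (.push (.push ?_))))⟩
      refine (hr.congr rfl ?_ le_rfl).congr_left ?_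
      · funext r
        rcases r with r | z
        · cases r <;> simp [borrowBits]
        · simp
      · funext r
        rcases r with r | z
        · cases r <;> simp
        · simp
  obtain ⟨c, hr⟩ := key l 0 (Function.update m (.inl .count) [dg 0]) (by simpa) (by simp)
  refine ⟨c, ((runs_push _ _ _).then_one (by rw [hc]; exact hr)).congr rfl ?_ (by omega)⟩
  funext r
  rcases r with r | z
  · cases r <;> simp
  · simp

/-- The bits arrive most significant first, so a zero is a leading zero exactly when `out` is still
empty. -/
theorem runs_dropZeros {l : List Bool} (hmult : m (.inl .mult) = l.reverse.map bit)
    (hout : m (.inl .out) = []) :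
    Runs [dropZeros] m 1 (Function.update (Function.update m (.inl .mult) []) (.inl .out)
      ((trim l).map bit)) l.length := by
  have key : ∀ (l₁ l₂ : List Bool) (m : Reg ⊕ Z → List (Sym B)),
      m (.inl .mult) = l₁.reverse.map bit → m (.inl .out) = (trim l₂).map bit →
      Runs [dropZeros] m 1 (Function.update (Function.update m (.inl .mult) []) (.inl .out)
        ((trim (l₁ ++ l₂)).map bit)) l₁.length := by
    intro l₁
    induction l₁ using List.reverseRecOn with
    | nil =>
      intro l₂ m hm ho
      refine .loop_nil (by simpa using hm) ((Runs.nil _ _).congr rfl ?_ le_rfl)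
      rw [List.reverse_nil, List.map_nil] at hm
      funext r
      rcases r with r | z
      · cases r <;> simp [hm, ho]
      · simp
    | append_singleton l₁ b ih =>
      intro l₂ m hm ho
      have h := ih (b :: l₂) (Function.update (Function.update m (.inl .mult)
        (l₁.reverse.map bit)) (.inl .out) ((trim (b :: l₂)).map bit)) (by simp) (by simp)
      have e : Function.update (Function.update (Function.update (Function.update m (.inl .mult)
          (l₁.reverse.map bit)) (.inl .out) ((trim (b :: l₂)).map bit)) (.inl .mult) []) (.inl .out)
          ((trim (l₁ ++ b :: l₂)).map bit) = Function.update (Function.update m (.inl .mult) [])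
            (.inl .out) ((trim (l₁ ++ [b] ++ l₂)).map bit) := by
        funext r
        rcases r with r | z
        · cases r <;> simp
        · simp
      rw [e] at h
      refine Runs.mono (t := l₁.length + 1) (.loop_cons (a := bit b) (l := l₁.reverse.map bit)
        (by simp [hm]) ?_) (by simp)
      cases b with
      | true =>
        rw [if_pos (by simp)]
        refine .push ?_
        exact h.congr_left (by simp [trim, ho])
      | false =>
        rw [if_neg (by simp)]
        by_cases ht : trim l₂ = []
        · refine .case_nil (by simp [ho, ht]) (.skip ?_)
          refine h.congr_left ?_
          rw [eq_comm, Function.update_eq_self_iff]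
          simp [trim, ht, ho]
        · obtain ⟨a, k, hk⟩ := List.exists_cons_of_ne_nil ht
          refine .case_cons (a := bit a) (l := k.map bit) (by simp [ho, hk])
            (.seq (.push (.push ?_)))
          exact h.congr_left (by simp [trim, hk])
  simpa using key l [] m hmult (by simpa [trim] using hout)

theorem runs_writeInt {l : List SignType} (hm : Idle m) (hacc : m (.inl .acc) = l.map dg)
    (hmult : m (.inl .mult) = []) (hout : m (.inl .out) = []) :
    ∃ m', m' (.inl .out) = (encodeInt (value l)).map bit ∧
      Runs [writeInt] m 1 m' (5 * l.length) := by
  have h1 := runs_findSign hacc hm.carry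
  rw [hm.tmp, List.append_nil] at h1
  -- Once the sign has been found, both cases finish by running `writeSigned`. Zero needs only its
  -- sign bit, because its list of binary digits is empty.
  have fin {m' : Reg ⊕ Z → List (Sym B)} (h : Runs [writeSigned (signDigit l)] (Function.update
      (Function.update m (.inl .acc) []) (.inl .tmp) (l.reverse.map dg)) 1 m' (3 * l.length))
      (h' : m' (.inl .out) = (encodeInt (value l)).map bit) :
      ∃ m', m' (.inl .out) = (encodeInt (value l)).map bit ∧
        Runs [writeInt] m 1 m' (5 * l.length) := by
    refine ⟨m', h', (h1.then_one (.case_cons (Function.update_self _ _ _) (h.congr_left ?_))).congr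
      rfl rfl (by omega)⟩
    rw [Function.update_idem, Function.update_eq_self_iff]
    simp [hm.carry]
  by_cases hs : signDigit l = 0
  · rw [writeSigned, if_pos hs] at fin
    exact fin ((runs_push _ _ _).mono (by omega)) (by simp [(value_bounds l).1 hs, encodeInt, hout])
  · obtain ⟨c, h3⟩ := runs_borrow (l := l.map fun a => signDigit l * a) (m := Function.update m (.inl .acc)
      ((l.map fun a => signDigit l * a).map dg)) (by simp) (by simp [hm.count])
    have h4 := runs_dropZeros (l := borrowBits 0 (l.map fun a => signDigit l * a))
      (m := Function.update (Function.update (Function.update (Function.update m (.inl .acc)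
      ((l.map fun a => signDigit l * a).map dg)) (.inl .acc) []) (.inl .mult)
        ((borrowBits 0 (l.map fun a => signDigit l * a)).reverse.map bit ++
          Function.update m (.inl .acc) ((l.map fun a => signDigit l * a).map dg) (.inl .mult)))
            (.inl .count) c)
      (by simp [hmult]) (by simp [hout])
    rw [writeSigned, if_neg hs] at fin
    refine fin ((((runs_pour (by simp) _ _).congr rfl ?_ le_rfl).then_one (h3.then_one
      (h4.then_one (runs_push _ _ _)))).mono ?_) ?_
    · funext r
      rcases r with r | z
      · cases r <;> simp [← List.map_eq_flatMap, hm.tmp]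
      · simp
    · simp [length_borrowBits]
      omega
    · simp [encodeInt_value rfl hs]

end Prog

/-! ### Some functions in `FP` -/

/-- The image under `φ` of the string `y` of a pair `⟨y, i⟩`. -/
def firstPart (φ : Bool → Bool) : List Bool → List Bool
  | a :: b :: l => if a = b then φ a :: firstPart φ l else []
  | _ => []

/-- Decoding stops at the separator, whose two bits differ. -/
theorem firstPart_pair (φ : Bool → Bool) (y : List Bool) (i : ℕ) :
    firstPart φ (pair y i) = y.map φ := by
  induction y with
  | nil => simp [pair, firstPart]
  | cons a y ih => simpa [pair, firstPart] using ih

theorem length_firstPart (φ : Bool → Bool) (x : List Bool) :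
    (firstPart φ x).length ≤ x.length := by
  induction x using firstPart.induct with
  | case1 a l ih => simp [firstPart]; omega
  | case2 a b l h => simp [firstPart, h]
  | case3 l h => unfold firstPart; split <;> simp_all

/-- This covers strings that are not pairs, too: composing with this map evaluates a function on
`0*` only, so that nonvanishing on `0*` becomes nonvanishing everywhere. -/
theorem firstPart_false (x : List Bool) :
    firstPart (fun _ => false) x = zeros (firstPart (fun _ => false) x).length := by
  induction x using firstPart.induct with
  | case1 a l ih => simpa [firstPart, zeros, List.replicate_succ] using ih
  | case2 a b l h => simp [firstPart, h, zeros]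
  | case3 l h => unfold firstPart; split <;> simp_all [zeros]

namespace Prog

variable {B Z : Type} [DecidableEq Z]

/-- Write the reversed first part of the input to `base`. -/
def readFirst (φ : Bool → Bool) : Prog (Sym B) (Reg ⊕ Z) :=
  loop (.inl .inp) fun a => case (.inl .inp) skip fun b =>
    if unbit a = unbit b then push (.inl .base) (bit (φ (unbit a))) else clear (.inl .inp)

theorem runs_readFirst (φ : Bool → Bool) {x : List Bool} {m : Reg ⊕ Z → List (Sym B)}
    (hx : m (.inl .inp) = x.map bit) :
    Runs [readFirst φ] m 1 (Function.update (Function.update m (.inl .inp) []) (.inl .base)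
      ((firstPart φ x).reverse.map bit ++ m (.inl .base))) x.length := by
  induction x using firstPart.induct generalizing m with
  | case1 a l ih =>
    refine Runs.mono (t := l.length + 1) (.loop_cons (by rw [hx, List.map_cons]) (.case_cons
      (a := bit a) (l := l.map bit) (by simp) ?_)) (by simp)
    rw [if_pos rfl]
    refine .push ((ih (by simp)).congr rfl ?_ le_rfl)
    funext r
    rcases r with r | z
    · cases r <;> simp [firstPart]
    · simp
  | case2 a b l h =>
    refine Runs.mono (t := l.length + 0 + 1) (.loop_cons (by rw [hx, List.map_cons]) (.case_cons
      (a := bit b) (l := l.map bit) (by simp) ?_)) (by simp)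
    rw [if_neg (by simpa using h)]
    refine (((runs_clear _ _).congr rfl rfl ?_).cons_one (.loop_nil (by simp) (.nil _ _))).congr rfl
      ?_ le_rfl
    · simp
    · funext r
      rcases r with r | z
      · cases r <;> simp [firstPart, h]
      · simp
  | case3 l h =>
    match l, h with
    | [], _ =>
      refine .loop_nil (by simpa using hx) ((Runs.nil _ _).congr rfl ?_ le_rfl)
      rw [List.map_nil] at hx
      funext r
      rcases r with r | z
      · cases r <;> simp [firstPart, hx]
      · simp
    | [a], _ =>
      refine .loop_cons (by rw [hx, List.map_cons]) (.case_nil (by simp) (.skip (.loop_nil (by simp)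
        ((Runs.nil _ _).congr rfl ?_ le_rfl))))
      funext r
      rcases r with r | z
      · cases r <;> simp [firstPart]
      · simp
    | a :: b :: l, h => exact absurd rfl (h a b l)

end Prog

/-- This turns a single target into an indexed family that ignores its index. The string is read in
reverse order, and the pour into `arg` restores it. -/
theorem comp_firstPart_mem_FP {f : List Bool → ℤ} (hf : f ∈ FP) (φ : Bool → Bool) :
    (fun x => f (firstPart φ x)) ∈ FP := by
  classical
  obtain ⟨M, h1, h2, h3⟩ := hf
  obtain ⟨E, hdet, q, hE⟩ := exists_evaluates (M := fun _ : Unit => M) (i := ()) h1 h2 h3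
  have hT : PolyBdd fun n => n + (n + (q.eval n + (q.eval n + q.eval n))) :=
    PolyBdd.id.add (PolyBdd.id.add ((PolyBdd.eval q).add ((PolyBdd.eval q).add (.eval q))))
  have hd : (readFirst φ : Prog (Sym (Symbols fun _ : Unit => M)) (Reg ⊕ Stacks fun _ : Unit => M)).Det := by
    refine fun a => ⟨trivial, fun b => ?_⟩
    dsimp only
    split_ifs
    exacts [det_push _ _, det_clear _]
  refine mem_FP_of_runs (P := readFirst φ ;; pour (.inl .base) (.inl .arg) (fun a => [a]) ;; E ;;
    pour (.inl .arg) (.inl .tmp) (fun a => [a]) ;; pour (.inl .tmp) (.inl .out) fun a => [a])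
    ⟨hd, det_pour _ _ _, hdet, det_pour _ _ _, det_pour _ _ _⟩ bit_injective (.inl .inp) (.inl .out)
    (m' := fun x => Function.update (fun _ => []) (.inl .out)
      ((encodeInt (f (firstPart φ x))).map bit)) (v := fun _ => 1) hT (fun x => ?_) (fun x => by simp)
  obtain ⟨hlen, hrun⟩ := hE (firstPart φ x)
  have hq := (Polynomial.eval_monotone_nat q) (length_firstPart φ x)
  have hx := length_firstPart φ x
  dsimp only at hq
  refine ((runs_readFirst φ (by simp [start])).then_one (((runs_pour (by simp) _ _).congr rfl ?_
    ?_).then_one (((hrun (fun _ => []) ⟨by simp, rfl, rfl, rfl, rfl⟩).mono hq).then_one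
    (((runs_pour (by simp) _ _).mono ?_).then_one ((runs_pour (by simp) _ _).congr rfl ?_ ?_)))))
  · funext r
    rcases r with r | z
    · cases r <;> simp [start]
    · simp [start]
  · simpa [start] using hx
  · simpa using hlen.trans hq
  · funext r
    rcases r with r | z
    · cases r <;> simp
    · simp
  · simpa using hlen.trans hq

theorem zero_mem_FP : (fun _ => 0) ∈ FP := by
  refine mem_FP_of_runs (P := push Reg.out (bit false)) (det_push _ _)
    (bit_injective (B := Empty)) .inp .out (v := fun _ => 1)
    (m' := fun x => Function.update (start bit .inp x) .out [bit false]) (.const 0)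
    (fun x => (runs_push _ _ _).congr rfl (by simp [start]) le_rfl) fun x => by simp [encodeInt]

/-- The product has polynomially many factors of polynomial length, so it can be accumulated in
signed digits and then written in the form of `encodeInt`. -/
theorem prod_mem_FP {fA fR : List Bool → ℤ} (hA : fA ∈ FP) (hR : fR ∈ FP) (c : ℕ) :
    (fun y : List Bool => ∏ j ∈ Finset.range (y.length ^ c + c),
      diffProd fR y (y.length ^ c + c) (fA (pair y (j + 1)))) ∈ FP := by
  classical
  obtain ⟨MA, hA1, hA2, hA3⟩ := hA
  obtain ⟨MR, hR1, hR2, hR3⟩ := hR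
  let M : Fin 2 → TM := ![MA, MR]
  obtain ⟨EA, hdA, qA, hEA⟩ := exists_evaluates (M := M) (i := 0) hA1 hA2 hA3
  obtain ⟨ER, hdR, qR, hER⟩ := exists_evaluates (M := M) (i := 1) hR1 hR2 hR3
  have hr : PolyBdd fun n => n ^ c + c := (PolyBdd.id.pow c).add (.const c)
  obtain ⟨D, hD⟩ : ∃ D : ℕ → ℕ, D = fun n => evalTime qA n (n ^ c + c) + evalTime qR n (n ^ c + c) :=
    ⟨_, rfl⟩
  have hDb : PolyBdd D := hD ▸ (polyBdd_evalTime c qA).add (polyBdd_evalTime c qR)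
  have hL : PolyBdd fun n => 1 + 2 * D n * (n ^ c + c) * (n ^ c + c) :=
    (PolyBdd.const 1).add ((((PolyBdd.const 2).mul hDb).mul hr).mul hr)
  have hN : PolyBdd fun n => 2 * (1 + 2 * D n * (n ^ c + c) * (n ^ c + c)) + 2 * D n + 2 :=
    (((PolyBdd.const 2).mul hL).add ((PolyBdd.const 2).mul hDb)).add (.const 2)
  have hS : PolyBdd fun n => stepTime (D n) (n ^ c + c) :=
    ((PolyBdd.const 4).mul hDb).add ((hDb.mul (((PolyBdd.const 5).mul hN).add (.const 1))).add
      ((PolyBdd.const 3).mul hN))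
  have hT : PolyBdd fun n => 2 * n + (0 + (loopTime c n (loopTime c n (stepTime (D n) (n ^ c + c))) +
      5 * (1 + 2 * D n * (n ^ c + c) * (n ^ c + c)))) :=
    ((PolyBdd.const 2).mul .id).add ((PolyBdd.const 0).add
      ((polyBdd_loopTime c (polyBdd_loopTime c hS)).add ((PolyBdd.const 5).mul hL)))
  have key : ∀ y : List Bool, ∃ m', m' (.inl .out) = (encodeInt (∏ j ∈ Finset.range
      (y.length ^ c + c), diffProd fR y (y.length ^ c + c) (fA (pair y (j + 1))))).map bit ∧
      Runs [setBase id ;; push (.inl .acc) (dg 1) ;; prodLoop c EA ER ;; writeInt]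
        (start bit (.inl .inp) y) 1 m' (2 * y.length + (0 + (loopTime c y.length
          (loopTime c y.length (stepTime (D y.length) (y.length ^ c + c))) +
            5 * (1 + 2 * D y.length * (y.length ^ c + c) * (y.length ^ c + c))))) := by
    intro y
    obtain ⟨h1, h2⟩ := runs_prodLoop hEA hER (ready_baseMem y y) (by simp [baseMem])
      (by simp [baseMem]) (by simp [baseMem]) (by simp [baseMem]) (by simp [baseMem])
      (by simp [baseMem]) (c := c) rfl rfl
    obtain ⟨m', h3, h4⟩ := runs_writeInt (B := Symbols M) (Z := Stacks M)
      (m := Function.update (baseMem y y) (.inl .acc) ((accDigits fA fR y (y.length ^ c + c)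
        (y.length ^ c + c)).map dg)) (l := accDigits fA fR y (y.length ^ c + c)
      (y.length ^ c + c)) ((ready_baseMem y y).idle.update (i := .acc) (by simp) _)
      (Function.update_self _ _ _) (by simp [baseMem]) (by simp [baseMem])
    rw [value_accDigits] at h3
    have h5 := runs_setBase (B := Symbols M) (Z := Stacks M) id y
    rw [List.map_id] at h5
    refine ⟨m', h3, h5.then_one ((runs_push _ _ _).then_one (Runs.then_one (Runs.congr_left
      (m := Function.update (baseMem y y) (.inl .acc) [dg 1]) ?_ ?_)
      (h4.mono ?_)))⟩
    · rw [hD]; exact h2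
    · simp [baseMem]
    · rw [hD]; exact Nat.mul_le_mul_left _ h1
  choose m' h1 h2 using key
  exact mem_FP_of_runs (P := setBase id ;; push (.inl .acc) (dg 1) ;; prodLoop c EA ER ;; writeInt)
    (v := fun _ => 1) ⟨det_dup _ _ _ _, det_push _ _, det_prodLoop hdA hdR,
    det_writeInt⟩ bit_injective _ _ hT h2 h1

/-! ### The classes -/

/-- A vanishing factor would be a common value of the accepting and rejecting targets. -/
theorem prod_diffProd_ne_zero {fA fR : List Bool → ℤ} {y : List Bool} {r : ℕ}
    (h : targets fA y r ∩ targets fR y r = ∅) :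
    ∏ j ∈ Finset.range r, diffProd fR y r (fA (pair y (j + 1))) ≠ 0 := by
  simp only [diffProd, Finset.prod_ne_zero_iff, Finset.mem_range, sub_ne_zero]
  intro j hj i hi he
  have : fA (pair y (j + 1)) ∈ targets fA y r ∩ targets fR y r :=
    ⟨⟨j + 1, by omega, hj, rfl⟩, ⟨i + 1, by omega, hi, he.symm⟩⟩
  rw [h] at this
  exact this

/-- If `a` is the accepting target with index `i`, then the factor for `i` in the second product is
zero. -/
theorem prod_sub_prod_of_mem {fA fR : List Bool → ℤ} {y : List Bool} {r : ℕ} {a : ℤ}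
    (h : a ∈ targets fA y r) :
    ∏ j ∈ Finset.range r, diffProd fR y r (fA (pair y (j + 1))) -
      ∏ j ∈ Finset.range r, (diffProd fR y r (fA (pair y (j + 1))) - diffProd fR y r a) =
    ∏ j ∈ Finset.range r, diffProd fR y r (fA (pair y (j + 1))) := by
  obtain ⟨i, h1, h2, rfl⟩ := h
  -- Targets are numbered from 1, the factors of the product from 0.
  rw [Finset.prod_eq_zero (i := i - 1) (s := Finset.range r)
    (f := fun j => diffProd fR y r (fA (pair y (j + 1))) - _) (by simp; omega), sub_zero]
  rw [Nat.sub_add_cancel h1, sub_self]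

/-- A rejecting target annihilates `diffProd fR y r a`, and the two products coincide. -/
theorem prod_sub_prod_of_mem_right {fA fR : List Bool → ℤ} {y : List Bool} {r : ℕ} {a : ℤ}
    (h : a ∈ targets fR y r) :
    ∏ j ∈ Finset.range r, diffProd fR y r (fA (pair y (j + 1))) -
      ∏ j ∈ Finset.range r, (diffProd fR y r (fA (pair y (j + 1))) - diffProd fR y r a) = 0 := by
  obtain ⟨i, h1, h2, rfl⟩ := h
  have : diffProd fR y r (fR (pair y i)) = 0 :=
    Finset.prod_eq_zero (i := i - 1) (by simp; omega) (by rw [Nat.sub_add_cancel h1, sub_self])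
  simp [this]

theorem map_const_false (x : List Bool) : x.map (fun _ => false) = zeros x.length :=
  List.map_const'

theorem length_zeros (n : ℕ) : (zeros n).length = n := List.length_replicate

theorem polyPolyLWPP_subset_LWPP : PolyPolyLWPP ⊆ LWPP := by
  rintro A ⟨c, -, g, hg, fA, hA, fR, hR, hd, hx⟩
  refine ⟨_, gapDiff_mem_GapP hg hA hR (fun _ => false) c, _, prod_mem_FP hA hR c, fun n => ?_,
    fun x => ⟨fun h => ?_, fun h => ?_⟩⟩
  · rw [length_zeros]
    exact prod_diffProd_ne_zero (hd n)
  · rw [map_const_false, length_zeros]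
    exact prod_sub_prod_of_mem ((hx x).1 h)
  · rw [map_const_false]
    exact prod_sub_prod_of_mem_right ((hx x).2 h)

theorem polyPolyWPP_subset_WPP : PolyPolyWPP ⊆ WPP := by
  rintro A ⟨c, -, g, hg, fA, hA, fR, hR, hd, hx⟩
  refine ⟨_, gapDiff_mem_GapP hg hA hR id c, _, prod_mem_FP hA hR c,
    fun x => prod_diffProd_ne_zero (hd x), fun x => ⟨fun h => ?_, fun h => ?_⟩⟩
  · rw [List.map_id]
    exact prod_sub_prod_of_mem ((hx x).1 h)
  · rw [List.map_id]
    exact prod_sub_prod_of_mem_right ((hx x).2 h)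

theorem LWPP_subset_polyLWPP : LWPP ⊆ PolyLWPP := by
  rintro A ⟨g, hg, f, hf, h0, hx⟩
  refine ⟨1, le_rfl, g, hg, _, comp_firstPart_mem_FP hf fun _ => false, fun y => ?_,
    fun x => ⟨fun h => ⟨1, le_rfl, by dsimp only; omega, ?_⟩, (hx x).2⟩⟩
  -- The indexed class demands a target function without zeros on all strings, whereas `f` is known
  -- to be nonzero only on `0*`.
  · rw [firstPart_false]
    exact h0 _
  · rw [firstPart_pair, map_const_false, length_zeros]
    exact (hx x).1 h

/-- The rejecting targets are all 0, and they are disjoint from the accepting ones because `f` has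
no zeros. Since `c ≥ 1`, the index 1 is always available. -/
theorem polyLWPP_subset_polyPolyLWPP : PolyLWPP ⊆ PolyPolyLWPP := by
  rintro A ⟨c, hc, g, hg, f, hf, h0, hx⟩
  refine ⟨c, hc, g, hg, f, hf, _, zero_mem_FP, fun j => ?_, fun x => ⟨fun h => ?_, fun h =>
    ⟨1, le_rfl, by dsimp only; omega, ((hx x).2 h).symm⟩⟩⟩
  · rw [Set.eq_empty_iff_forall_notMem]
    rintro _ ⟨⟨i, -, -, rfl⟩, ⟨k, -, -, hk⟩⟩
    exact h0 _ hk.symm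
  · obtain ⟨i, h1, h2, h3⟩ := (hx x).1 h
    exact ⟨i, h1, h2, h3.symm⟩

theorem WPP_subset_polyPolyWPP : WPP ⊆ PolyPolyWPP := by
  rintro A ⟨g, hg, f, hf, h0, hx⟩
  refine ⟨1, le_rfl, g, hg, _, comp_firstPart_mem_FP hf id, _, zero_mem_FP, fun y => ?_,
    fun x => ⟨fun h => ⟨1, le_rfl, by dsimp only; omega, ?_⟩, fun h =>
      ⟨1, le_rfl, by dsimp only; omega, ((hx x).2 h).symm⟩⟩⟩
  · rw [Set.eq_empty_iff_forall_notMem]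
    rintro _ ⟨⟨i, -, -, rfl⟩, ⟨k, -, -, hk⟩⟩
    exact h0 _ hk.symm
  · dsimp only
    rw [firstPart_pair, List.map_id]
    exact ((hx x).1 h).symm

end CountingClasses

theorem mainTheorem3 :
    CountingClasses.PolyPolyLWPP = CountingClasses.PolyLWPP ∧
    CountingClasses.PolyPolyLWPP = CountingClasses.LWPP ∧
    CountingClasses.PolyPolyWPP = CountingClasses.WPP := by
  have h1 := CountingClasses.polyPolyLWPP_subset_LWPP
  have h2 := CountingClasses.LWPP_subset_polyLWPP
  have h3 := CountingClasses.polyLWPP_subset_polyPolyLWPP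
  exact ⟨(h1.trans h2).antisymm h3, h1.antisymm (h2.trans h3),
    CountingClasses.polyPolyWPP_subset_WPP.antisymm CountingClasses.WPP_subset_polyPolyWPP⟩
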